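/- **Setting.** Let $M$ be a smooth manifold of dimension $n$ (Hausdorff, second countable), let $\epsilon>0$, and let $g_\rho$, $\rho\in(-\epsilon,\epsilon)$, be a smooth one-parameter family of pseudo-Riemannian metrics on $M$ with $g_0=g$, for instance one for which $\widetilde g=2\rho\,d\tau^2+2\tau\,d\tau\,d\rho+\tau^2g_\rho$ is a straight and normal Fefferman--Graham ambient metric (the Ricci condition on $\widetilde g$ is not needed). Let $\widetilde\Delta$ be the Laplace--Beltrami operator of $\widetilde g$ on $\mathbb{R}_+\times M\times(-\epsilon,\epsilon)$, put $w(\rho)=(\det g_\rho/\det g)^{1/4}$ and $\widetilde\Delta_w=w\circ\widetilde\Delta\circ w^{-1}$. For a function $u$ on $M$, extended so as to be constant in $\tau$ and $\rho$, put $\widetilde{\mathcal M}(\rho)u=\widetilde\Delta_w(u)|_{\tau=1}$, so that $$\widetilde\Delta_w(\tau^\gamma u)=\tau^{\gamma-2}\big[-2\rho\,\partial_\rho^2+(2\gamma+n-2)\,\partial_\rho+\widetilde{\mathcal M}(\rho)\big]u \qquad\text{for } u=u(x,\rho).$$ Define operators $\mathcal M_{2(N+1)}$, $N\ge 0$, on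 functions on $M$ by the Taylor expansion at $\rho=0$ $$\widetilde{\mathcal M}(\rho)=\sum_{N\ge0}\frac{1}{(N!)^2}\Big(-\frac{\rho}{2}\Big)^N\mathcal M_{2(N+1)} .$$ For functions on $M\times(-\epsilon,\epsilon)$ put $\mathcal R_j=-2\rho\,\partial_\rho^2+2j\,\partial_\rho+\widetilde{\mathcal M}(\rho)$ and $\widetilde D_{m,L}=\mathcal R_{L+1-2m}\cdots\mathcal R_{L-3}\mathcal R_{L-1}$ ($m$ factors). For $f\in C^\infty(M\times(-\epsilon,\epsilon))$ and $u\in C^\infty(M)$ put $$D_{[m',L'],[m,L];f}(u)=\widetilde D_{m',L'}\big(f\,\widetilde D_{m,L}(u)\big)\big|_{\rho=0},$$ and for integers $U,V\ge0$ and indeterminates $L,K$ $$D_{U,V,L,K;f}(u)=\sum_{\substack{m,m'\ge0\\ m+m'=U}}\frac{\Gamma(U+K+1)}{\Gamma(m+K+1)\,\Gamma(m'+1)}\cdot\frac{\Gamma(L+m')\,\Gamma(L+V-m')}{\Gamma(L)^2}\;D_{[m',-L-V+2m'],[m,L-K+U];f}(u),$$ where the quotients of Gamma functions are read as rational functions of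 $L$ and $K$. Write $f^{(R)}=\partial_\rho^Rf|_{\rho=0}$. **Statement.** Let $U\ge0$ be an integer and $L$ a real number. 1. If $L+k\ne0$ for $0\le k<U$, then for all $u\in C^\infty(M)$ $$D_{U,U,L,0;f}(u)=\sum_{R,\mathbf A',\mathbf A}\mathcal C_{R}(\mathbf A',\mathbf A)\;\mathcal M_{2(A'_{r'}+1)}\cdots\mathcal M_{2(A'_1+1)}\big(f^{(R)}\,\mathcal M_{2(A_r+1)}\cdots\mathcal M_{2(A_1+1)}(u)\big),$$ where the sum runs over all integers $R\ge0$ and all (possibly empty) sequences $\mathbf A=(A_1,\dots,A_r)$, $\mathbf A'=(A'_1,\dots,A'_{r'})$ of nonnegative integers with $R+r+\sum_{j=1}^{r}A_j+r'+\sum_{j=1}^{r'}A'_j=U$, and $$\begin{aligned}\mathcal C_R(\mathbf A',\mathbf A)={}&(-1)^R\,2^R\,\frac{U!}{R!}\prod_{k=0}^{U-1}(L+k)^2\prod_{i=1}^r\frac1{(A_i!)^2}\prod_{i=1}^{r'}\frac1{(A'_i!)^2}\\&\times\prod_{i=1}^r\frac{1}{\sum_{j=1}^i(A_j+1)}\prod_{i=1}^r\frac{1}{L+U-\sum_{j=1}^i(A_j+1)}\\&\times\prod_{i=1}^{r'}\frac{1}{\sum_{j=1}^i(A'_{r'+1-j}+1)}\prod_{i=1}^{r'}\frac{1}{L+U-\sum_{j=1}^i(A'_{r'+1-j}+1)}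 .\end{aligned}$$ 2. The expansion is symmetric under reversing and swapping the inner and the outer sequence: $\mathcal C_R(\mathbf A',\mathbf A)=\mathcal C_R(\mathbf A^{-1},(\mathbf A')^{-1})$, where $\mathbf A^{-1}=(A_r,\dots,A_1)$. 3. For every real $L$, $D_{U,U,L,0;f}$ is formally self-adjoint: for all compactly supported smooth functions $u,v$ on $M$ (all smooth functions, if $M$ is compact), with respect to the volume measure of $g$ the functions $u\,D_{U,U,L,0;f}(v)$ and $v\,D_{U,U,L,0;f}(u)$ are integrable and $$\int_M u\,D_{U,U,L,0;f}(v)\,\mathrm{dvol}_g=\int_M v\,D_{U,U,L,0;f}(u)\,\mathrm{dvol}_g .$$ -/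

import Mathlib

open Set MeasureTheory
open scoped Manifold ContDiff

noncomputable section

namespace JuhlLinear

/-- The model space `ℝⁿ`. -/
abbrev E (n : ℕ) : Type := EuclideanSpace ℝ (Fin n)

/-! ### One-parameter families of pseudo-Riemannian metrics -/

/-- A field of bilinear forms on the tangent spaces of `M`. -/
abbrev FormField (n : ℕ) (M : Type*) [TopologicalSpace M] [ChartedSpace (E n) M] : Type _ :=
  ∀ x : M, TangentSpace (𝓡 n) x →L[ℝ] TangentSpace (𝓡 n) x →L[ℝ] ℝ

/-- The component matrix `h_{ij} = h(∂_i, ∂_j)` of a field of bilinear forms in a chart `φ`, at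
the point with coordinates `z`. -/
def gram {n : ℕ} {M : Type*} [TopologicalSpace M] [ChartedSpace (E n) M]
    (φ : OpenPartialHomeomorph M (E n)) (h : FormField n M) (z : E n) :
    Matrix (Fin n) (Fin n) ℝ :=
  Matrix.of fun i j =>
    h (φ.symm z) (mfderiv (𝓡 n) (𝓡 n) φ.symm z (EuclideanSpace.single i (1 : ℝ)))
      (mfderiv (𝓡 n) (𝓡 n) φ.symm z (EuclideanSpace.single j (1 : ℝ)))

/-- A smooth one-parameter family `g_ρ`, `ρ ∈ (-ε, ε)`, of pseudo-Riemannian metrics on `M` (of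
any signature). The values for `ρ` outside of `(-ε, ε)` are irrelevant. -/
structure MetricFamily (n : ℕ) (M : Type*) [TopologicalSpace M] [ChartedSpace (E n) M]
    (ε : ℝ) where
  metric : ℝ → FormField n M
  symm : ∀ ρ ∈ Ioo (-ε) ε, ∀ (x : M) (v w : TangentSpace (𝓡 n) x),
    metric ρ x v w = metric ρ x w v
  nondegenerate : ∀ ρ ∈ Ioo (-ε) ε, ∀ (x : M) (v : TangentSpace (𝓡 n) x),
    (∀ w : TangentSpace (𝓡 n) x, metric ρ x v w = 0) → v = 0
  smooth : ∀ (x : M) (i j : Fin n),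
    ContDiffOn ℝ ∞ (fun p : E n × ℝ => gram (chartAt (E n) x) (metric p.2) p.1 i j)
      ((chartAt (E n) x).target ×ˢ Ioo (-ε) ε)

/-- The measure `|det h|^{1/2} dz` of a chart domain, where `h` is a pseudo-Riemannian metric. -/
def chartVolume {n : ℕ} {M : Type*} [TopologicalSpace M] [ChartedSpace (E n) M]
    [MeasurableSpace M] (h : FormField n M) (φ : OpenPartialHomeomorph M (E n)) : Measure M :=
  (((volume : Measure (E n)).restrict φ.target).withDensity
    fun z => ENNReal.ofReal (Real.sqrt |(gram φ h z).det|)).map φ.symm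

/-- The pseudo-Riemannian volume measure: the measures `|det h|^{1/2} dz` of the chart domains
agree on overlaps, and the volume measure is glued from them; as a measure it is their supremum. -/
def riemannianVolume {n : ℕ} {M : Type*} [TopologicalSpace M] [ChartedSpace (E n) M]
    [MeasurableSpace M] (h : FormField n M) : Measure M :=
  ⨆ x : M, chartVolume h (chartAt (E n) x)

/-! ### The ambient Laplacian -/

/-- The partial derivative `∂_i F` on `ℝ^ι`. -/
def pd {ι : Type*} [Fintype ι] [DecidableEq ι] (i : ι) (F : (ι → ℝ) → ℝ) (ξ : ι → ℝ) : ℝ :=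
  fderiv ℝ F ξ (Pi.single i 1)

/-- The Laplace-Beltrami operator of the metric with component matrix `G` in coordinates:
`|det G|^{-1/2} ∑_{i,j} ∂_i (|det G|^{1/2} G^{ij} ∂_j F)`. -/
def coordLaplacian {ι : Type*} [Fintype ι] [DecidableEq ι] (G : (ι → ℝ) → Matrix ι ι ℝ)
    (F : (ι → ℝ) → ℝ) (ξ : ι → ℝ) : ℝ :=
  (Real.sqrt |(G ξ).det|)⁻¹ *
    ∑ i, pd i (fun η => Real.sqrt |(G η).det| * ∑ j, (G η)⁻¹ i j * pd j F η) ξ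

/-- The index set of the coordinates on the ambient space: `Sum.inl i` stands for the `i`-th
coordinate of `M`, `Sum.inr 0` for `τ` and `Sum.inr 1` for `ρ`. -/
abbrev AmbIdx (n : ℕ) : Type := Fin n ⊕ Fin 2

/-- The `M`-part of the ambient coordinates. -/
def baseCoord {n : ℕ} (ξ : AmbIdx n → ℝ) : E n := WithLp.toLp 2 fun i => ξ (Sum.inl i)

/-- The component matrix of the metric `2 ρ dτ² + 2 τ dτ dρ + τ² g_ρ` in the coordinates given by
a chart of `M`, by `τ` and by `ρ`. -/
def ambGram {n : ℕ} {M : Type*} [TopologicalSpace M] [ChartedSpace (E n) M] {ε : ℝ}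
    (g : MetricFamily n M ε) (φ : OpenPartialHomeomorph M (E n)) (ξ : AmbIdx n → ℝ) :
    Matrix (AmbIdx n) (AmbIdx n) ℝ :=
  Matrix.fromBlocks
    (ξ (Sum.inr 0) ^ 2 • gram φ (g.metric (ξ (Sum.inr 1))) (baseCoord ξ)) 0 0
    !![2 * ξ (Sum.inr 1), ξ (Sum.inr 0); ξ (Sum.inr 0), 0]

/-- The Laplacian of the metric `2 ρ dτ² + 2 τ dτ dρ + τ² g_ρ`, acting on functions
`F τ x ρ` on `ℝ₊ × M × (-ε, ε)`. -/
def ambLaplacian {n : ℕ} {M : Type*} [TopologicalSpace M] [ChartedSpace (E n) M] {ε : ℝ}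
    (g : MetricFamily n M ε) (F : ℝ → M → ℝ → ℝ) (τ : ℝ) (x : M) (ρ : ℝ) : ℝ :=
  coordLaplacian (ambGram g (chartAt (E n) x))
    (fun ξ => F (ξ (Sum.inr 0)) ((chartAt (E n) x).symm (baseCoord ξ)) (ξ (Sum.inr 1)))
    (Sum.elim (fun i => chartAt (E n) x x i) ![τ, ρ])

/-- The function `w(ρ) = (det g_ρ / det g_0)^{1/4}` on `M`. The quotient of the determinants does
not depend on the coordinates. -/
def wFun {n : ℕ} {M : Type*} [TopologicalSpace M] [ChartedSpace (E n) M] {ε : ℝ}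
    (g : MetricFamily n M ε) (x : M) (ρ : ℝ) : ℝ :=
  ((gram (chartAt (E n) x) (g.metric ρ) (chartAt (E n) x x)).det /
    (gram (chartAt (E n) x) (g.metric 0) (chartAt (E n) x x)).det) ^ (1 / 4 : ℝ)

/-- The conjugated ambient Laplacian `w ∘ Δ̃ ∘ w⁻¹`. -/
def ambLaplacianW {n : ℕ} {M : Type*} [TopologicalSpace M] [ChartedSpace (E n) M] {ε : ℝ}
    (g : MetricFamily n M ε) (F : ℝ → M → ℝ → ℝ) (τ : ℝ) (x : M) (ρ : ℝ) : ℝ :=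
  wFun g x ρ * ambLaplacian g (fun t y s => (wFun g y s)⁻¹ * F t y s) τ x ρ

/-! ### The operators `M̃(ρ)`, `M_{2(N+1)}` and `R_j` -/

/-- The operator `M̃(ρ)` on functions on `M`. It is the part without `ρ`-derivatives of the
conjugated ambient Laplacian, `Δ̃_w (τ^γ u) = τ^{γ-2} (-2ρ ∂_ρ² + (2γ+n-2) ∂_ρ + M̃(ρ)) u`;
thus `M̃(ρ) u` is the value at `τ = 1` of `Δ̃_w` on the extension of `u` that is constant in `τ`
and in `ρ`. -/
def Mtilde {n : ℕ} {M : Type*} [TopologicalSpace M] [ChartedSpace (E n) M] {ε : ℝ}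
    (g : MetricFamily n M ε) (ρ : ℝ) (u : M → ℝ) (x : M) : ℝ :=
  ambLaplacianW g (fun _ y _ => u y) 1 x ρ

/-- `Mop g N` is the operator `M_{2(N+1)}`, defined by the generating function (Taylor expansion
at `ρ = 0`) `M̃(ρ) = ∑_N (N!)⁻² (-ρ/2)^N M_{2(N+1)}`. -/
def Mop {n : ℕ} {M : Type*} [TopologicalSpace M] [ChartedSpace (E n) M] {ε : ℝ}
    (g : MetricFamily n M ε) (N : ℕ) (u : M → ℝ) (x : M) : ℝ :=
  (N.factorial : ℝ) ^ 2 * (-2) ^ N *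
    (iteratedDeriv N (fun ρ => Mtilde g ρ u x) 0 / (N.factorial : ℝ))

/-- The operator `R_j = -2ρ ∂_ρ² + 2j ∂_ρ + M̃(ρ)` on functions on `M × (-ε, ε)`. -/
def Rop {n : ℕ} {M : Type*} [TopologicalSpace M] [ChartedSpace (E n) M] {ε : ℝ}
    (g : MetricFamily n M ε) (j : ℝ) (F : M → ℝ → ℝ) (x : M) (ρ : ℝ) : ℝ :=
  -2 * ρ * iteratedDeriv 2 (F x) ρ + 2 * j * deriv (F x) ρ + Mtilde g ρ (fun y => F y ρ) x

/-- `Dtilde g m L` is the composition `R_{L+1-2m} ⋯ R_{L-3} R_{L-1}` of `m` operators. -/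
def Dtilde {n : ℕ} {M : Type*} [TopologicalSpace M] [ChartedSpace (E n) M] {ε : ℝ}
    (g : MetricFamily n M ε) : ℕ → ℝ → (M → ℝ → ℝ) → (M → ℝ → ℝ)
  | 0, _, F => F
  | m + 1, L, F => Rop g (L + 1 - 2 * ((m : ℝ) + 1)) (Dtilde g m L F)

/-- The operator `D_{[M',L'],[M,L];f}(u) = D̃_{M',L'}(f D̃_{M,L}(u))|_{ρ=0}`. -/
def Dpair {n : ℕ} {M : Type*} [TopologicalSpace M] [ChartedSpace (E n) M] {ε : ℝ}
    (g : MetricFamily n M ε) (m' : ℕ) (L' : ℝ) (m : ℕ) (L : ℝ) (f : M → ℝ → ℝ)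
    (u : M → ℝ) (x : M) : ℝ :=
  Dtilde g m' L' (fun y ρ => f y ρ * Dtilde g m L (fun y' _ => u y') y ρ) x 0

/-- The quotient `Γ(x + m) / Γ(x)` for an integer `m`, as a rational function of `x`. -/
def gammaQuot (x : ℝ) : ℤ → ℝ
  | Int.ofNat m => ∏ i ∈ Finset.range m, (x + i)
  | Int.negSucc m => ∏ i ∈ Finset.range (m + 1), (x - 1 - i)⁻¹

theorem gammaQuot_eq (x : ℝ) (m : ℤ) (hx : ∀ k : ℤ, x + k ≠ 0) :
    gammaQuot x m = Real.Gamma (x + m) / Real.Gamma x := by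
  have hG : Real.Gamma x ≠ 0 := by
    apply Real.Gamma_ne_zero
    intro k h
    exact hx k (by rw [h]; simp)
  have up : ∀ (m : ℕ) (y : ℝ), (∀ k : ℤ, y + k ≠ 0) →
      (∏ i ∈ Finset.range m, (y + i)) * Real.Gamma y = Real.Gamma (y + m) := by
    intro m y hy
    induction m with
    | zero => simp
    | succ m ih =>
      rw [Finset.prod_range_succ, mul_right_comm, ih, Nat.cast_succ, ← add_assoc,
        Real.Gamma_add_one (by exact_mod_cast hy m), mul_comm]
  rw [eq_div_iff hG]
  cases m with
  | ofNat m => simpa [gammaQuot] using up m x hx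
  | negSucc m =>
    have h := up (m + 1) (x - (m + 1)) (fun k => by
      have := hx (k - (m + 1))
      push_cast at this
      intro h
      exact this (by linarith))
    have h2 : ∏ i ∈ Finset.range (m + 1), (x - (m + 1) + (i : ℝ))
        = ∏ i ∈ Finset.range (m + 1), (x - 1 - (i : ℝ)) := by
      rw [← Finset.prod_range_reflect]
      apply Finset.prod_congr rfl
      intro i hi
      have : i ≤ m := by simpa [Nat.lt_succ_iff] using hi
      rw [show m + 1 - 1 - i = m - i by omega, Nat.cast_sub this]
      ring
    have h3 : ∏ i ∈ Finset.range (m + 1), (x - 1 - (i : ℝ)) ≠ 0 := by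
      rw [Finset.prod_ne_zero_iff]
      intro i _ h
      refine hx (-1 - i) ?_
      push_cast
      linarith
    have e1 : x - ((m : ℝ) + 1) + ((m + 1 : ℕ) : ℝ) = x := by push_cast; ring
    have e2 : x + ((Int.negSucc m : ℤ) : ℝ) = x - (m + 1) := by
      rw [Int.cast_negSucc]; push_cast; ring
    rw [h2, e1] at h
    rw [e2, ← h, gammaQuot, Finset.prod_inv_distrib, ← mul_assoc, inv_mul_cancel₀ h3, one_mul]

/-- The operator `D_{U,V,L,K;f}`, that is
`∑_{M+M'=U} Γ(U+K+1)/(Γ(M+K+1) Γ(M'+1)) · Γ(L+M') Γ(L+V-M')/Γ(L)² ·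
D_{[M',-L-V+2M'],[M,L-K+U];f}`, where `L` and `K` are indeterminates: the quotients of
Gamma functions are read as rational functions of `L` and `K`. -/
def DUVLK {n : ℕ} {M : Type*} [TopologicalSpace M] [ChartedSpace (E n) M] {ε : ℝ}
    (g : MetricFamily n M ε) (U V : ℕ) (L K : ℝ) (f : M → ℝ → ℝ) (u : M → ℝ) (x : M) : ℝ :=
  ∑ p ∈ Finset.HasAntidiagonal.antidiagonal U,
    gammaQuot ((p.1 : ℝ) + K + 1) ((U : ℤ) - p.1) / Real.Gamma ((p.2 : ℝ) + 1) *
      (gammaQuot L p.2 * gammaQuot L ((V : ℤ) - p.2)) *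
      Dpair g p.2 (-L - V + 2 * p.2) p.1 (L - K + U) f u x

/-! ### The explicit expansion -/

/-- The weight `r + ∑_j A_j` of a sequence `A = (A_1, …, A_r)` of nonnegative integers. -/
def weight (A : List ℕ) : ℕ := A.length + A.sum

theorem finite_weight_le (U : ℕ) : {A : List ℕ | weight A ≤ U}.Finite := by
  refine ((List.finite_length_le (Fin (U + 1)) U).image (List.map Fin.val)).subset ?_
  intro A hA
  simp only [weight, mem_ofPred_eq] at hA
  have hlt : ∀ a ∈ A, a < U + 1 := fun a ha => by
    have := List.le_sum_of_mem ha
    omega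
  refine ⟨A.pmap (fun a h => (⟨a, h⟩ : Fin (U + 1))) hlt, ?_, ?_⟩
  · simp only [mem_ofPred_eq, List.length_pmap]; omega
  · simp [List.map_pmap]

theorem finite_index (U : ℕ) :
    {t : ℕ × List ℕ × List ℕ | t.1 + weight t.2.2 + weight t.2.1 = U}.Finite := by
  refine ((finite_le_nat U).prod ((finite_weight_le U).prod (finite_weight_le U))).subset ?_
  rintro ⟨R, A', A⟩ h
  simp only [mem_ofPred_eq] at h
  refine ⟨?_, ?_, ?_⟩ <;> simp only [mem_ofPred_eq] <;> omega

/-- The triples `(R, A', A)` with `R + r + ∑ A_j + r' + ∑ A'_j = U`. -/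
def indexSet (U : ℕ) : Finset (ℕ × List ℕ × List ℕ) := (finite_index U).toFinset

/-- The composition `M_{2(A_r+1)} ⋯ M_{2(A_1+1)}` for `A = (A_1, …, A_r)`. -/
def Mcomp {n : ℕ} {M : Type*} [TopologicalSpace M] [ChartedSpace (E n) M] {ε : ℝ}
    (g : MetricFamily n M ε) (A : List ℕ) (u : M → ℝ) : M → ℝ :=
  A.foldl (fun v a => Mop g a v) u

/-- The partial sum `∑_{j=1}^i (A_j + 1)`. -/
def partialSum (A : List ℕ) (i : ℕ) : ℕ := ((A.take i).map (· + 1)).sum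

/-- The coefficient
`(-1)^R 2^R (U!/R!) ∏_{n<U} (L+n)² ∏_i (A_i!)⁻² ∏_i (A'_i!)⁻²
  ∏_{i≤r} (∑_{j≤i} (A_j+1))⁻¹ ∏_{i≤r} (L+U-∑_{j≤i} (A_j+1))⁻¹
  ∏_{i≤r'} (∑_{j≤i} (A'_{r'+1-j}+1))⁻¹ ∏_{i≤r'} (L+U-∑_{j≤i} (A'_{r'+1-j}+1))⁻¹`. -/
def coeff (U : ℕ) (L : ℝ) (R : ℕ) (A' A : List ℕ) : ℝ :=
  (-1) ^ R * 2 ^ R * ((U.factorial : ℝ) / (R.factorial : ℝ)) *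
    (∏ k ∈ Finset.range U, (L + k) ^ 2) *
    (A.map fun a => 1 / (a.factorial : ℝ) ^ 2).prod *
    (A'.map fun a => 1 / (a.factorial : ℝ) ^ 2).prod *
    (∏ i ∈ Finset.Icc 1 A.length, 1 / (partialSum A i : ℝ)) *
    (∏ i ∈ Finset.Icc 1 A.length, 1 / (L + U - (partialSum A i : ℝ))) *
    (∏ i ∈ Finset.Icc 1 A'.length, 1 / (partialSum A'.reverse i : ℝ)) *
    (∏ i ∈ Finset.Icc 1 A'.length, 1 / (L + U - (partialSum A'.reverse i : ℝ)))

/-- Formal self-adjointness of an operator on functions on `M`, with respect to the volume of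
the pseudo-Riemannian metric `h`: the Dirichlet form `(u, v) ↦ ∫ u D(v) dvol` is (defined and)
symmetric on compactly supported smooth functions; for compact `M` these are all the smooth
functions. -/
def IsFormallySelfAdjoint {n : ℕ} {M : Type*} [TopologicalSpace M] [ChartedSpace (E n) M]
    [MeasurableSpace M] (h : FormField n M) (D : (M → ℝ) → M → ℝ) : Prop :=
  ∀ u v : M → ℝ, ContMDiff (𝓡 n) 𝓘(ℝ) ∞ u → ContMDiff (𝓡 n) 𝓘(ℝ) ∞ v →
    HasCompactSupport u → HasCompactSupport v →
    Integrable (fun x => u x * D v x) (riemannianVolume h) ∧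
    Integrable (fun x => v x * D u x) (riemannianVolume h) ∧
    ∫ x, u x * D v x ∂(riemannianVolume h) = ∫ x, v x * D u x ∂(riemannianVolume h)

end JuhlLinear

end

/-! Taylor expansion at `ρ = 0` turns the identity into algebra. If `M̃(ρ) = ∑ ρ^a P_a`, then `R_j`
sends the coefficients `F_k` to `2(k+1)(j-k) F_{k+1} + ∑_{a+b=k} P_a F_b` (`seqR`). Put `l = L + U`
and `s_k = -2k(l-k)` (`stepFactor`). The formal solution of `R_{l-1} u = 0`, `u_0 = v`, satisfies
`s_{k+1} u_{k+1} = ∑_{a+b=k} P_a u_b`. Hence `u_k` is a sum over sequences of weight `k`, with the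
`s` of the partial sums as denominators (`innerCoeff`); `outerCoeff` is its mirror image. The
quadratic identity `s_{m+k} = s_m - 2k(l-2m-k)` yields two facts: (1) `u_N = ∑_{m+k=N} (s_1⋯s_m)⁻¹
[ρ^k] D̃_{m,l}(v)` (`sum_seqD_const`); (2) `D̃_{m',-l+2m'}(F)|_{ρ=0} = s_1⋯s_{m'} ∑_{p+k=m'}
outer_p(F_k)` (`seqD_outer`). For `K = 0`, `V = U` the Gamma coefficients are, up to a factor
depending only on `U` and `L`, equal to `(s_1⋯s_m)⁻¹ (s_1⋯s_{m'})⁻¹` (`gammaQuot_prefactor`). So (1)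
and (2) collapse the sum over `m + m' = U` to `∑_{p+R+q=U} outer_p(f_R u_q)` (`sum_seqD_pair`).
Rewriting `P_a` in terms of `M_{2(a+1)}` gives the coefficients. The condition on `L` says exactly
that `s_1, …, s_U` are nonzero. The symmetry of the coefficients reflects that the outer factors
mirror the inner ones.

Self-adjointness: `M̃(ρ)` is `w Δ_{g_ρ} w⁻¹` plus a multiplication operator (`Mtilde_eq`), and
`dvol_{g_ρ} = w² dvol_g`. By Green's identity `M̃(ρ)` is symmetric for `dvol_g`, and differentiating
under the integral shows the same for each `P_a`. Transposing a term of the expansion reverses and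
swaps its sequences, which the coefficients permit. The exceptional `L` are finite in number and
follow by continuity in `L`.

The analytic work makes the `P_a` linear maps of smooth functions. At each point the Laplacian is
computed in the preferred chart of that same point, so smoothness rests on chart independence. This
is proved weakly (`lapChart_eq`): against test functions the Laplacian equals minus the integral of
the gradient pairing, which involves first derivatives only and is visibly invariant. In one fixed
chart `M̃(ρ)` is then a finite sum of smooth coefficients times partial derivatives
(`exists_Mtilde_eq`), whence smoothness, linearity, locality and the Leibniz rule in `ρ`. -/

noncomputable section

namespace JuhlLinear

open Finset.HasAntidiagonal (antidiagonal)

/-! ### Sequences of nonnegative integers of given weight -/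

/-- The sequences `A` with `weight A = k`. -/
def listsOfWeight (k : ℕ) : Finset (List ℕ) :=
  ((finite_weight_le k).subset (fun _ hA => le_of_eq hA) : {A | weight A = k}.Finite).toFinset

@[simp]
theorem mem_listsOfWeight {k : ℕ} {A : List ℕ} : A ∈ listsOfWeight k ↔ weight A = k := by
  simp [listsOfWeight]

@[simp]
theorem weight_nil : weight [] = 0 := rfl

@[simp]
theorem weight_cons (a : ℕ) (A : List ℕ) : weight (a :: A) = weight A + a + 1 := by
  simp [weight]; omega

@[simp]
theorem weight_reverse (A : List ℕ) : weight A.reverse = weight A := by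
  simp [weight]

theorem listsOfWeight_zero : listsOfWeight 0 = {[]} := by
  ext A
  cases A <;> simp

section

variable {X : Type*} [AddCommGroup X]

theorem sum_listsOfWeight_reverse (k : ℕ) (G : List ℕ → X) :
    ∑ A ∈ listsOfWeight k, G A.reverse = ∑ A ∈ listsOfWeight k, G A := by
  refine Finset.sum_nbij' List.reverse List.reverse ?_ ?_ ?_ ?_ ?_ <;> simp

/-- An entry `a` contributes `a + 1` to the weight, so removing it from weight `k + 1` leaves `k -
a`. Peeling the head drives the recursion of `outerCoeff`; peeling the last entry drives that of
`innerCoeff`. -/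
theorem sum_listsOfWeight_cons (k : ℕ) (G : List ℕ → X) :
    ∑ A ∈ listsOfWeight (k + 1), G A =
      ∑ p ∈ antidiagonal k, ∑ B ∈ listsOfWeight p.1, G (p.2 :: B) := by
  rw [Finset.sum_sigma']
  symm
  refine Finset.sum_bij' (fun x _ => x.1.2 :: x.2)
    (fun A _ => (⟨(weight A.tail, A.headD 0), A.tail⟩ : (_ : ℕ × ℕ) × List ℕ)) ?_ ?_ ?_ ?_ ?_
  · rintro ⟨⟨a, b⟩, B⟩ h
    simp only [Finset.mem_sigma, Finset.HasAntidiagonal.mem_antidiagonal, mem_listsOfWeight] at h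
    simp; omega
  · rintro (_ | ⟨a, A⟩) h
    · simp at h
    · simp at h ⊢; omega
  · rintro ⟨⟨a, b⟩, B⟩ h
    simp only [Finset.mem_sigma, Finset.HasAntidiagonal.mem_antidiagonal, mem_listsOfWeight] at h
    simp [h.2]
  · rintro (_ | ⟨a, A⟩) h
    · simp at h
    · simp
  · intros; rfl

theorem sum_listsOfWeight_append (k : ℕ) (G : List ℕ → X) :
    ∑ A ∈ listsOfWeight (k + 1), G A =
      ∑ p ∈ antidiagonal k, ∑ B ∈ listsOfWeight p.2, G (B ++ [p.1]) := by
  rw [← sum_listsOfWeight_reverse, sum_listsOfWeight_cons]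
  rw [← Finset.Nat.sum_antidiagonal_swap]
  refine Finset.sum_congr rfl fun p _ => ?_
  simp only [Prod.fst_swap, Prod.snd_swap, List.reverse_cons]
  exact sum_listsOfWeight_reverse p.2 (fun B => G (B ++ [p.1]))

theorem sum_antidiagonal_assoc (n : ℕ) (G : ℕ → ℕ → ℕ → X) :
    ∑ p ∈ antidiagonal n, ∑ q ∈ antidiagonal p.2, G p.1 q.1 q.2 =
      ∑ p ∈ antidiagonal n, ∑ q ∈ antidiagonal p.1, G q.1 q.2 p.2 := by
  simp only [Finset.sum_sigma']
  refine Finset.sum_bij' (fun x _ => ⟨(x.1.1 + x.2.1, x.2.2), (x.1.1, x.2.1)⟩)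
    (fun x _ => ⟨(x.2.1, x.2.2 + x.1.2), (x.2.2, x.1.2)⟩) ?_ ?_ ?_ ?_ ?_ <;>
  · rintro ⟨⟨a, b⟩, ⟨c, d⟩⟩ h
    simp at h ⊢
    try omega

/-- The longer antidiagonal adds one boundary term to each sum, and both vanish. In the applications
`G` carries the factor produced by `∂_ρ` and `H` carries `stepFactor`, each zero at index `0`. -/
theorem sum_antidiagonal_shift (n : ℕ) (G H : ℕ → ℕ → X) (hG : ∀ k, G k 0 = 0)
    (hH : ∀ k, H 0 k = 0) :
    ∑ p ∈ antidiagonal n, G p.1 (p.2 + 1) + ∑ p ∈ antidiagonal n, H (p.1 + 1) p.2 =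
      ∑ p ∈ antidiagonal (n + 1), (G p.1 p.2 + H p.1 p.2) := by
  rw [Finset.sum_add_distrib, Finset.Nat.sum_antidiagonal_succ' (f := fun p => G p.1 p.2),
    Finset.Nat.sum_antidiagonal_succ (f := fun p => H p.1 p.2), hG, hH, zero_add, zero_add]

/-- A sum over the index set of the expansion, as an iterated sum. -/
theorem sum_indexSet (U : ℕ) (G : ℕ → List ℕ → List ℕ → X) :
    ∑ t ∈ indexSet U, G t.1 t.2.1 t.2.2 =
      ∑ p ∈ antidiagonal U, ∑ q ∈ antidiagonal p.2,
        ∑ A' ∈ listsOfWeight p.1, ∑ A ∈ listsOfWeight q.2, G q.1 A' A := by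
  simp only [Finset.sum_sigma']
  refine Finset.sum_bij'
    (fun t _ => ⟨(weight t.2.1, t.1 + weight t.2.2), ⟨(t.1, weight t.2.2), ⟨t.2.1, t.2.2⟩⟩⟩)
    (fun x _ => (x.2.1.1, x.2.2.1, x.2.2.2)) ?_ ?_ ?_ ?_ ?_
  · rintro ⟨R, A', A⟩ h
    simp [indexSet] at h ⊢
    omega
  · rintro ⟨⟨a, b⟩, ⟨c, d⟩, A', A⟩ h
    simp [indexSet] at h ⊢
    omega
  · intros; rfl
  · rintro ⟨⟨a, b⟩, ⟨c, d⟩, A', A⟩ h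
    simp at h
    obtain ⟨h1, h2, h3, h4⟩ := h
    simp [h3, h4, h2]
  · intros; rfl

end

theorem partialSum_append {A : List ℕ} {i : ℕ} (hi : i ≤ A.length) (B : List ℕ) :
    partialSum (A ++ B) i = partialSum A i := by
  simp [partialSum, List.take_append_of_le_length hi]

theorem partialSum_length (A : List ℕ) : partialSum A A.length = weight A := by
  rw [partialSum, List.take_length]
  induction A with
  | nil => rfl
  | cons a A ih => simp [ih]; omega

/-- The coefficient `∏_i x (∑_{j ≤ i} (A_j + 1))`. -/
def stepProd (x : ℕ → ℝ) (A : List ℕ) : ℝ := ∏ i ∈ Finset.Icc 1 A.length, x (partialSum A i)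

@[simp]
theorem stepProd_nil (x : ℕ → ℝ) : stepProd x [] = 1 := by simp [stepProd]

/-- The earlier partial sums are unaffected and the only new one is the total weight; hence the
one-step recursions below. -/
theorem stepProd_append (x : ℕ → ℝ) (A : List ℕ) (a : ℕ) :
    stepProd x (A ++ [a]) = stepProd x A * x (weight A + a + 1) := by
  rw [stepProd, List.length_append, List.length_singleton,
    Finset.prod_Icc_succ_top (by omega)]
  congr 1
  · refine Finset.prod_congr rfl fun i hi => ?_
    rw [partialSum_append (Finset.mem_Icc.1 hi).2]
  · have := partialSum_length (A ++ [a])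
    rw [List.length_append, List.length_singleton] at this
    rw [this]
    congr 1
    simp [weight]; omega

/-! ### The operators on Taylor coefficients -/

section

variable {X : Type*} [AddCommGroup X] [Module ℝ X] (P : ℕ → X →ₗ[ℝ] X)

/-- The operator `-2ρ ∂_ρ² + 2j ∂_ρ + ∑_a ρ^a P_a` on Taylor coefficients. -/
def seqR (j : ℝ) (F : ℕ → X) (k : ℕ) : X :=
  (2 * ((k : ℝ) + 1) * (j - k)) • F (k + 1) + ∑ p ∈ antidiagonal k, P p.1 (F p.2)

/-- The composition `R_{L+1-2m} ⋯ R_{L-3} R_{L-1}` on Taylor coefficients. -/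
def seqD : ℕ → ℝ → (ℕ → X) → (ℕ → X)
  | 0, _, F => F
  | m + 1, L, F => seqR P (L + 1 - 2 * ((m : ℝ) + 1)) (seqD m L F)

/-- The definition peels off the outermost factor. Here the innermost one is peeled off, the factor
that meets `F` in the induction of `seqD_outer`. -/
theorem seqD_succ' (m : ℕ) (L : ℝ) (F : ℕ → X) :
    seqD P (m + 1) L F = seqD P m (L - 2) (seqR P (L - 1) F) := by
  induction m with
  | zero => simp only [seqD]; congr 1; push_cast; ring
  | succ m ih =>
    rw [seqD, ih]
    conv_rhs => rw [seqD]
    congr 1; push_cast; ring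

/-- The factor `-2k(l - k)` which `ρ^k` picks up under `R_{l-1}`, up to sign. -/
def stepFactor (l : ℝ) (k : ℕ) : ℝ := -2 * k * (l - k)

/-- The composition of the operators `P_a` along a sequence. -/
def seqComp (A : List ℕ) (v : X) : X := A.foldl (fun v a => P a v) v

theorem seqComp_append (A B : List ℕ) (v : X) :
    seqComp P (A ++ B) v = seqComp P B (seqComp P A v) := List.foldl_append

/-- The coefficient `u_k` of the formal solution `∑ ρ^k u_k` of `R_{l-1} u = 0` with `u_0 = v`. -/
def innerCoeff (l : ℝ) (k : ℕ) (v : X) : X :=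
  ∑ A ∈ listsOfWeight k, stepProd (fun i => (stepFactor l i)⁻¹) A • seqComp P A v

/-- The mirror image of `innerCoeff`. -/
def outerCoeff (l : ℝ) (k : ℕ) (v : X) : X :=
  ∑ A ∈ listsOfWeight k, stepProd (fun i => (stepFactor l i)⁻¹) A.reverse • seqComp P A v

theorem innerCoeff_zero (l : ℝ) (v : X) : innerCoeff P l 0 v = v := by
  simp [innerCoeff, listsOfWeight_zero, seqComp]

theorem outerCoeff_zero (l : ℝ) (v : X) : outerCoeff P l 0 v = v := by
  simp [outerCoeff, listsOfWeight_zero, seqComp]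

/-- The last entry is the operator applied last, and its partial sum is the full weight `k + 1`, so
its factor is common to all sequences. This is the recursion expressing `R_{l-1} u = 0`. -/
theorem innerCoeff_succ (l : ℝ) (k : ℕ) (v : X) :
    innerCoeff P l (k + 1) v =
      (stepFactor l (k + 1))⁻¹ • ∑ p ∈ antidiagonal k, P p.1 (innerCoeff P l p.2 v) := by
  rw [innerCoeff, sum_listsOfWeight_append, Finset.smul_sum]
  refine Finset.sum_congr rfl fun p hp => ?_
  rw [innerCoeff, map_sum, Finset.smul_sum]
  refine Finset.sum_congr rfl fun B hB => ?_
  rw [stepProd_append, seqComp_append, mem_listsOfWeight.1 hB, map_smul, smul_smul, mul_comm,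
    ← Finset.HasAntidiagonal.mem_antidiagonal.1 hp, add_comm p.1 p.2]
  rfl

/-- Since the factors are read along the reversed sequence, the full weight now belongs to the head,
that is, to the operator applied first. -/
theorem outerCoeff_succ (l : ℝ) (k : ℕ) (v : X) :
    outerCoeff P l (k + 1) v =
      (stepFactor l (k + 1))⁻¹ • ∑ p ∈ antidiagonal k, outerCoeff P l p.1 (P p.2 v) := by
  rw [outerCoeff, sum_listsOfWeight_cons, Finset.smul_sum]
  refine Finset.sum_congr rfl fun p hp => ?_
  rw [outerCoeff, Finset.smul_sum]
  refine Finset.sum_congr rfl fun B hB => ?_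
  rw [List.reverse_cons, stepProd_append, weight_reverse, mem_listsOfWeight.1 hB, smul_smul,
    mul_comm, ← Finset.HasAntidiagonal.mem_antidiagonal.1 hp]
  rfl

theorem outerCoeff_add (l : ℝ) (k : ℕ) (v w : X) :
    outerCoeff P l k (v + w) = outerCoeff P l k v + outerCoeff P l k w := by
  have h : ∀ A : List ℕ, seqComp P A (v + w) = seqComp P A v + seqComp P A w := by
    intro A
    induction A generalizing v w with
    | nil => rfl
    | cons a A ih => simpa [seqComp] using ih (P a v) (P a w)
  simp [outerCoeff, h, Finset.sum_add_distrib]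

theorem outerCoeff_smul (l : ℝ) (k : ℕ) (c : ℝ) (v : X) :
    outerCoeff P l k (c • v) = c • outerCoeff P l k v := by
  have h : ∀ A : List ℕ, seqComp P A (c • v) = c • seqComp P A v := by
    intro A
    induction A generalizing v with
    | nil => rfl
    | cons a A ih => simpa [seqComp] using ih (P a v)
  simp [outerCoeff, h, Finset.smul_sum, smul_comm c]

/-- `outerCoeff` as a linear map. -/
def outerMap (l : ℝ) (k : ℕ) : X →ₗ[ℝ] X where
  toFun := outerCoeff P l k
  map_add' := outerCoeff_add P l k
  map_smul' := outerCoeff_smul P l k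

/-- The product `∏_{k=1}^m (-2k(l - k))`. -/
def stepNorm (l : ℝ) (m : ℕ) : ℝ := ∏ i ∈ Finset.range m, stepFactor l (i + 1)

theorem stepNorm_succ (l : ℝ) (m : ℕ) :
    stepNorm l (m + 1) = stepNorm l m * stepFactor l (m + 1) := Finset.prod_range_succ _ _

/-- Induction on `m` for all `F`: peeling off the innermost factor lowers the parameter by `2`,
which keeps the form `-l + 2m` with the same `l`. The coefficient of `outer_k(F_K)` with `k + K = m
+ 1` collects `2K(-l + 2(m+1) - K)` from the derivatives and `s_k` from the `P_a`. The total is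
`s_{m+1}`, independent of the splitting. -/
theorem seqD_outer (l : ℝ) (m : ℕ) (hl : ∀ k < m, stepFactor l (k + 1) ≠ 0) (F : ℕ → X) :
    seqD P m (-l + 2 * m) F 0 =
      stepNorm l m • ∑ p ∈ antidiagonal m, outerCoeff P l p.1 (F p.2) := by
  induction m generalizing F with
  | zero => simp [seqD, stepNorm, outerCoeff_zero]
  | succ m ih =>
    have e : -l + 2 * ((m + 1 : ℕ) : ℝ) - 2 = -l + 2 * m := by push_cast; ring
    rw [seqD_succ', e, ih (fun k hk => hl k (by omega)), stepNorm_succ, mul_smul]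
    congr 1
    have hR : ∀ p ∈ antidiagonal m,
        outerCoeff P l p.1 (seqR P (-l + 2 * ((m + 1 : ℕ) : ℝ) - 1) F p.2) =
          (2 * ((p.2 : ℝ) + 1) * (-l + 2 * ((m + 1 : ℕ) : ℝ) - 1 - p.2)) •
            outerCoeff P l p.1 (F (p.2 + 1)) +
          ∑ q ∈ antidiagonal p.2, outerCoeff P l p.1 (P q.1 (F q.2)) := by
      intro p _
      rw [seqR, outerCoeff_add, outerCoeff_smul]
      congr 1
      exact map_sum (outerMap P l p.1) _ _
    rw [Finset.sum_congr rfl hR, Finset.sum_add_distrib]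
    -- Grouped by the coefficient of `F`, the inner sums are `outerCoeff_succ` read backwards.
    have h2 : ∑ p ∈ antidiagonal m, ∑ q ∈ antidiagonal p.2, outerCoeff P l p.1 (P q.1 (F q.2)) =
        ∑ p ∈ antidiagonal m, stepFactor l (p.1 + 1 : ℕ) • outerCoeff P l (p.1 + 1) (F p.2) := by
      rw [sum_antidiagonal_assoc m (fun a b c => outerCoeff P l a (P b (F c)))]
      refine Finset.sum_congr rfl fun p hp => ?_
      have : p.1 < m + 1 := by
        have := Finset.HasAntidiagonal.mem_antidiagonal.1 hp; omega
      rw [outerCoeff_succ, smul_smul, mul_inv_cancel₀ (hl _ this), one_smul]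
    have h3 := sum_antidiagonal_shift m
      (fun k K => (2 * (K : ℝ) * (-l + 2 * ((m + 1 : ℕ) : ℝ) - K)) • outerCoeff P l k (F K))
      (fun k K => stepFactor l k • outerCoeff P l k (F K)) (by simp) (by simp [stepFactor])
    rw [h2, Finset.smul_sum]
    convert h3 using 3 with p hp p hp
    · push_cast; ring_nf
    · rw [← add_smul]
      have := Finset.HasAntidiagonal.mem_antidiagonal.1 hp
      congr 1
      have h4 : ((m : ℝ) + 1) = p.1 + p.2 := by exact_mod_cast this.symm
      simp only [stepFactor]
      push_cast
      rw [h4]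
      ring

/-- The coefficients of the formal solution of `R_{l-1} u = 0` in terms of the compositions
`R_{l+1-2m} ⋯ R_{l-1}`. -/
theorem sum_seqD_const (l : ℝ) (N : ℕ) (hl : ∀ k < N, stepFactor l (k + 1) ≠ 0) (v : X) :
    ∑ p ∈ antidiagonal N, (stepNorm l p.1)⁻¹ • seqD P p.1 l (fun k => if k = 0 then v else 0) p.2 =
      innerCoeff P l N v := by
  -- The Taylor coefficients of the extension of `v` that is constant in `ρ`.
  set F : ℕ → X := fun k => if k = 0 then v else 0 with hF
  induction N using Nat.strong_induction_on with
  | _ N ih =>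
  rcases N with _ | N
  · simp [stepNorm, seqD, innerCoeff_zero, hF]
  have hne : ∀ m ≤ N + 1, stepNorm l m ≠ 0 := fun m hm =>
    Finset.prod_ne_zero_iff.2 fun i hi => by
      exact_mod_cast hl i (by have := Finset.mem_range.1 hi; omega)
  have h1 : ∀ p ∈ antidiagonal N, P p.1 (innerCoeff P l p.2 v) =
      ∑ q ∈ antidiagonal p.2, (stepNorm l q.1)⁻¹ • P p.1 (seqD P q.1 l F q.2) := by
    intro p hp
    have := Finset.HasAntidiagonal.mem_antidiagonal.1 hp
    rw [← ih p.2 (by omega) (fun k hk => hl k (by omega)), map_sum]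
    simp only [map_smul]
  have h2 : ∑ p ∈ antidiagonal N, P p.1 (innerCoeff P l p.2 v) =
      ∑ p ∈ antidiagonal N, (stepNorm l p.1)⁻¹ • ∑ q ∈ antidiagonal p.2,
        P q.1 (seqD P p.1 l F q.2) := by
    rw [Finset.sum_congr rfl h1,
      sum_antidiagonal_assoc N (fun a b c => (stepNorm l b)⁻¹ • P a (seqD P b l F c))]
    simp only [Finset.smul_sum]
    rw [sum_antidiagonal_assoc N (fun b a c => (stepNorm l b)⁻¹ • P a (seqD P b l F c))]
    refine Finset.sum_congr rfl fun p _ => ?_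
    exact (Finset.Nat.sum_antidiagonal_swap
      (f := fun q => (stepNorm l q.2)⁻¹ • P q.1 (seqD P q.2 l F p.2))).symm
  -- The `P`-part of `R_{l-1-2m}` is the whole operator minus its derivative part, and the whole
  -- operator turns `D̃_{m,l}` into `D̃_{m+1,l}`. The second prefactor is written with index `m + 1`
  -- to match `sum_antidiagonal_shift`.
  have h3 : ∀ p ∈ antidiagonal N, (stepNorm l p.1)⁻¹ • ∑ q ∈ antidiagonal p.2,
        P q.1 (seqD P p.1 l F q.2) =
      (-(2 * ((p.2 : ℝ) + 1) * (l - 1 - 2 * p.1 - p.2)) * (stepNorm l p.1)⁻¹) •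
          seqD P p.1 l F (p.2 + 1) +
        (stepFactor l (p.1 + 1 : ℕ) * (stepNorm l (p.1 + 1))⁻¹) • seqD P (p.1 + 1) l F p.2 := by
    intro p hp
    have := Finset.HasAntidiagonal.mem_antidiagonal.1 hp
    have e1 : stepFactor l (p.1 + 1 : ℕ) * (stepNorm l (p.1 + 1))⁻¹ = (stepNorm l p.1)⁻¹ := by
      rw [stepNorm_succ, mul_inv, mul_left_comm, mul_inv_cancel₀ (hl _ (by omega)), mul_one]
    rw [e1, seqD, seqR, smul_add, smul_smul, ← add_assoc, ← add_smul]
    convert (zero_add _).symm using 2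
    convert zero_smul ℝ _ using 2
    ring
  have h4 := sum_antidiagonal_shift N
      (fun m k => (-(2 * (k : ℝ) * (l - 2 * m - k)) * (stepNorm l m)⁻¹) • seqD P m l F k)
      (fun m k => (stepFactor l m * (stepNorm l m)⁻¹) • seqD P m l F k) (by simp)
      (by simp [stepFactor])
  rw [innerCoeff_succ, h2, Finset.sum_congr rfl h3, Finset.sum_add_distrib]
  have h5 : ∑ p ∈ antidiagonal N, (-(2 * ((p.2 : ℝ) + 1) * (l - 1 - 2 * p.1 - p.2)) *
      (stepNorm l p.1)⁻¹) • seqD P p.1 l F (p.2 + 1) = ∑ p ∈ antidiagonal N,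
      (-(2 * ((p.2 + 1 : ℕ) : ℝ) * (l - 2 * p.1 - (p.2 + 1 : ℕ))) * (stepNorm l p.1)⁻¹) •
        seqD P p.1 l F (p.2 + 1) := by
    refine Finset.sum_congr rfl fun p _ => ?_
    congr 3
    push_cast; ring
  rw [h5, h4, Finset.smul_sum]
  refine Finset.sum_congr rfl fun p hp => ?_
  have hp' : ((N : ℝ) + 1) = p.1 + p.2 := by
    exact_mod_cast (Finset.HasAntidiagonal.mem_antidiagonal.1 hp).symm
  -- The identity `s_m - 2k(l-2m-k) = s_{m+k}` with `m + k = N + 1`; the result cancels against the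
  -- factor of `innerCoeff_succ`.
  have e : -(2 * (p.2 : ℝ) * (l - 2 * p.1 - p.2)) * (stepNorm l p.1)⁻¹ +
      stepFactor l p.1 * (stepNorm l p.1)⁻¹ = stepFactor l (N + 1 : ℕ) * (stepNorm l p.1)⁻¹ := by
    simp only [stepFactor]
    push_cast
    rw [hp']
    ring
  rw [← add_smul, e, smul_smul, ← mul_assoc, inv_mul_cancel₀ (hl N (by omega)), one_mul]

/-- The formal version of the explicit expansion: `f` acts through its Taylor coefficients. -/
theorem sum_seqD_pair (U : ℕ) (l : ℝ) (hl : ∀ k < U, stepFactor l (k + 1) ≠ 0)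
    (f : ℕ → X →ₗ[ℝ] X) (v : X) :
    ∑ p ∈ antidiagonal U, (stepNorm l p.1)⁻¹ • (stepNorm l p.2)⁻¹ •
        seqD P p.2 (-l + 2 * p.2) (fun k => ∑ q ∈ antidiagonal k,
          f q.1 (seqD P p.1 l (fun k => if k = 0 then v else 0) q.2)) 0 =
      ∑ p ∈ antidiagonal U, ∑ q ∈ antidiagonal p.2,
        outerCoeff P l p.1 (f q.1 (innerCoeff P l q.2 v)) := by
  set F : ℕ → X := fun k => if k = 0 then v else 0 with hF
  have hne : ∀ m ≤ U, stepNorm l m ≠ 0 := fun m hm =>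
    Finset.prod_ne_zero_iff.2 fun i hi => by
      exact_mod_cast hl i (by have := Finset.mem_range.1 hi; omega)
  have h1 : ∀ p ∈ antidiagonal U, (stepNorm l p.1)⁻¹ • (stepNorm l p.2)⁻¹ •
        seqD P p.2 (-l + 2 * p.2) (fun k => ∑ q ∈ antidiagonal k, f q.1 (seqD P p.1 l F q.2)) 0 =
      ∑ p' ∈ antidiagonal p.2, (stepNorm l p.1)⁻¹ • ∑ q ∈ antidiagonal p'.2,
        outerCoeff P l p'.1 (f q.1 (seqD P p.1 l F q.2)) := by
    intro p hp
    have := Finset.HasAntidiagonal.mem_antidiagonal.1 hp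
    rw [seqD_outer P l p.2 (fun k hk => hl k (by omega)), smul_smul (stepNorm l p.2)⁻¹,
      inv_mul_cancel₀ (hne _ (by omega)), one_smul, Finset.smul_sum]
    refine Finset.sum_congr rfl fun p' _ => ?_
    congr 1
    exact map_sum (outerMap P l p'.1) _ _
  rw [Finset.sum_congr rfl h1, sum_antidiagonal_assoc U (fun a b c => (stepNorm l a)⁻¹ •
    ∑ q ∈ antidiagonal c, outerCoeff P l b (f q.1 (seqD P a l F q.2)))]
  have h2 : ∀ p ∈ antidiagonal U, ∀ q ∈ antidiagonal p.2,
      outerCoeff P l p.1 (f q.1 (innerCoeff P l q.2 v)) = ∑ r ∈ antidiagonal q.2,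
        (stepNorm l r.1)⁻¹ • outerCoeff P l p.1 (f q.1 (seqD P r.1 l F r.2)) := by
    intro p hp q hq
    have := Finset.HasAntidiagonal.mem_antidiagonal.1 hp
    have := Finset.HasAntidiagonal.mem_antidiagonal.1 hq
    rw [← sum_seqD_const P l q.2 (fun k hk => hl k (by omega)), map_sum]
    rw [show ∀ w, outerCoeff P l p.1 w = outerMap P l p.1 w from fun _ => rfl, map_sum]
    refine Finset.sum_congr rfl fun r _ => ?_
    rw [map_smul, map_smul]
    rfl
  rw [Finset.sum_congr rfl fun p hp => Finset.sum_congr rfl (h2 p hp)]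
  -- Both sides are the sum of `G a k R c` over `a + k + R + c = U`: on the left by (2), on the
  -- right by (1). What remains is reassociation.
  set G : ℕ → ℕ → ℕ → ℕ → X := fun a k R c =>
    (stepNorm l a)⁻¹ • outerCoeff P l k (f R (seqD P a l F c)) with hG
  calc _ = ∑ p ∈ antidiagonal U, ∑ q ∈ antidiagonal p.1, ∑ r ∈ antidiagonal p.2,
        G q.1 q.2 r.1 r.2 := by simp only [Finset.smul_sum, hG]
    _ = ∑ p ∈ antidiagonal U, ∑ q ∈ antidiagonal p.1, ∑ r ∈ antidiagonal p.2,
        G q.2 q.1 r.1 r.2 := by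
        refine Finset.sum_congr rfl fun p _ => ?_
        exact (Finset.Nat.sum_antidiagonal_swap
          (f := fun q : ℕ × ℕ => ∑ r ∈ antidiagonal p.2, G q.2 q.1 r.1 r.2))
    _ = ∑ p ∈ antidiagonal U, ∑ q ∈ antidiagonal p.2, ∑ r ∈ antidiagonal q.2,
        G q.1 p.1 r.1 r.2 :=
        (sum_antidiagonal_assoc U fun a b c => ∑ r ∈ antidiagonal c, G b a r.1 r.2).symm
    _ = _ := by
        refine Finset.sum_congr rfl fun p _ => ?_
        rw [sum_antidiagonal_assoc p.2 fun a b c => G a p.1 b c,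
          sum_antidiagonal_assoc p.2 fun a b c => G b p.1 a c]
        refine Finset.sum_congr rfl fun q _ => ?_
        exact (Finset.Nat.sum_antidiagonal_swap (f := fun r : ℕ × ℕ => G r.2 p.1 r.1 q.2))

end

/-! ### Smoothness in charts -/

section

variable (n : ℕ) {M : Type*} [TopologicalSpace M] [ChartedSpace (E n) M]

/-- A function on `M` whose coordinate expressions in the preferred charts are smooth. -/
def ChartSmooth (u : M → ℝ) : Prop :=
  ∀ x : M, ContDiffOn ℝ ∞ (u ∘ (chartAt (E n) x).symm) (chartAt (E n) x).target

/-- A function on `M × (-ε, ε)` whose coordinate expressions are smooth. -/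
def ChartSmoothFam (ε : ℝ) (F : M → ℝ → ℝ) : Prop :=
  ∀ x : M, ContDiffOn ℝ ∞ (fun p : E n × ℝ => F ((chartAt (E n) x).symm p.1) p.2)
    ((chartAt (E n) x).target ×ˢ Ioo (-ε) ε)

/-- The coordinate change between two preferred charts. -/
def trans (x y : M) : E n → E n := chartAt (E n) y ∘ (chartAt (E n) x).symm

/-- The domain of the coordinate change between two preferred charts. -/
def transDom (x y : M) : Set (E n) :=
  (chartAt (E n) x).target ∩ (chartAt (E n) x).symm ⁻¹' (chartAt (E n) y).source

variable {n}

theorem isOpen_transDom (x y : M) : IsOpen (transDom n x y) :=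
  (chartAt (E n) x).isOpen_inter_preimage_symm (chartAt (E n) y).open_source

theorem trans_symm {x y : M} {z : E n} (hz : z ∈ transDom n x y) :
    (chartAt (E n) y).symm (trans n x y z) = (chartAt (E n) x).symm z :=
  (chartAt (E n) y).left_inv hz.2

theorem trans_mem_target {x y : M} {z : E n} (hz : z ∈ transDom n x y) :
    trans n x y z ∈ (chartAt (E n) y).target :=
  (chartAt (E n) y).map_source hz.2

theorem trans_mem_transDom {x y : M} {z : E n} (hz : z ∈ transDom n x y) :
    trans n x y z ∈ transDom n y x := by
  refine ⟨trans_mem_target hz, ?_⟩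
  rw [mem_preimage, trans_symm hz]
  exact (chartAt (E n) x).map_target hz.1

theorem mem_transDom {x y p : M} (h1 : p ∈ (chartAt (E n) x).source)
    (h2 : p ∈ (chartAt (E n) y).source) : chartAt (E n) x p ∈ transDom n x y :=
  ⟨(chartAt (E n) x).map_source h1, by
    rw [mem_preimage, (chartAt (E n) x).left_inv h1]; exact h2⟩

theorem trans_chartAt {x y p : M} (h1 : p ∈ (chartAt (E n) x).source) :
    trans n x y (chartAt (E n) x p) = chartAt (E n) y p := by
  simp [trans, (chartAt (E n) x).left_inv h1]

theorem injOn_trans (x y : M) : InjOn (trans n x y) (transDom n x y) := by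
  intro z hz z' hz' h
  have := congrArg (chartAt (E n) y).symm h
  rw [trans_symm hz, trans_symm hz'] at this
  exact (chartAt (E n) x).symm.injOn hz.1 hz'.1 this

theorem eventually_trans_symm {x y : M} {z : E n} (hz : z ∈ transDom n x y) :
    (chartAt (E n) x).symm =ᶠ[nhds z] (chartAt (E n) y).symm ∘ trans n x y :=
  Filter.eventuallyEq_of_mem ((isOpen_transDom x y).mem_nhds hz) fun _ h => (trans_symm h).symm

theorem ChartSmooth.continuous {u : M → ℝ} (hu : ChartSmooth n u) : Continuous u := by
  rw [continuous_iff_continuousAt]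
  intro x
  have hx := mem_chart_target (E n) x
  have h := (((hu x).contDiffAt ((chartAt (E n) x).open_target.mem_nhds hx)).continuousAt)
  rw [(chartAt (E n) x).symm.continuousAt_iff_continuousAt_comp_right (x := x)
    (mem_chart_source _ x)]
  exact h

/-! ### Components of a metric -/

/-- The Jacobian matrix of a coordinate change. -/
def jac (x y : M) (z : E n) : Matrix (Fin n) (Fin n) ℝ :=
  Matrix.of fun k i => fderiv ℝ (trans n x y) z (EuclideanSpace.single i (1 : ℝ)) k

theorem det_jac (x y : M) (z : E n) :
    (jac x y z).det = (fderiv ℝ (trans n x y) z).det := by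
  rw [ContinuousLinearMap.det, ← LinearMap.det_toMatrix (EuclideanSpace.basisFun (Fin n) ℝ).toBasis]
  congr 1

theorem euclidean_eq_sum (v : E n) :
    v = ∑ k, v k • EuclideanSpace.single k (1 : ℝ) := by
  have := (EuclideanSpace.basisFun (Fin n) ℝ).sum_repr v
  simpa using this.symm

/-- A smooth pseudo-Riemannian metric. -/
structure IsMetric (h : FormField n M) : Prop where
  symm : ∀ (x : M) (v w : TangentSpace (𝓡 n) x), h x v w = h x w v
  nondegenerate : ∀ (x : M) (v : TangentSpace (𝓡 n) x),
    (∀ w : TangentSpace (𝓡 n) x, h x v w = 0) → v = 0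
  smooth : ∀ (x : M) (i j : Fin n),
    ContDiffOn ℝ ∞ (fun z : E n => gram (chartAt (E n) x) h z i j) (chartAt (E n) x).target

theorem MetricFamily.isMetric {ε : ℝ} (g : MetricFamily n M ε) {ρ : ℝ} (hρ : ρ ∈ Ioo (-ε) ε) :
    IsMetric (g.metric ρ) where
  symm := g.symm ρ hρ
  nondegenerate := g.nondegenerate ρ hρ
  smooth x i j := (g.smooth x i j).comp (f := fun z : E n => (z, ρ))
    (contDiffOn_id.prodMk contDiffOn_const) fun _ hz => ⟨hz, hρ⟩

theorem IsMetric.gram_isSymm {h : FormField n M} (hh : IsMetric h)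
    (φ : OpenPartialHomeomorph M (E n)) (z : E n) : (gram φ h z).IsSymm := by
  ext i j
  exact hh.symm _ _ _

variable [IsManifold (𝓡 n) ∞ M]

theorem contDiffOn_trans (x y : M) : ContDiffOn ℝ ∞ (trans n x y) (transDom n x y) := by
  have h1 : ContMDiffOn (𝓡 n) (𝓡 n) ∞ (trans n x y) (transDom n x y) :=
    (contMDiffOn_chart (I := 𝓡 n) (n := ∞) (x := y)).comp
      ((contMDiffOn_chart_symm (I := 𝓡 n) (n := ∞) (x := x)).mono inter_subset_left)
      fun z hz => hz.2
  exact contMDiffOn_iff_contDiffOn.1 h1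

theorem contDiffAt_trans {x y : M} {z : E n} (hz : z ∈ transDom n x y) :
    ContDiffAt ℝ ∞ (trans n x y) z :=
  (contDiffOn_trans x y).contDiffAt ((isOpen_transDom x y).mem_nhds hz)

theorem hasFDerivAt_trans {x y : M} {z : E n} (hz : z ∈ transDom n x y) :
    HasFDerivAt (trans n x y) (fderiv ℝ (trans n x y) z) z :=
  ((contDiffAt_trans hz).differentiableAt (by simp)).hasFDerivAt

theorem ContMDiff.chartSmooth {u : M → ℝ} (hu : ContMDiff (𝓡 n) 𝓘(ℝ) ∞ u) :
    ChartSmooth n u := fun x =>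
  contMDiffOn_iff_contDiffOn.1
    (hu.comp_contMDiffOn (contMDiffOn_chart_symm (I := 𝓡 n) (n := ∞) (x := x)))

theorem ContMDiffOn.chartSmoothFam {ε : ℝ} {f : M → ℝ → ℝ}
    (hf : ContMDiffOn ((𝓡 n).prod 𝓘(ℝ)) 𝓘(ℝ) ∞ (fun p : M × ℝ => f p.1 p.2)
      (Set.univ ×ˢ Set.Ioo (-ε) ε)) : ChartSmoothFam n ε f := by
  intro x
  have h1 : ContMDiffOn ((𝓡 n).prod 𝓘(ℝ)) ((𝓡 n).prod 𝓘(ℝ)) ∞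
      (fun p : E n × ℝ => ((chartAt (E n) x).symm p.1, p.2))
      ((chartAt (E n) x).target ×ˢ Ioo (-ε) ε) := by
    refine ContMDiffOn.prodMk ?_ contMDiffOn_snd
    exact (contMDiffOn_chart_symm (I := 𝓡 n) (n := ∞) (x := x)).comp contMDiffOn_fst
      fun p hp => hp.1
  have h2 := hf.comp h1 fun p hp => ⟨mem_univ _, hp.2⟩
  rw [← modelWithCornersSelf_prod, chartedSpaceSelf_prod] at h2
  exact contMDiffOn_iff_contDiffOn.1 h2

/-- By the chain rule the differentials of the two inverse charts differ by the Jacobian of the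
coordinate change. -/
theorem gram_trans (h : FormField n M) {x y : M} {z : E n} (hz : z ∈ transDom n x y) :
    gram (chartAt (E n) x) h z =
      (jac x y z).transpose * gram (chartAt (E n) y) h (trans n x y z) * jac x y z := by
  have hd : mfderiv (𝓡 n) (𝓡 n) (chartAt (E n) x).symm z =
      (mfderiv (𝓡 n) (𝓡 n) (chartAt (E n) y).symm (trans n x y z)).comp
        (fderiv ℝ (trans n x y) z) := by
    have h1 : MDifferentiableAt (𝓡 n) (𝓡 n) (chartAt (E n) y).symm (trans n x y z) :=
      mdifferentiableAt_atlas_symm (I := 𝓡 n) (chart_mem_atlas _ y) (trans_mem_target hz)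
    have h2 : MDifferentiableAt (𝓡 n) (𝓡 n) (trans n x y) z :=
      (hasFDerivAt_trans hz).differentiableAt.mdifferentiableAt
    rw [(eventually_trans_symm hz).mfderiv_eq, mfderiv_comp z h1 h2, mfderiv_eq_fderiv]
    rfl
  -- The two base points agree only propositionally, and the tangent spaces depend on them. Stating
  -- the expansion for arbitrary `p = q`, with all vectors in `E n`, lets `rfl` remove the
  -- transport.
  have key : ∀ (p q : M) (hpq : p = q) (B : E n →L[ℝ] E n) (v w : E n),
      (h p : E n →L[ℝ] E n →L[ℝ] ℝ) (B v) (B w) =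
      ∑ k, (∑ l, v l * (h q : E n →L[ℝ] E n →L[ℝ] ℝ) (B (EuclideanSpace.single l 1))
        (B (EuclideanSpace.single k 1))) * w k := by
    rintro p _ rfl B v w
    have h1 : ∀ b : E n →L[ℝ] E n →L[ℝ] ℝ, b (B v) (B w) =
        ∑ k, (∑ l, v l * b (B (EuclideanSpace.single l 1))
          (B (EuclideanSpace.single k 1))) * w k := by
      intro b
      have e1 : B v = ∑ l, v l • B (EuclideanSpace.single l 1) := by
        conv_lhs => rw [euclidean_eq_sum v, map_sum]
        simp only [map_smul]
      have e2 : B w = ∑ l, w l • B (EuclideanSpace.single l 1) := by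
        conv_lhs => rw [euclidean_eq_sum w, map_sum]
        simp only [map_smul]
      rw [e2, map_sum]
      refine Finset.sum_congr rfl fun k _ => ?_
      rw [map_smul, smul_eq_mul, mul_comm, e1, map_sum, sum_apply]
      congr 1
      refine Finset.sum_congr rfl fun l _ => ?_
      rw [map_smul]
      rfl
    exact h1 (h p)
  ext i j
  simp only [Matrix.mul_apply, Matrix.transpose_apply]
  rw [gram, Matrix.of_apply, hd]
  exact key _ _ (trans_symm hz).symm
    (mfderiv (𝓡 n) (𝓡 n) (chartAt (E n) y).symm (trans n x y z)) _ _

theorem det_gram_trans (h : FormField n M) {x y : M} {z : E n} (hz : z ∈ transDom n x y) :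
    (gram (chartAt (E n) x) h z).det =
      (fderiv ℝ (trans n x y) z).det ^ 2 * (gram (chartAt (E n) y) h (trans n x y z)).det := by
  rw [gram_trans h hz, Matrix.det_mul, Matrix.det_mul, Matrix.det_transpose, det_jac]
  ring

theorem sqrt_det_gram_trans (h : FormField n M) {x y : M} {z : E n} (hz : z ∈ transDom n x y) :
    √|(gram (chartAt (E n) x) h z).det| =
      |(fderiv ℝ (trans n x y) z).det| * √|(gram (chartAt (E n) y) h (trans n x y z)).det| := by
  rw [det_gram_trans h hz, abs_mul, Real.sqrt_mul (abs_nonneg _), abs_pow,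
    Real.sqrt_sq (abs_nonneg _)]

theorem fderiv_trans_comp {x y : M} {z : E n} (hz : z ∈ transDom n x y) :
    (fderiv ℝ (trans n y x) (trans n x y z)).comp (fderiv ℝ (trans n x y) z) =
      ContinuousLinearMap.id ℝ (E n) := by
  have h1 := (hasFDerivAt_trans (trans_mem_transDom hz)).comp z (hasFDerivAt_trans hz)
  refine h1.unique ((hasFDerivAt_id z).congr_of_eventuallyEq ?_)
  filter_upwards [(isOpen_transDom x y).mem_nhds hz] with z' hz'
  simp only [Function.comp_apply, id]
  rw [trans, Function.comp_apply, trans_symm hz', (chartAt (E n) x).right_inv hz'.1]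

theorem det_fderiv_trans_ne_zero {x y : M} {z : E n} (hz : z ∈ transDom n x y) :
    (fderiv ℝ (trans n x y) z).det ≠ 0 := by
  intro h0
  have h := congrArg ContinuousLinearMap.det (fderiv_trans_comp hz)
  have e : ∀ A B : E n →L[ℝ] E n, (A.comp B).det = A.det * B.det := fun A B => by
    simp only [ContinuousLinearMap.det]
    exact LinearMap.det_comp _ _
  rw [e, h0, mul_zero] at h
  simp [ContinuousLinearMap.det] at h

/-- The differential of the inverse chart is bijective, so it would map a kernel vector of the
component matrix to a nonzero tangent vector orthogonal to the whole tangent space. -/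
theorem IsMetric.det_gram_ne_zero {h : FormField n M} (hh : IsMetric h) {x : M} {z : E n}
    (hz : z ∈ (chartAt (E n) x).target) : (gram (chartAt (E n) x) h z).det ≠ 0 := by
  intro h0
  obtain ⟨v, hv, h1⟩ := Matrix.exists_mulVec_eq_zero_iff.2 h0
  apply hv
  have hd := mdifferentiable_of_mem_atlas (I := 𝓡 n) (chart_mem_atlas (E n) x)
  have hinj : Function.Bijective (mfderiv (𝓡 n) (𝓡 n) (chartAt (E n) x).symm z) :=
    hd.symm.mfderiv_bijective hz
  set B : E n →L[ℝ] E n := mfderiv (𝓡 n) (𝓡 n) (chartAt (E n) x).symm z with hB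
  set V : E n := WithLp.toLp 2 v with hV
  have h2 : B V = 0 := by
    refine hh.nondegenerate ((chartAt (E n) x).symm z) (B V) fun w => ?_
    obtain ⟨w', rfl⟩ : ∃ w' : E n, B w' = w := hinj.2 w
    refine (hh.symm _ _ _).trans ?_
    have e1 : (B w' : E n) = ∑ i, w' i • B (EuclideanSpace.single i 1) := by
      conv_lhs => rw [euclidean_eq_sum w', map_sum]
      simp only [map_smul]
    have e2 : B V = ∑ j, v j • B (EuclideanSpace.single j 1) := by
      conv_lhs => rw [euclidean_eq_sum V, map_sum]
      simp only [map_smul, hV]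
    have h3 : ∀ b : E n →L[ℝ] E n →L[ℝ] ℝ,
        (∀ i, ∑ j, b (B (EuclideanSpace.single i 1)) (B (EuclideanSpace.single j 1)) * v j = 0) →
        b (B w') (B V) = 0 := by
      intro b hb
      rw [e1, map_sum, sum_apply]
      refine Finset.sum_eq_zero fun i _ => ?_
      rw [map_smul, smul_apply, e2, map_sum]
      convert smul_zero _
      rw [← hb i]
      refine Finset.sum_congr rfl fun j _ => ?_
      rw [map_smul, smul_eq_mul, mul_comm]
    exact h3 (h ((chartAt (E n) x).symm z)) fun i => congrFun h1 i
  have h3 : V = 0 := hinj.1 (h2.trans (map_zero B).symm)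
  ext i
  simpa [hV] using congrArg (fun w : E n => w i) h3

end

/-! ### The volume measure -/

section

variable {n : ℕ} {M : Type*} [TopologicalSpace M] [ChartedSpace (E n) M]

theorem IsMetric.continuousOn_sqrt_det {h : FormField n M} (hh : IsMetric h) (x : M) :
    ContinuousOn (fun z => √|(gram (chartAt (E n) x) h z).det|) (chartAt (E n) x).target := by
  refine Real.continuous_sqrt.comp_continuousOn (ContinuousOn.abs ?_)
  simp only [Matrix.det_apply]
  refine continuousOn_finsetSum _ fun σ _ => ContinuousOn.const_smul ?_ _
  exact continuousOn_finsetProd _ fun i _ => (hh.smooth x _ _).continuousOn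

variable [MeasurableSpace M] [BorelSpace M]

theorem aemeasurable_symm (h : FormField n M) (φ : OpenPartialHomeomorph M (E n)) :
    AEMeasurable φ.symm (((volume : Measure (E n)).restrict φ.target).withDensity
      fun z => ENNReal.ofReal (Real.sqrt |(gram φ h z).det|)) := by
  exact (ContinuousOn.aemeasurable φ.continuousOn_symm φ.open_target.measurableSet).mono_ac
    (withDensity_absolutelyContinuous _ _)

theorem chartVolume_apply (h : FormField n M) (φ : OpenPartialHomeomorph M (E n)) {S : Set M}
    (hS : MeasurableSet S) :
    chartVolume h φ S = ∫⁻ z in φ.symm ⁻¹' S ∩ φ.target,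
      ENNReal.ofReal (Real.sqrt |(gram φ h z).det|) := by
  rw [chartVolume, Measure.map_apply_of_aemeasurable (aemeasurable_symm h φ) hS,
    withDensity_apply', Measure.restrict_restrict' φ.open_target.measurableSet]

theorem measurableSet_symm_preimage (φ : OpenPartialHomeomorph M (E n)) {S : Set M}
    (hS : MeasurableSet S) : MeasurableSet (φ.symm ⁻¹' S ∩ φ.target) := by
  have h1 : Measurable (φ.target.domRestrict φ.symm) :=
    (continuousOn_iff_continuous_domRestrict.1 φ.continuousOn_symm).measurable
  have h2 := φ.open_target.measurableSet.subtype_image (h1 hS)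
  convert h2 using 1
  ext z
  simp only [mem_inter_iff, mem_preimage, mem_image, Subtype.exists, exists_and_right,
    exists_eq_right, domRestrict_apply, exists_prop]
  exact and_comm

theorem chartVolume_compl_source (h : FormField n M) (φ : OpenPartialHomeomorph M (E n)) :
    chartVolume h φ φ.sourceᶜ = 0 := by
  rw [chartVolume_apply h φ φ.open_source.measurableSet.compl]
  convert setLIntegral_empty _
  ext z
  simp only [mem_inter_iff, mem_preimage, mem_compl_iff, mem_empty_iff_false, iff_false, not_and]
  exact fun h1 h2 => h1 (φ.map_target h2)

theorem chartVolume_inter_source (h : FormField n M) (φ : OpenPartialHomeomorph M (E n))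
    (S : Set M) : chartVolume h φ (S ∩ φ.source) = chartVolume h φ S :=
  measure_inter_conull (chartVolume_compl_source h φ)

variable [IsManifold (𝓡 n) ∞ M]

/-- Change of variables: the Jacobian factor is exactly the one by which the densities differ. -/
theorem chartVolume_congr (h : FormField n M) {x y : M} {S : Set M} (hS : MeasurableSet S)
    (hx : S ⊆ (chartAt (E n) x).source) (hy : S ⊆ (chartAt (E n) y).source) :
    chartVolume h (chartAt (E n) x) S = chartVolume h (chartAt (E n) y) S := by
  rw [chartVolume_apply h _ hS, chartVolume_apply h _ hS]
  set A := (chartAt (E n) x).symm ⁻¹' S ∩ (chartAt (E n) x).target with hA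
  have hAd : A ⊆ transDom n x y := fun z hz => ⟨hz.2, hy hz.1⟩
  have hAm : MeasurableSet A := measurableSet_symm_preimage _ hS
  have e : (chartAt (E n) y).symm ⁻¹' S ∩ (chartAt (E n) y).target = trans n x y '' A := by
    ext z
    constructor
    · rintro ⟨h1, h2⟩
      have h3 : z ∈ transDom n y x := ⟨h2, hx h1⟩
      refine ⟨trans n y x z, ⟨?_, trans_mem_target h3⟩, ?_⟩
      · rw [mem_preimage, trans_symm h3]; exact h1
      · rw [trans, Function.comp_apply, trans_symm h3, (chartAt (E n) y).right_inv h2]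
    · rintro ⟨z', h1, rfl⟩
      refine ⟨?_, trans_mem_target (hAd h1)⟩
      rw [mem_preimage, trans_symm (hAd h1)]
      exact h1.1
  rw [e, lintegral_image_eq_lintegral_abs_det_fderiv_mul volume hAm
    (fun z hz => (hasFDerivAt_trans (hAd hz)).hasFDerivWithinAt) ((injOn_trans x y).mono hAd)]
  refine setLIntegral_congr_fun hAm fun z hz => ?_
  rw [sqrt_det_gram_trans h (hAd hz), ENNReal.ofReal_mul (abs_nonneg _)]

variable [SecondCountableTopology M]

/-- Countably many chart domains cover `M`. Cutting them into disjoint pieces and gluing the chart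
volumes gives a measure `ν` that agrees with every chart volume on its own domain. Thus `ν` bounds
the supremum and coincides with it there. -/
theorem riemannianVolume_apply (h : FormField n M) {x : M} {S : Set M} (hS : MeasurableSet S)
    (hx : S ⊆ (chartAt (E n) x).source) :
    riemannianVolume h S = chartVolume h (chartAt (E n) x) S := by
  refine le_antisymm ?_ (Measure.le_iff'.1 (le_iSup (fun x : M =>
    chartVolume h (chartAt (E n) x)) x) S)
  obtain ⟨T, hTc, hT⟩ := TopologicalSpace.isOpen_iUnion_countable
    (fun x : M => (chartAt (E n) x).source) (fun x => (chartAt (E n) x).open_source)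
  have hne : T.Nonempty := by
    rcases T.eq_empty_or_nonempty with rfl | h0
    · have : x ∈ ⋃ y : M, (chartAt (E n) y).source := mem_iUnion.2 ⟨x, mem_chart_source _ x⟩
      rw [← hT] at this
      simp at this
    · exact h0
  obtain ⟨c, rfl⟩ := hTc.exists_eq_range hne
  set D : ℕ → Set M := disjointed fun i => (chartAt (E n) (c i)).source with hD
  have hDm : ∀ i, MeasurableSet (D i) :=
    MeasurableSet.disjointed fun i => (chartAt (E n) (c i)).open_source.measurableSet
  have hDs : ∀ i, D i ⊆ (chartAt (E n) (c i)).source := fun i => disjointed_subset _ i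
  have hDd : Pairwise (Function.onFun Disjoint D) := disjoint_disjointed _
  have hDu : ⋃ i, D i = univ := by
    rw [hD, iUnion_disjointed, ← univ_subset_iff]
    intro y _
    have : y ∈ ⋃ y : M, (chartAt (E n) y).source := mem_iUnion.2 ⟨y, mem_chart_source _ y⟩
    rw [← hT, biUnion_range] at this
    exact this
  set ν : Measure M := Measure.sum fun i => (chartVolume h (chartAt (E n) (c i))).restrict (D i)
  have key : ∀ (y : M) (R : Set M), MeasurableSet R → R ⊆ (chartAt (E n) y).source →
      chartVolume h (chartAt (E n) y) R = ν R := by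
    intro y R hR hRy
    rw [Measure.sum_apply _ hR]
    have : R = ⋃ i, R ∩ D i := by rw [← inter_iUnion, hDu, inter_univ]
    conv_lhs => rw [this]
    rw [measure_iUnion (fun i j hij => (hDd hij).mono inter_subset_right inter_subset_right)
      (fun i => hR.inter (hDm i))]
    refine tsum_congr fun i => ?_
    rw [Measure.restrict_apply hR]
    exact chartVolume_congr h (hR.inter (hDm i)) (inter_subset_left.trans hRy)
      (inter_subset_right.trans (hDs i))
  rw [key x S hS hx]
  have hle : riemannianVolume h ≤ ν := by
    refine iSup_le fun y => Measure.le_iff.2 fun R hR => ?_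
    rw [← chartVolume_inter_source, key y _ (hR.inter (chartAt (E n) y).open_source.measurableSet)
      inter_subset_right]
    exact measure_mono inter_subset_left
  exact Measure.le_iff'.1 hle S

theorem restrict_riemannianVolume (h : FormField n M) (x : M) :
    (riemannianVolume h).restrict (chartAt (E n) x).source =
      chartVolume h (chartAt (E n) x) := by
  ext S hS
  rw [Measure.restrict_apply hS, riemannianVolume_apply h
    (hS.inter (chartAt (E n) x).open_source.measurableSet) inter_subset_right,
    chartVolume_inter_source]

theorem integral_riemannianVolume {h : FormField n M} (hh : IsMetric h) (x : M) {k : M → ℝ}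
    (hk : Continuous k) (hs : Function.support k ⊆ (chartAt (E n) x).source) :
    ∫ p, k p ∂(riemannianVolume h) =
      ∫ z in (chartAt (E n) x).target,
        √|(gram (chartAt (E n) x) h z).det| * k ((chartAt (E n) x).symm z) := by
  rw [← setIntegral_eq_integral_of_forall_compl_eq_zero (s := (chartAt (E n) x).source),
    restrict_riemannianVolume, chartVolume,
    integral_map (aemeasurable_symm h _) hk.aestronglyMeasurable,
    integral_withDensity_eq_integral_toReal_smul₀]
  · refine integral_congr_ae (Filter.Eventually.of_forall fun z => ?_)
    simp [ENNReal.toReal_ofReal (Real.sqrt_nonneg _)]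
  · exact ((hh.continuousOn_sqrt_det x).aemeasurable
      (chartAt (E n) x).open_target.measurableSet).ennreal_ofReal
  · exact Filter.Eventually.of_forall fun z => ENNReal.ofReal_lt_top
  · intro p hp
    by_contra h0
    exact hp (hs h0)

theorem IsMetric.isLocallyFiniteMeasure {h : FormField n M} (hh : IsMetric h) :
    IsLocallyFiniteMeasure (riemannianVolume h) := by
  refine ⟨fun x => ?_⟩
  set φ := chartAt (E n) x
  have hx : φ x ∈ φ.target := mem_chart_target (E n) x
  obtain ⟨K, hK, hKt, hKc⟩ := local_compact_nhds (φ.open_target.mem_nhds hx)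
  have hN : φ.source ∩ φ ⁻¹' (interior K) ∈ nhds x :=
    (φ.isOpen_inter_preimage isOpen_interior).mem_nhds
      ⟨mem_chart_source _ x, mem_interior_iff_mem_nhds.2 hK⟩
  refine ⟨_, hN, ?_⟩
  rw [riemannianVolume_apply h (φ.isOpen_inter_preimage isOpen_interior).measurableSet
    inter_subset_left, chartVolume_apply h _
    (φ.isOpen_inter_preimage isOpen_interior).measurableSet]
  have h1 : IntegrableOn (fun z => √|(gram φ h z).det|) K :=
    ((hh.continuousOn_sqrt_det x).mono hKt).integrableOn_compact hKc
  refine lt_of_le_of_lt (lintegral_mono_set (t := K) ?_) h1.lintegral_lt_top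
  rintro z ⟨hz1, hz2⟩
  have := hz1.2
  rw [mem_preimage, φ.right_inv hz2] at this
  exact interior_subset this

/-- The density is positive. This lets almost everywhere equality of continuous functions be
upgraded to equality in `lapChart_eq`. -/
theorem IsMetric.isOpenPosMeasure {h : FormField n M} (hh : IsMetric h) :
    (riemannianVolume h).IsOpenPosMeasure := by
  refine ⟨fun O hO hne h0 => ?_⟩
  obtain ⟨x, hx⟩ := hne
  set φ := chartAt (E n) x
  have h1 : riemannianVolume h (O ∩ φ.source) = 0 := measure_mono_null inter_subset_left h0
  rw [riemannianVolume_apply h (hO.inter φ.open_source).measurableSet inter_subset_right,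
    chartVolume_apply h _ (hO.inter φ.open_source).measurableSet] at h1
  set V := φ.symm ⁻¹' (O ∩ φ.source) ∩ φ.target
  have hV : IsOpen V := by
    have := φ.isOpen_inter_preimage_symm (hO.inter φ.open_source)
    rwa [inter_comm] at this
  have hVne : V.Nonempty := ⟨φ x, by
    refine ⟨?_, mem_chart_target (E n) x⟩
    rw [mem_preimage, φ.left_inv (mem_chart_source _ x)]
    exact ⟨hx, mem_chart_source _ x⟩⟩
  have h2 : AEMeasurable (fun z => ENNReal.ofReal √|(gram φ h z).det|) (volume.restrict V) :=
    (((hh.continuousOn_sqrt_det x).mono inter_subset_right).aemeasurable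
      hV.measurableSet).ennreal_ofReal
  rw [lintegral_eq_zero_iff' h2, Filter.EventuallyEq, ae_restrict_iff' hV.measurableSet] at h1
  have h3 : volume V = 0 := by
    rw [← nonpos_iff_eq_zero, ← h1]
    refine measure_mono fun z hz => ?_
    simp only [mem_compl_iff, mem_ofPred_eq, Pi.zero_apply, ENNReal.ofReal_eq_zero, not_forall]
    refine ⟨hz, not_le.2 (Real.sqrt_pos.2 (abs_pos.2 (hh.det_gram_ne_zero hz.2)))⟩
  exact hV.measure_ne_zero volume hVne h3

end

/-! ### Smoothness of the components of the inverse metric -/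

section

variable {V : Type*} [NormedAddCommGroup V] [NormedSpace ℝ V] {ι : Type*} [Fintype ι]
  [DecidableEq ι] {S : Set V} {G : V → Matrix ι ι ℝ}

theorem contDiffOn_det (hG : ∀ i j, ContDiffOn ℝ ∞ (fun z => G z i j) S) :
    ContDiffOn ℝ ∞ (fun z => (G z).det) S := by
  simp only [Matrix.det_apply]
  refine ContDiffOn.sum fun σ _ => ContDiffOn.const_smul _ ?_
  exact contDiffOn_prod fun i _ => hG _ _

/-- Cramer's rule: the entries are cofactors, again determinants, divided by the determinant. -/
theorem contDiffOn_inv_apply (hG : ∀ i j, ContDiffOn ℝ ∞ (fun z => G z i j) S)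
    (h0 : ∀ z ∈ S, (G z).det ≠ 0) (i j : ι) : ContDiffOn ℝ ∞ (fun z => (G z)⁻¹ i j) S := by
  have h1 : ContDiffOn ℝ ∞ (fun z => (G z).adjugate i j) S := by
    simp only [Matrix.adjugate_apply]
    refine contDiffOn_det fun k l => ?_
    by_cases hk : k = j
    · subst hk
      simpa using contDiffOn_const
    · simpa [Matrix.updateRow_ne hk] using hG k l
  have h2 := ((contDiffOn_det hG).inv h0).mul h1
  refine h2.congr fun z hz => ?_
  simp [Matrix.inv_def]

theorem contDiffOn_sqrt_det (hG : ∀ i j, ContDiffOn ℝ ∞ (fun z => G z i j) S)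
    (h0 : ∀ z ∈ S, (G z).det ≠ 0) : ContDiffOn ℝ ∞ (fun z => √|(G z).det|) S := by
  refine ContDiffOn.sqrt ?_ fun z hz => abs_ne_zero.2 (h0 z hz)
  exact fun z hz => ContDiffAt.comp_contDiffWithinAt z (g := fun x : ℝ => |x|)
    (contDiffAt_abs (h0 z hz)) (contDiffOn_det hG z hz)

end

/-! ### Partial derivatives and integration by parts -/

section

variable {n : ℕ}

/-- The partial derivative `∂_i` on `E n`. -/
def pe (i : Fin n) (H : E n → ℝ) (z : E n) : ℝ :=
  fderiv ℝ H z (EuclideanSpace.single i (1 : ℝ))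

theorem pe_congr {i : Fin n} {H K : E n → ℝ} {z : E n} (h : H =ᶠ[nhds z] K) :
    pe i H z = pe i K z := by rw [pe, pe, h.fderiv_eq]

theorem pe_congr_on {i : Fin n} {O : Set (E n)} (hO : IsOpen O) {H K : E n → ℝ} (h : EqOn H K O)
    {z : E n} (hz : z ∈ O) : pe i H z = pe i K z :=
  pe_congr (Filter.eventuallyEq_of_mem (hO.mem_nhds hz) h)

theorem contDiffOn_pe {O : Set (E n)} (hO : IsOpen O) {H : E n → ℝ} (h : ContDiffOn ℝ ∞ H O)
    (i : Fin n) : ContDiffOn ℝ ∞ (pe i H) O :=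
  (h.fderiv_of_isOpen hO (by simp)).clm_apply contDiffOn_const

theorem pe_eq_zero_of_notMem {i : Fin n} {a : E n → ℝ} {z : E n} (hz : z ∉ tsupport a) :
    pe i a z = 0 := by
  have : a =ᶠ[nhds z] fun _ => 0 := notMem_tsupport_iff_eventuallyEq.1 hz
  rw [pe_congr this]
  simp [pe]

theorem integrable_of_continuousOn {O K : Set (E n)} {k : E n → ℝ} (hk : ContinuousOn k O)
    (hK : IsCompact K) (hKO : K ⊆ O) (h0 : ∀ z ∉ K, k z = 0) : Integrable k := by
  rw [← integrableOn_iff_integrable_of_support_subset (s := K)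
    (fun z hz => by_contra fun h => hz (h0 z h))]
  exact (hk.mono hKO).integrableOn_compact hK

/-- Outside `O` the function `W` may be arbitrary, since `a` and its derivatives vanish off a
compact subset of `O`. -/
theorem integral_mul_pe {O : Set (E n)} (hO : IsOpen O) {a W : E n → ℝ}
    (ha : ContDiffOn ℝ ∞ a O) (hW : ContDiffOn ℝ ∞ W O) (hc : HasCompactSupport a)
    (hs : tsupport a ⊆ O) (i : Fin n) :
    ∫ z, a z * pe i W z = -∫ z, pe i a z * W z := by
  have z1 : ∀ z ∉ tsupport a, a z = 0 := fun z hz => image_eq_zero_of_notMem_tsupport hz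
  have z2 : ∀ z ∉ tsupport a, pe i a z = 0 := fun z hz => pe_eq_zero_of_notMem hz
  have i1 : Integrable fun z => (fderiv ℝ a z) (EuclideanSpace.single i 1) * W z :=
    integrable_of_continuousOn ((contDiffOn_pe hO ha i).continuousOn.mul hW.continuousOn) hc hs
      fun z hz => by
        have := z2 z hz
        rw [pe] at this
        rw [this, zero_mul]
  have i2 : Integrable fun z => a z * (fderiv ℝ W z) (EuclideanSpace.single i 1) :=
    integrable_of_continuousOn (ha.continuousOn.mul (contDiffOn_pe hO hW i).continuousOn) hc hs
      fun z hz => by rw [z1 z hz, zero_mul]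
  have i3 : Integrable fun z => a z * W z :=
    integrable_of_continuousOn (ha.continuousOn.mul hW.continuousOn) hc hs
      fun z hz => by rw [z1 z hz, zero_mul]
  refine integral_mul_fderiv_eq_neg_fderiv_mul_of_integrable i1 i2 i3 (fun z _ => ?_) fun z hz => ?_
  · by_cases hz : z ∈ tsupport a
    · exact (ha.contDiffAt (hO.mem_nhds (hs hz))).differentiableAt (by simp)
    · have : a =ᶠ[nhds z] fun _ => 0 := notMem_tsupport_iff_eventuallyEq.1 hz
      exact (differentiableAt_const _).congr_of_eventuallyEq this
  · exact (hW.contDiffAt (hO.mem_nhds (hs hz))).differentiableAt (by simp)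

/-! ### The Laplacian in a chart -/

/-- The Laplacian `|det G|^{-1/2} ∑_{i,j} ∂_i (|det G|^{1/2} G^{ij} ∂_j v)` on `E n`. -/
def lapE (G : E n → Matrix (Fin n) (Fin n) ℝ) (v : E n → ℝ) (z : E n) : ℝ :=
  (√|(G z).det|)⁻¹ * ∑ i, pe i (fun y => √|(G y).det| * ∑ j, (G y)⁻¹ i j * pe j v y) z

/-- The gradient pairing `∑_{i,j} G^{ij} ∂_i a ∂_j b` on `E n`. -/
def gradE (G : E n → Matrix (Fin n) (Fin n) ℝ) (a b : E n → ℝ) (z : E n) : ℝ :=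
  (fun i => pe i a z) ⬝ᵥ (G z)⁻¹.mulVec fun j => pe j b z

theorem gradE_comm {G : E n → Matrix (Fin n) (Fin n) ℝ} {z : E n} (hG : (G z).IsSymm)
    (a b : E n → ℝ) : gradE G a b z = gradE G b a z := by
  have h1 : ((G z)⁻¹).transpose = (G z)⁻¹ := by rw [Matrix.transpose_nonsing_inv, hG]
  rw [gradE, gradE, Matrix.dotProduct_mulVec, dotProduct_comm, ← Matrix.mulVec_transpose, h1]

theorem gradE_congr {G : E n → Matrix (Fin n) (Fin n) ℝ} {a b a' b' : E n → ℝ} {z : E n}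
    (ha : a =ᶠ[nhds z] a') (hb : b =ᶠ[nhds z] b') : gradE G a b z = gradE G a' b' z := by
  simp only [gradE, pe_congr ha, pe_congr hb]

theorem contDiffOn_lapE {G : E n → Matrix (Fin n) (Fin n) ℝ} {O : Set (E n)} (hO : IsOpen O)
    (hG : ∀ i j, ContDiffOn ℝ ∞ (fun z => G z i j) O) (h0 : ∀ z ∈ O, (G z).det ≠ 0)
    {v : E n → ℝ} (hv : ContDiffOn ℝ ∞ v O) : ContDiffOn ℝ ∞ (lapE G v) O := by
  refine ((contDiffOn_sqrt_det hG h0).inv fun z hz =>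
    (Real.sqrt_pos.2 (abs_pos.2 (h0 z hz))).ne').mul ?_
  refine ContDiffOn.sum fun i _ => contDiffOn_pe hO ?_ i
  refine (contDiffOn_sqrt_det hG h0).mul (ContDiffOn.sum fun j _ => ?_)
  exact (contDiffOn_inv_apply hG h0 i j).mul (contDiffOn_pe hO hv j)

theorem contDiffOn_gradE {G : E n → Matrix (Fin n) (Fin n) ℝ} {O : Set (E n)} (hO : IsOpen O)
    (hG : ∀ i j, ContDiffOn ℝ ∞ (fun z => G z i j) O) (h0 : ∀ z ∈ O, (G z).det ≠ 0)
    {a b : E n → ℝ} (ha : ContDiffOn ℝ ∞ a O) (hb : ContDiffOn ℝ ∞ b O) :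
    ContDiffOn ℝ ∞ (gradE G a b) O := by
  change ContDiffOn ℝ ∞ (fun z => ∑ i, pe i a z * ∑ j, (G z)⁻¹ i j * pe j b z) O
  refine ContDiffOn.sum fun i _ => (contDiffOn_pe hO ha i).mul (ContDiffOn.sum fun j _ => ?_)
  exact (contDiffOn_inv_apply hG h0 i j).mul (contDiffOn_pe hO hb j)

/-- The density cancels the outer factor of the Laplacian and leaves a divergence, which is
integrated by parts componentwise. -/
theorem integral_mul_lapE {G : E n → Matrix (Fin n) (Fin n) ℝ} {O : Set (E n)} (hO : IsOpen O)
    (hG : ∀ i j, ContDiffOn ℝ ∞ (fun z => G z i j) O) (h0 : ∀ z ∈ O, (G z).det ≠ 0)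
    {a v : E n → ℝ} (ha : ContDiffOn ℝ ∞ a O) (hv : ContDiffOn ℝ ∞ v O)
    (hc : HasCompactSupport a) (hs : tsupport a ⊆ O) :
    ∫ z, √|(G z).det| * (a z * lapE G v z) = -∫ z, √|(G z).det| * gradE G a v z := by
  set W : Fin n → E n → ℝ := fun i y => √|(G y).det| * ∑ j, (G y)⁻¹ i j * pe j v y with hWd
  have hW : ∀ i, ContDiffOn ℝ ∞ (W i) O := fun i =>
    (contDiffOn_sqrt_det hG h0).mul (ContDiffOn.sum fun j _ =>
      (contDiffOn_inv_apply hG h0 i j).mul (contDiffOn_pe hO hv j))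
  have z1 : ∀ z ∉ tsupport a, a z = 0 := fun z hz => image_eq_zero_of_notMem_tsupport hz
  have e1 : ∀ z, √|(G z).det| * (a z * lapE G v z) = ∑ i, a z * pe i (W i) z := by
    intro z
    by_cases hz : z ∈ tsupport a
    · have hp : √|(G z).det| ≠ 0 := (Real.sqrt_pos.2 (abs_pos.2 (h0 z (hs hz)))).ne'
      rw [lapE, ← Finset.mul_sum, mul_left_comm, mul_inv_cancel_left₀ hp]
    · simp [z1 z hz]
  have e2 : ∀ z, √|(G z).det| * gradE G a v z = ∑ i, pe i a z * W i z := by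
    intro z
    simp only [gradE, dotProduct, Matrix.mulVec, Finset.mul_sum, hWd]
    refine Finset.sum_congr rfl fun i _ => Finset.sum_congr rfl fun j _ => ?_
    ring
  simp only [e1, e2]
  rw [integral_finsetSum, integral_finsetSum, ← Finset.sum_neg_distrib]
  · exact Finset.sum_congr rfl fun i _ => integral_mul_pe hO ha (hW i) hc hs i
  · exact fun i _ => integrable_of_continuousOn ((contDiffOn_pe hO ha i).continuousOn.mul
      (hW i).continuousOn) hc hs fun z hz => by rw [pe_eq_zero_of_notMem hz, zero_mul]
  · exact fun i _ => integrable_of_continuousOn (ha.continuousOn.mul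
      (contDiffOn_pe hO (hW i) i).continuousOn) hc hs fun z hz => by rw [z1 z hz, zero_mul]

end

theorem sum_partition_mul {M : Type*} {K : Set M} {t : Finset M} {χ : t → M → ℝ}
    (h1 : ∀ p ∈ K, ∑ i, χ i p = 1) {k : M → ℝ} (hk : Function.support k ⊆ K) (p : M) :
    ∑ i, χ i p * k p = k p := by
  rw [← Finset.sum_mul]
  by_cases hp : p ∈ K
  · rw [h1 p hp, one_mul]
  · rw [show k p = 0 from by_contra fun h0 => hp (hk h0), mul_zero]

/-! ### The Laplacian on a manifold -/

section

variable {n : ℕ} {M : Type*} [TopologicalSpace M] [ChartedSpace (E n) M]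

/-- The Laplacian of `h`, computed in the preferred chart at `x`. -/
def lapChart (h : FormField n M) (x : M) (v : M → ℝ) (p : M) : ℝ :=
  lapE (gram (chartAt (E n) x) h) (v ∘ (chartAt (E n) x).symm) (chartAt (E n) x p)

/-- The Laplacian of `h`. -/
def lap (h : FormField n M) (v : M → ℝ) (p : M) : ℝ := lapChart h p v p

/-- The gradient pairing of `h`, computed in the preferred chart at `x`. -/
def gradChart (h : FormField n M) (x : M) (a b : M → ℝ) (p : M) : ℝ :=
  gradE (gram (chartAt (E n) x) h) (a ∘ (chartAt (E n) x).symm) (b ∘ (chartAt (E n) x).symm)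
    (chartAt (E n) x p)

/-- The gradient pairing of `h`. -/
def grad (h : FormField n M) (a b : M → ℝ) (p : M) : ℝ := gradChart h p a b p

theorem ChartSmooth.mul {u v : M → ℝ} (hu : ChartSmooth n u) (hv : ChartSmooth n v) :
    ChartSmooth n fun p => u p * v p := fun x => (hu x).mul (hv x)

theorem ChartSmooth.contDiffAt {u : M → ℝ} (hu : ChartSmooth n u) {x : M} {z : E n}
    (hz : z ∈ (chartAt (E n) x).target) : ContDiffAt ℝ ∞ (u ∘ (chartAt (E n) x).symm) z :=
  (hu x).contDiffAt ((chartAt (E n) x).open_target.mem_nhds hz)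

theorem grad_comm {h : FormField n M} (hh : IsMetric h) (a b : M → ℝ) (p : M) :
    grad h a b p = grad h b a p :=
  gradE_comm (hh.gram_isSymm _ _) _ _

theorem support_grad_subset (h : FormField n M) (a b : M → ℝ) :
    Function.support (grad h a b) ⊆ tsupport a := by
  intro p hp
  by_contra h0
  apply hp
  have h1 : a =ᶠ[nhds p] fun _ => 0 := notMem_tsupport_iff_eventuallyEq.1 h0
  set φ := chartAt (E n) p
  have h2 : Filter.Tendsto φ.symm (nhds (φ p)) (nhds p) := by
    have := φ.continuousAt_symm (mem_chart_target (E n) p)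
    rwa [ContinuousAt, φ.left_inv (mem_chart_source _ p)] at this
  have h3 : a ∘ φ.symm =ᶠ[nhds (φ p)] fun _ => 0 := h2.eventually h1
  have : ∀ i, pe i (a ∘ φ.symm) (φ p) = 0 := fun i => by
    rw [pe_congr h3]; simp [pe]
  simp only [grad, gradChart, gradE]
  rw [show (fun i => pe i (a ∘ φ.symm) (φ p)) = 0 from funext this, zero_dotProduct]

variable [IsManifold (𝓡 n) ∞ M]

theorem IsMetric.continuousOn_lapChart {h : FormField n M} (hh : IsMetric h) (x : M)
    {v : M → ℝ} (hv : ChartSmooth n v) :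
    ContinuousOn (lapChart h x v) (chartAt (E n) x).source :=
  (contDiffOn_lapE (chartAt (E n) x).open_target (hh.smooth x) (fun _ hz => hh.det_gram_ne_zero hz)
    (hv x)).continuousOn.comp (chartAt (E n) x).continuousOn fun _ hp =>
      (chartAt (E n) x).map_source hp


theorem pe_trans {u : M → ℝ} (hu : ChartSmooth n u) {x y : M} {z : E n} (hz : z ∈ transDom n x y)
    (i : Fin n) : pe i (u ∘ (chartAt (E n) x).symm) z =
      ∑ k, jac x y z k i * pe k (u ∘ (chartAt (E n) y).symm) (trans n x y z) := by
  have h1 : u ∘ (chartAt (E n) x).symm =ᶠ[nhds z] (u ∘ (chartAt (E n) y).symm) ∘ trans n x y :=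
    (eventually_trans_symm hz).fun_comp u
  have h2 : DifferentiableAt ℝ (u ∘ (chartAt (E n) y).symm) (trans n x y z) :=
    (hu.contDiffAt (trans_mem_target hz)).differentiableAt (by simp)
  rw [pe_congr h1, pe, fderiv_comp z h2 (hasFDerivAt_trans hz).differentiableAt,
    ContinuousLinearMap.comp_apply,
    euclidean_eq_sum (fderiv ℝ (trans n x y) z (EuclideanSpace.single i 1)), map_sum]
  refine Finset.sum_congr rfl fun k _ => ?_
  rw [map_smul]
  rfl

/-- Differentials pick up `Jᵀ` and the inverse metric picks up `J⁻¹` and its transpose, which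
cancel. Only first derivatives occur, so invariance is plain matrix algebra here, in contrast to the
Laplacian. -/
theorem gradE_trans (h : FormField n M) {a b : M → ℝ} (ha : ChartSmooth n a)
    (hb : ChartSmooth n b) {x y : M} {z : E n} (hz : z ∈ transDom n x y) :
    gradE (gram (chartAt (E n) x) h) (a ∘ (chartAt (E n) x).symm) (b ∘ (chartAt (E n) x).symm) z =
      gradE (gram (chartAt (E n) y) h) (a ∘ (chartAt (E n) y).symm) (b ∘ (chartAt (E n) y).symm)
        (trans n x y z) := by
  have hJ : IsUnit (jac x y z).det := by
    rw [det_jac]; exact (det_fderiv_trans_ne_zero hz).isUnit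
  have e : ∀ {u : M → ℝ}, ChartSmooth n u →
      (fun i => pe i (u ∘ (chartAt (E n) x).symm) z) = (jac x y z).transpose.mulVec
        fun k => pe k (u ∘ (chartAt (E n) y).symm) (trans n x y z) := by
    intro u hu
    ext i
    rw [pe_trans hu hz]
    rfl
  rw [gradE, gradE, e ha, e hb, gram_trans h hz, Matrix.mul_inv_rev, Matrix.mul_inv_rev,
    Matrix.mulVec_transpose, ← Matrix.dotProduct_mulVec, Matrix.mulVec_mulVec,
    Matrix.mulVec_mulVec, ← Matrix.mul_assoc (jac x y z), Matrix.mul_nonsing_inv _ hJ,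
    Matrix.one_mul, Matrix.mul_assoc, ← Matrix.transpose_nonsing_inv, ← Matrix.transpose_mul,
    Matrix.mul_nonsing_inv _ hJ, Matrix.transpose_one, Matrix.mul_one]

theorem grad_eq_gradChart (h : FormField n M) {a b : M → ℝ} (ha : ChartSmooth n a)
    (hb : ChartSmooth n b) {x p : M} (hp : p ∈ (chartAt (E n) x).source) :
    grad h a b p = gradChart h x a b p := by
  rw [grad, gradChart, gradChart, gradE_trans h ha hb (mem_transDom (mem_chart_source _ p) hp),
    trans_chartAt (mem_chart_source _ p)]

theorem IsMetric.continuous_grad {h : FormField n M} (hh : IsMetric h) {a b : M → ℝ}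
    (ha : ChartSmooth n a) (hb : ChartSmooth n b) : Continuous (grad h a b) := by
  rw [continuous_iff_continuousAt]
  intro x
  set φ := chartAt (E n) x
  have h1 : ContinuousOn (gradChart h x a b) φ.source :=
    (contDiffOn_gradE φ.open_target (hh.smooth x) (fun _ hz => hh.det_gram_ne_zero hz)
      (ha x) (hb x)).continuousOn.comp φ.continuousOn fun _ hp => φ.map_source hp
  have h2 := h1.continuousAt (φ.open_source.mem_nhds (mem_chart_source _ x))
  refine h2.congr ?_
  filter_upwards [φ.open_source.mem_nhds (mem_chart_source _ x)] with p hp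
  exact (grad_eq_gradChart h ha hb hp).symm

variable [T2Space M] [SecondCountableTopology M] [MeasurableSpace M] [BorelSpace M]

/-- The right-hand side no longer refers to the chart at `x`; this is the source of chart
independence. -/
theorem integral_mul_lapChart {h : FormField n M} (hh : IsMetric h) (x : M) {a v : M → ℝ}
    (ha : ChartSmooth n a) (hv : ChartSmooth n v) (hc : HasCompactSupport a)
    (hs : tsupport a ⊆ (chartAt (E n) x).source) :
    ∫ p, a p * lapChart h x v p ∂(riemannianVolume h) =
      -∫ p, grad h a v p ∂(riemannianVolume h) := by
  set φ := chartAt (E n) x with hφ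
  have hcont : Continuous fun p => a p * lapChart h x v p := by
    have h1 : ContinuousOn (fun p => a p * lapChart h x v p) φ.source :=
      ha.continuous.continuousOn.mul (hh.continuousOn_lapChart x hv)
    rw [continuous_iff_continuousAt]
    intro p
    by_cases hp : p ∈ tsupport a
    · exact h1.continuousAt (φ.open_source.mem_nhds (hs hp))
    · have h2 : a =ᶠ[nhds p] fun _ => 0 := notMem_tsupport_iff_eventuallyEq.1 hp
      refine (continuousAt_const (y := (0 : ℝ))).congr ?_
      filter_upwards [h2] with q hq
      rw [hq, zero_mul]
  rw [integral_riemannianVolume hh x hcont, integral_riemannianVolume hh x (hh.continuous_grad ha hv)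
    ((support_grad_subset h a v).trans hs)]
  swap
  · intro p hp
    by_contra h0
    apply hp
    simp only
    rw [image_eq_zero_of_notMem_tsupport fun h1 => h0 (hs h1), zero_mul]
  -- Off the target `φ.symm` takes arbitrary values, so the function is extended by zero before
  -- integrating over all of `E n`.
  set A : E n → ℝ := φ.target.indicator (a ∘ φ.symm) with hA
  have hAe : EqOn A (a ∘ φ.symm) φ.target := fun z hz => indicator_of_mem hz _
  have hAs : ContDiffOn ℝ ∞ A φ.target := (ha x).congr hAe
  have hK : IsCompact (φ '' tsupport a) :=
    hc.isCompact.image_of_continuousOn (φ.continuousOn.mono hs)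
  have hAsupp : Function.support A ⊆ φ '' tsupport a := by
    intro z hz
    have hzt : z ∈ φ.target := by
      by_contra h0
      exact hz (indicator_of_notMem h0 _)
    refine ⟨φ.symm z, ?_, φ.right_inv hzt⟩
    apply subset_tsupport
    rw [Function.mem_support, ← Function.comp_apply (f := a), ← hAe hzt]
    exact hz
  have hAts : tsupport A ⊆ φ '' tsupport a := closure_minimal hAsupp hK.isClosed
  have hAc : HasCompactSupport A := hK.of_isClosed_subset (isClosed_tsupport _) hAts
  have hAt : tsupport A ⊆ φ.target := hAts.trans (by
    rintro _ ⟨p, hp, rfl⟩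
    exact φ.map_source (hs hp))
  have key := integral_mul_lapE φ.open_target (hh.smooth x) (fun _ hz => hh.det_gram_ne_zero hz)
    hAs (hv x) hAc hAt
  have hm := φ.open_target.measurableSet
  have e1 : ∫ z in φ.target, √|(gram φ h z).det| *
      (a (φ.symm z) * lapChart h x v (φ.symm z)) =
      ∫ z, √|(gram φ h z).det| * (A z * lapE (gram φ h) (v ∘ φ.symm) z) := by
    refine Eq.trans ?_ (setIntegral_eq_integral_of_forall_compl_eq_zero (s := φ.target) ?_)
    · refine setIntegral_congr_fun hm fun z hz => ?_
      rw [hAe hz, lapChart, ← hφ, φ.right_inv hz]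
      rfl
    · intro z hz
      rw [hA, indicator_of_notMem hz, zero_mul, mul_zero]
  have e2 : ∫ z in φ.target, √|(gram φ h z).det| * grad h a v (φ.symm z) =
      ∫ z, √|(gram φ h z).det| * gradE (gram φ h) A (v ∘ φ.symm) z := by
    refine Eq.trans ?_ (setIntegral_eq_integral_of_forall_compl_eq_zero (s := φ.target) ?_)
    · refine setIntegral_congr_fun hm fun z hz => ?_
      rw [grad_eq_gradChart h ha hv (φ.map_target hz), gradChart, ← hφ, φ.right_inv hz,
        gradE_congr (Filter.eventuallyEq_of_mem (φ.open_target.mem_nhds hz) hAe)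
          (Filter.EventuallyEq.refl _ _)]
    · intro z hz
      have : ∀ i, pe i A z = 0 := fun i => pe_eq_zero_of_notMem fun h1 => hz (hAt h1)
      rw [gradE, show (fun i => pe i A z) = 0 from funext this, zero_dotProduct, mul_zero]
  rw [e1, e2, key]

/-- Both sides have the same integral against every test function supported in the overlap, so they
agree almost everywhere, and by continuity everywhere. No second-order chain rule is needed. -/
theorem lapChart_eq {h : FormField n M} (hh : IsMetric h) {v : M → ℝ} (hv : ChartSmooth n v)
    (x y : M) : EqOn (lapChart h x v) (lapChart h y v)
      ((chartAt (E n) x).source ∩ (chartAt (E n) y).source) := by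
  have := hh.isLocallyFiniteMeasure
  have := hh.isOpenPosMeasure
  have : LocallyCompactSpace M := ChartedSpace.locallyCompactSpace (E n) M
  have : SigmaCompactSpace M := sigmaCompactSpace_of_locallyCompact_secondCountable
  set O := (chartAt (E n) x).source ∩ (chartAt (E n) y).source
  have hO : IsOpen O := (chartAt (E n) x).open_source.inter (chartAt (E n) y).open_source
  have c1 : ContinuousOn (lapChart h x v) O :=
    (hh.continuousOn_lapChart x hv).mono inter_subset_left
  have c2 : ContinuousOn (lapChart h y v) O :=
    (hh.continuousOn_lapChart y hv).mono inter_subset_right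
  have h0 : ∀ᵐ p ∂(riemannianVolume h), p ∈ O → lapChart h x v p - lapChart h y v p = 0 := by
    refine hO.ae_eq_zero_of_integral_contMDiff_smul_eq_zero (𝓡 n)
      ((c1.sub c2).locallyIntegrableOn hO.measurableSet) fun η hη hc hs => ?_
    have hη' := ContMDiff.chartSmooth hη
    have i1 := integral_mul_lapChart hh x hη' hv hc (hs.trans inter_subset_left)
    have i2 := integral_mul_lapChart hh y hη' hv hc (hs.trans inter_subset_right)
    have hi : ∀ f : M → ℝ, ContinuousOn f O →
        Integrable (fun p => η p * f p) (riemannianVolume h) := by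
      intro f hf
      rw [← integrableOn_iff_integrable_of_support_subset (s := tsupport η)]
      · exact (hη.continuous.continuousOn.mul (hf.mono hs)).integrableOn_compact hc
      · intro p hp
        by_contra h1
        apply hp
        simp only
        rw [image_eq_zero_of_notMem_tsupport h1, zero_mul]
    simp only [smul_eq_mul, mul_sub]
    rw [integral_sub (hi _ c1) (hi _ c2), i1, i2, sub_self]
  refine Measure.eqOn_open_of_ae_eq (μ := riemannianVolume h) ?_ hO c1 c2
  rw [Filter.EventuallyEq, ae_restrict_iff' hO.measurableSet]
  filter_upwards [h0] with p hp hpO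
  exact sub_eq_zero.1 (hp hpO)

theorem lap_eq_lapChart {h : FormField n M} (hh : IsMetric h) {v : M → ℝ} (hv : ChartSmooth n v)
    {x p : M} (hp : p ∈ (chartAt (E n) x).source) : lap h v p = lapChart h x v p :=
  lapChart_eq hh hv p x ⟨mem_chart_source _ p, hp⟩

theorem IsMetric.chartSmooth_lap {h : FormField n M} (hh : IsMetric h) {v : M → ℝ}
    (hv : ChartSmooth n v) : ChartSmooth n (lap h v) := by
  intro x
  refine (contDiffOn_lapE (chartAt (E n) x).open_target (hh.smooth x)
    (fun _ hz => hh.det_gram_ne_zero hz) (hv x)).congr fun z hz => ?_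
  rw [Function.comp_apply, lap_eq_lapChart hh hv ((chartAt (E n) x).map_target hz), lapChart,
    (chartAt (E n) x).right_inv hz]

/-- A smooth partition of unity on a neighborhood of a compact set, subordinate to charts. -/
theorem exists_chart_partition {K : Set M} (hK : IsCompact K) :
    ∃ (t : Finset M) (χ : t → M → ℝ), (∀ i, ContMDiff (𝓡 n) 𝓘(ℝ) ∞ (χ i)) ∧
      (∀ i, tsupport (χ i) ⊆ (chartAt (E n) (i : M)).source) ∧ ∀ p ∈ K, ∑ i, χ i p = 1 := by
  have : LocallyCompactSpace M := ChartedSpace.locallyCompactSpace (E n) M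
  have : SigmaCompactSpace M := sigmaCompactSpace_of_locallyCompact_secondCountable
  obtain ⟨t, ht⟩ := hK.elim_nhds_subcover (fun x => (chartAt (E n) x).source)
    fun x _ => (chartAt (E n) x).open_source.mem_nhds (mem_chart_source _ x)
  obtain ⟨f, hf⟩ := SmoothPartitionOfUnity.exists_isSubordinate (𝓡 n) hK.isClosed
    (fun i : t => (chartAt (E n) (i : M)).source) (fun i => (chartAt (E n) (i : M)).open_source)
    (by
      intro p hp
      obtain ⟨x, hx, hpx⟩ := mem_iUnion₂.1 (ht.2 hp)
      exact mem_iUnion.2 ⟨⟨x, hx⟩, hpx⟩)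
  refine ⟨t, fun i => f i, fun i => (f i).contMDiff, hf, fun p hp => ?_⟩
  rw [← finsum_eq_sum_of_fintype]
  exact f.sum_eq_one hp

theorem IsMetric.integrable {h : FormField n M} (hh : IsMetric h) {k : M → ℝ} (hk : Continuous k)
    (hc : HasCompactSupport k) : Integrable k (riemannianVolume h) := by
  have := hh.isLocallyFiniteMeasure
  exact hk.integrable_of_hasCompactSupport hc

/-- Green's identity. -/
theorem integral_mul_lap {h : FormField n M} (hh : IsMetric h) {a v : M → ℝ}
    (ha : ChartSmooth n a) (hv : ChartSmooth n v) (hc : HasCompactSupport a) :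
    ∫ p, a p * lap h v p ∂(riemannianVolume h) = -∫ p, grad h a v p ∂(riemannianVolume h) := by
  -- The partition sums to one on the support of `a`, so `a` is a finite sum of functions each
  -- supported in one chart.
  obtain ⟨t, χ, hχ, hχs, hχ1⟩ := exists_chart_partition (n := n) hc.isCompact
  have hd : ∀ i, ChartSmooth n fun p => χ i p * a p := fun i =>
    (ContMDiff.chartSmooth (hχ i)).mul ha
  have hdc : ∀ i, HasCompactSupport fun p => χ i p * a p := fun i => hc.mul_left
  have hds : ∀ i, tsupport (fun p => χ i p * a p) ⊆ (chartAt (E n) (i : M)).source := fun i =>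
    (tsupport_mul_subset_left).trans (hχs i)
  have hsum := sum_partition_mul hχ1 (subset_tsupport a)
  have e1 : ∀ p, a p * lap h v p = ∑ i, χ i p * a p * lap h v p := fun p => by
    rw [← Finset.sum_mul, hsum]
  have e2 : ∀ p, grad h a v p = ∑ i, grad h (fun p => χ i p * a p) v p := by
    intro p
    have : ∀ j, pe j (a ∘ (chartAt (E n) p).symm) (chartAt (E n) p p) =
        ∑ i, pe j ((fun p => χ i p * a p) ∘ (chartAt (E n) p).symm) (chartAt (E n) p p) := by
      intro j
      have : a ∘ (chartAt (E n) p).symm =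
          fun z => ∑ i, ((fun p => χ i p * a p) ∘ (chartAt (E n) p).symm) z := by
        ext z
        exact (hsum _).symm
      rw [this]
      simp only [pe]
      rw [fderiv_fun_sum fun i _ => ((hd i).contDiffAt (mem_chart_target (E n) p)).differentiableAt
        (by simp), sum_apply]
    simp only [grad, gradChart, gradE, dotProduct, this, Finset.sum_mul]
    exact Finset.sum_comm
  simp only [e1, e2]
  rw [integral_finsetSum, integral_finsetSum, ← Finset.sum_neg_distrib]
  · refine Finset.sum_congr rfl fun i _ => ?_
    rw [← integral_mul_lapChart hh (i : M) (hd i) hv (hdc i) (hds i)]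
    congr 1
    ext p
    by_cases hp : p ∈ (chartAt (E n) (i : M)).source
    · rw [lap_eq_lapChart hh hv hp]
    · have : χ i p = 0 := image_eq_zero_of_notMem_tsupport fun h1 => hp (hχs i h1)
      rw [this]; ring
  · intro i _
    refine hh.integrable (hh.continuous_grad (hd i) hv) ?_
    exact HasCompactSupport.of_support_subset_isCompact (hdc i) (support_grad_subset h _ v)
  · intro i _
    exact hh.integrable ((hd i).continuous.mul (hh.chartSmooth_lap hv).continuous)
      (hdc i).mul_right

end

/-! ### Functions of a point and a parameter -/

section

variable {n : ℕ}

/-- The partial derivative `∂_i` of a function on `E n × ℝ`. -/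
def dx (i : Fin n) (Q : E n × ℝ → ℝ) (p : E n × ℝ) : ℝ := pe i (fun z => Q (z, p.2)) p.1

/-- The derivative with respect to the parameter of a function on `E n × ℝ`. -/
def dr (Q : E n × ℝ → ℝ) (p : E n × ℝ) : ℝ := deriv (fun r => Q (p.1, r)) p.2

theorem dx_eq_fderiv {Q : E n × ℝ → ℝ} {p : E n × ℝ} (h : DifferentiableAt ℝ Q p) (i : Fin n) :
    dx i Q p = fderiv ℝ Q p (EuclideanSpace.single i 1, 0) := by
  have h1 : HasFDerivAt (fun z : E n => (z, p.2)) (ContinuousLinearMap.inl ℝ (E n) ℝ) p.1 :=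
    hasFDerivAt_prodMk_left _ _
  have h2 := HasFDerivAt.comp (g := Q) p.1 (h.hasFDerivAt) h1
  exact congrArg (fun A : E n →L[ℝ] ℝ => A (EuclideanSpace.single i 1)) h2.fderiv

theorem hasDerivAt_slice {Q : E n × ℝ → ℝ} {p : E n × ℝ} (h : DifferentiableAt ℝ Q p) :
    HasDerivAt (fun r => Q (p.1, r)) (fderiv ℝ Q p (0, 1)) p.2 := by
  have h1 : HasFDerivAt (fun r : ℝ => (p.1, r)) (ContinuousLinearMap.inr ℝ (E n) ℝ) p.2 :=
    hasFDerivAt_prodMk_right _ _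
  have h2 := HasFDerivAt.comp (g := Q) p.2 (h.hasFDerivAt) h1
  exact h2.hasDerivAt

theorem dr_eq_fderiv {Q : E n × ℝ → ℝ} {p : E n × ℝ} (h : DifferentiableAt ℝ Q p) :
    dr Q p = fderiv ℝ Q p (0, 1) := (hasDerivAt_slice h).deriv

theorem contDiffOn_dx {Q : E n × ℝ → ℝ} {O : Set (E n × ℝ)} (hO : IsOpen O)
    (h : ContDiffOn ℝ ∞ Q O) (i : Fin n) : ContDiffOn ℝ ∞ (dx i Q) O := by
  refine ((h.fderiv_of_isOpen hO (m := ∞) (by simp)).clm_apply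
    (contDiffOn_const (c := (EuclideanSpace.single i (1 : ℝ), (0 : ℝ))))).congr fun p hp => ?_
  exact dx_eq_fderiv ((h.contDiffAt (hO.mem_nhds hp)).differentiableAt (by simp)) i

theorem contDiffOn_dr {Q : E n × ℝ → ℝ} {O : Set (E n × ℝ)} (hO : IsOpen O)
    (h : ContDiffOn ℝ ∞ Q O) : ContDiffOn ℝ ∞ (dr Q) O := by
  refine ((h.fderiv_of_isOpen hO (m := ∞) (by simp)).clm_apply
    (contDiffOn_const (c := ((0 : E n), (1 : ℝ))))).congr fun p hp => ?_
  exact dr_eq_fderiv ((h.contDiffAt (hO.mem_nhds hp)).differentiableAt (by simp))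

theorem contDiffAt_slice {Q : E n × ℝ → ℝ} {O : Set (E n × ℝ)} (hO : IsOpen O)
    (h : ContDiffOn ℝ ∞ Q O) {p : E n × ℝ} (hp : p ∈ O) :
    ContDiffAt ℝ ∞ (fun r => Q (p.1, r)) p.2 :=
  (h.contDiffAt (hO.mem_nhds hp)).comp p.2 (contDiffAt_const.prodMk contDiffAt_id)

end

/-! ### The ambient coordinates -/

section

variable {n : ℕ}

/-- The ambient coordinates, regrouped. -/
def ambEquiv (n : ℕ) : (AmbIdx n → ℝ) ≃L[ℝ] E n × ℝ × ℝ :=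
  LinearEquiv.toContinuousLinearEquiv
    { toFun := fun ξ => (baseCoord ξ, ξ (Sum.inr 0), ξ (Sum.inr 1))
      invFun := fun q => Sum.elim (fun i => q.1 i) ![q.2.1, q.2.2]
      map_add' := fun _ _ => rfl
      map_smul' := fun _ _ => rfl
      left_inv := fun ξ => by
        ext (i | i)
        · rfl
        · fin_cases i <;> rfl
      right_inv := fun q => rfl }

theorem ambEquiv_apply (ξ : AmbIdx n → ℝ) :
    ambEquiv n ξ = (baseCoord ξ, ξ (Sum.inr 0), ξ (Sum.inr 1)) := rfl

theorem pd_comp_ambEquiv (H : E n × ℝ × ℝ → ℝ) (i : AmbIdx n) (ξ : AmbIdx n → ℝ) :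
    pd i (H ∘ ambEquiv n) ξ = fderiv ℝ H (ambEquiv n ξ) (ambEquiv n (Pi.single i 1)) := by
  rw [pd, (ambEquiv n).comp_right_fderiv]
  rfl

theorem ambEquiv_single_inl (i : Fin n) :
    ambEquiv n (Pi.single (Sum.inl i) 1) = (EuclideanSpace.single i 1, 0, 0) := by
  rw [ambEquiv_apply]
  refine Prod.ext ?_ (Prod.ext ?_ ?_)
  · ext j
    simp [baseCoord, Pi.single_apply]
  · simp
  · simp

theorem ambEquiv_single_inr_zero :
    ambEquiv n (Pi.single (Sum.inr 0) 1) = (0, 1, 0) := by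
  rw [ambEquiv_apply]
  refine Prod.ext ?_ (Prod.ext ?_ ?_)
  · ext j
    simp [baseCoord]
  · simp
  · simp

theorem ambEquiv_single_inr_one :
    ambEquiv n (Pi.single (Sum.inr 1) 1) = (0, 0, 1) := by
  rw [ambEquiv_apply]
  refine Prod.ext ?_ (Prod.ext ?_ ?_)
  · ext j
    simp [baseCoord]
  · simp
  · simp

theorem pd_inl {H : E n × ℝ × ℝ → ℝ} {ξ : AmbIdx n → ℝ}
    (h : DifferentiableAt ℝ H (ambEquiv n ξ)) (i : Fin n) :
    pd (Sum.inl i) (H ∘ ambEquiv n) ξ =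
      pe i (fun z => H (z, ξ (Sum.inr 0), ξ (Sum.inr 1))) (baseCoord ξ) := by
  rw [pd_comp_ambEquiv, ambEquiv_single_inl]
  have h1 : HasFDerivAt (fun z : E n => (z, ξ (Sum.inr 0), ξ (Sum.inr 1)))
      (ContinuousLinearMap.inl ℝ (E n) (ℝ × ℝ)) (baseCoord ξ) := hasFDerivAt_prodMk_left _ _
  have h2 := HasFDerivAt.comp (g := H) (baseCoord ξ) (h.hasFDerivAt) h1
  exact (congrArg (fun A : E n →L[ℝ] ℝ => A (EuclideanSpace.single i 1)) h2.fderiv).symm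

theorem pd_inr_zero {H : E n × ℝ × ℝ → ℝ} {ξ : AmbIdx n → ℝ}
    (h : DifferentiableAt ℝ H (ambEquiv n ξ)) :
    pd (Sum.inr 0) (H ∘ ambEquiv n) ξ =
      deriv (fun t => H (baseCoord ξ, t, ξ (Sum.inr 1))) (ξ (Sum.inr 0)) := by
  rw [pd_comp_ambEquiv, ambEquiv_single_inr_zero]
  have h1 : HasDerivAt (fun t : ℝ => (baseCoord ξ, t, ξ (Sum.inr 1))) (0, 1, 0) (ξ (Sum.inr 0)) :=
    (hasDerivAt_const _ _).prodMk ((hasDerivAt_id _).prodMk (hasDerivAt_const _ _))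
  exact (HasFDerivAt.comp_hasDerivAt (l := H) _ (h.hasFDerivAt) h1).deriv.symm

theorem pd_inr_one {H : E n × ℝ × ℝ → ℝ} {ξ : AmbIdx n → ℝ}
    (h : DifferentiableAt ℝ H (ambEquiv n ξ)) :
    pd (Sum.inr 1) (H ∘ ambEquiv n) ξ =
      deriv (fun t => H (baseCoord ξ, ξ (Sum.inr 0), t)) (ξ (Sum.inr 1)) := by
  rw [pd_comp_ambEquiv, ambEquiv_single_inr_one]
  have h1 : HasDerivAt (fun t : ℝ => (baseCoord ξ, ξ (Sum.inr 0), t)) (0, 0, 1) (ξ (Sum.inr 1)) :=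
    (hasDerivAt_const _ _).prodMk ((hasDerivAt_const _ _).prodMk (hasDerivAt_id _))
  exact (HasFDerivAt.comp_hasDerivAt (l := H) _ (h.hasFDerivAt) h1).deriv.symm

end

/-! ### Determinant and inverse of the ambient metric, and the shape of `M̃(ρ)` -/

section

variable {n : ℕ} {M : Type*} [TopologicalSpace M] [ChartedSpace (E n) M] {ε : ℝ}
  (g : MetricFamily n M ε)

theorem det_ambGram (φ : OpenPartialHomeomorph M (E n)) (ξ : AmbIdx n → ℝ) :
    (ambGram g φ ξ).det = -(ξ (Sum.inr 0) ^ (n + 1)) ^ 2 *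
      (gram φ (g.metric (ξ (Sum.inr 1))) (baseCoord ξ)).det := by
  rw [ambGram, Matrix.det_fromBlocks_zero₂₁, Matrix.det_smul, Matrix.det_fin_two_of]
  simp only [Fintype.card_fin]
  ring

theorem sqrt_det_ambGram (φ : OpenPartialHomeomorph M (E n)) {ξ : AmbIdx n → ℝ}
    (hτ : 0 < ξ (Sum.inr 0)) :
    √|(ambGram g φ ξ).det| = ξ (Sum.inr 0) ^ (n + 1) *
      √|(gram φ (g.metric (ξ (Sum.inr 1))) (baseCoord ξ)).det| := by
  rw [det_ambGram, abs_mul, abs_neg, abs_pow, Real.sqrt_mul (by positivity),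
    Real.sqrt_sq (abs_nonneg _), abs_of_pos (by positivity)]

theorem inv_ambGram (φ : OpenPartialHomeomorph M (E n)) {ξ : AmbIdx n → ℝ}
    (hτ : 0 < ξ (Sum.inr 0))
    (hd : (gram φ (g.metric (ξ (Sum.inr 1))) (baseCoord ξ)).det ≠ 0) :
    (ambGram g φ ξ)⁻¹ = Matrix.fromBlocks
      ((ξ (Sum.inr 0) ^ 2)⁻¹ • (gram φ (g.metric (ξ (Sum.inr 1))) (baseCoord ξ))⁻¹) 0 0
      !![0, (ξ (Sum.inr 0))⁻¹; (ξ (Sum.inr 0))⁻¹,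
        -2 * ξ (Sum.inr 1) * (ξ (Sum.inr 0) ^ 2)⁻¹] := by
  apply Matrix.inv_eq_right_inv
  rw [ambGram, Matrix.fromBlocks_multiply, ← Matrix.fromBlocks_one]
  have hτ' := hτ.ne'
  congr 1
  · rw [Matrix.smul_mul, Matrix.mul_smul, smul_smul, mul_inv_cancel₀ (pow_ne_zero 2 hτ'),
      one_smul, Matrix.mul_nonsing_inv _ hd.isUnit, Matrix.mul_zero, add_zero]
  · simp
  · simp
  · ext i j
    fin_cases i <;> fin_cases j <;> simp <;> field_simp <;> ring

/-! ### The function `w` -/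

theorem isOpen_chartDom (x : M) : IsOpen ((chartAt (E n) x).target ×ˢ Ioo (-ε) ε) :=
  (chartAt (E n) x).open_target.prod isOpen_Ioo

theorem det_metric_ne_zero [IsManifold (𝓡 n) ∞ M] {x : M} {p : E n × ℝ}
    (hp : p ∈ (chartAt (E n) x).target ×ˢ Ioo (-ε) ε) :
    (gram (chartAt (E n) x) (g.metric p.2) p.1).det ≠ 0 :=
  (g.isMetric hp.2).det_gram_ne_zero hp.1

variable [IsManifold (𝓡 n) ∞ M]

/-- The quotient of determinants whose fourth root is `w`, in a chart. -/
def detRatio (x : M) (p : E n × ℝ) : ℝ :=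
  (gram (chartAt (E n) x) (g.metric p.2) p.1).det / (gram (chartAt (E n) x) (g.metric 0) p.1).det

/-- The squared Jacobian cancels in the quotient, so `w`, defined with a chart that moves with the
point, can be computed in a fixed chart. -/
theorem wFun_eq {x y : M} (hy : y ∈ (chartAt (E n) x).source) (s : ℝ) :
    wFun g y s = detRatio g x (chartAt (E n) x y, s) ^ (1 / 4 : ℝ) := by
  have hz := mem_transDom (mem_chart_source (E n) y) hy
  have h0 : (fderiv ℝ (trans n y x) (chartAt (E n) y y)).det ^ 2 ≠ 0 :=
    pow_ne_zero 2 (det_fderiv_trans_ne_zero hz)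
  rw [wFun, detRatio, det_gram_trans (g.metric s) hz, det_gram_trans (g.metric 0) hz,
    trans_chartAt (mem_chart_source _ y), mul_div_mul_left _ _ h0]

theorem contDiffOn_detRatio (hε : 0 < ε) (x : M) : ContDiffOn ℝ ∞ (detRatio g x)
    ((chartAt (E n) x).target ×ˢ Ioo (-ε) ε) := by
  have h0 : (0 : ℝ) ∈ Ioo (-ε) ε := ⟨by linarith, hε⟩
  refine (contDiffOn_det (g.smooth x)).div ?_ fun p hp => (g.isMetric h0).det_gram_ne_zero hp.1
  exact (contDiffOn_det ((g.isMetric h0).smooth x)).comp contDiffOn_fst fun p hp => hp.1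

/-- The ratio is continuous in `ρ`, equals `1` at `ρ = 0` and never vanishes, whatever the
signature. -/
theorem detRatio_pos (hε : 0 < ε) {x : M} {p : E n × ℝ}
    (hp : p ∈ (chartAt (E n) x).target ×ˢ Ioo (-ε) ε) : 0 < detRatio g x p := by
  have h0 : (0 : ℝ) ∈ Ioo (-ε) ε := ⟨by linarith, hε⟩
  have hc : ContinuousOn (fun r => detRatio g x (p.1, r)) (Ioo (-ε) ε) :=
    (contDiffOn_detRatio g hε x).continuousOn.comp (by fun_prop) fun r hr => ⟨hp.1, hr⟩
  have hne : ∀ r ∈ Ioo (-ε) ε, detRatio g x (p.1, r) ≠ 0 := fun r hr =>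
    div_ne_zero (det_metric_ne_zero g (p := (p.1, r)) ⟨hp.1, hr⟩)
      (det_metric_ne_zero g (p := (p.1, 0)) ⟨hp.1, h0⟩)
  have h1 : detRatio g x (p.1, 0) = 1 :=
    div_self (det_metric_ne_zero g (p := (p.1, 0)) ⟨hp.1, h0⟩)
  by_contra hneg
  obtain ⟨r, hr, hr0⟩ := isPreconnected_Ioo.intermediate_value hp.2 h0 hc
    (show (0 : ℝ) ∈ Icc _ _ from ⟨not_lt.1 hneg, by rw [h1]; exact zero_le_one⟩)
  exact hne r hr hr0

theorem wFun_pos (hε : 0 < ε) (y : M) {s : ℝ} (hs : s ∈ Ioo (-ε) ε) : 0 < wFun g y s := by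
  rw [wFun_eq g (mem_chart_source _ y)]
  exact Real.rpow_pos_of_pos (detRatio_pos g hε ⟨mem_chart_target _ y, hs⟩) _

theorem chartSmoothFam_wFun (hε : 0 < ε) : ChartSmoothFam n ε (wFun g) := by
  intro x
  refine ((contDiffOn_detRatio g hε x).rpow_const_of_ne (p := (1 / 4 : ℝ))
    fun p hp => (detRatio_pos g hε hp).ne').congr fun p hp => ?_
  rw [wFun_eq g ((chartAt (E n) x).map_target hp.1), (chartAt (E n) x).right_inv hp.1]

/-- Since `w⁴` is the ratio of determinants, `dvol_{g_ρ} = w² dvol_g`; this is what the conjugation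
by `w` is made for. -/
theorem sqrt_det_metric (hε : 0 < ε) {x y : M} (hy : y ∈ (chartAt (E n) x).source) {s : ℝ}
    (hs : s ∈ Ioo (-ε) ε) :
    √|(gram (chartAt (E n) x) (g.metric s) (chartAt (E n) x y)).det| =
      wFun g y s ^ 2 * √|(gram (chartAt (E n) x) (g.metric 0) (chartAt (E n) x y)).det| := by
  have hp : (chartAt (E n) x y, s) ∈ (chartAt (E n) x).target ×ˢ Ioo (-ε) ε :=
    ⟨(chartAt (E n) x).map_source hy, hs⟩
  have h0 : (0 : ℝ) ∈ Ioo (-ε) ε := ⟨by linarith, hε⟩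
  have hne := det_metric_ne_zero g (p := (chartAt (E n) x y, 0)) ⟨hp.1, h0⟩
  have hpos := detRatio_pos g hε hp
  rw [wFun_eq g hy, ← Real.rpow_natCast, ← Real.rpow_mul hpos.le,
    show (1 / 4 : ℝ) * ((2 : ℕ) : ℝ) = 1 / 2 by norm_num, ← Real.sqrt_eq_rpow,
    ← Real.sqrt_mul hpos.le]
  congr 1
  rw [detRatio] at hpos ⊢
  rw [← abs_of_pos hpos, ← abs_mul, div_mul_cancel₀ _ hne]

/-- The coefficient of order zero of `M̃(ρ)`, as a differential operator conjugated by `w`. -/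
def zeroth (x : M) (ρ : ℝ) : ℝ :=
  wFun g x ρ * (n * deriv (fun r => (wFun g x r)⁻¹) ρ -
    2 * ((wFun g x ρ ^ 2)⁻¹ *
      deriv (fun r => wFun g x r ^ 2 * (r * deriv (fun r => (wFun g x r)⁻¹) r)) ρ))

/-- The inverse ambient metric is block diagonal, so the divergence splits. At `τ = 1` the
`M`-directions give the Laplacian of `g_ρ`. The `τ`- and `ρ`-directions see only the `ρ`-dependence
of `w⁻¹`, because `u` is constant there, and contribute a multiple of `u`. -/
theorem Mtilde_eq (hε : 0 < ε) {u : M → ℝ} (hu : ChartSmooth n u) {ρ : ℝ} (hρ : ρ ∈ Ioo (-ε) ε)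
    (x : M) :
    Mtilde g ρ u x = wFun g x ρ * lap (g.metric ρ) (fun y => (wFun g y ρ)⁻¹ * u y) x +
      zeroth g x ρ * u x := by
  set φ := chartAt (E n) x with hφ
  set O := φ.target ×ˢ Ioo (-ε) ε with hO
  have hOo : IsOpen O := isOpen_chartDom x
  set q : E n × ℝ → ℝ := fun p => (wFun g (φ.symm p.1) p.2)⁻¹ with hq
  have hqs : ContDiffOn ℝ ∞ q O := (chartSmoothFam_wFun g hε x).inv fun p hp =>
    (wFun_pos g hε _ hp.2).ne'
  set Q : E n × ℝ → ℝ := fun p => q p * u (φ.symm p.1) with hQ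
  have hQs : ContDiffOn ℝ ∞ Q O := hqs.mul ((hu x).comp contDiffOn_fst fun p hp => hp.1)
  set s : E n × ℝ → ℝ := fun p => √|(gram φ (g.metric p.2) p.1).det| with hs
  have hss : ContDiffOn ℝ ∞ s O :=
    contDiffOn_sqrt_det (g.smooth x) fun p hp => det_metric_ne_zero g hp
  set k : Fin n → Fin n → E n × ℝ → ℝ := fun i j p => (gram φ (g.metric p.2) p.1)⁻¹ i j with hk
  have hks : ∀ i j, ContDiffOn ℝ ∞ (k i j) O := fun i j =>
    contDiffOn_inv_apply (g.smooth x) (fun p hp => det_metric_ne_zero g hp) i j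
  set Ξ : Set (E n × ℝ × ℝ) := {p | (p.1, p.2.2) ∈ O ∧ 0 < p.2.1} with hΞ
  have hπc : Continuous fun p : E n × ℝ × ℝ => (p.1, p.2.2) := by fun_prop
  have hτc : Continuous fun p : E n × ℝ × ℝ => p.2.1 := by fun_prop
  have hΞo : IsOpen Ξ := (hOo.preimage hπc).inter (isOpen_lt continuous_const hτc)
  have hπ : ContDiffOn ℝ ∞ (fun p : E n × ℝ × ℝ => (p.1, p.2.2)) Ξ := by fun_prop
  have hπm : MapsTo (fun p : E n × ℝ × ℝ => (p.1, p.2.2)) Ξ O := fun p hp => hp.1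
  have hτs : ContDiffOn ℝ ∞ (fun p : E n × ℝ × ℝ => p.2.1) Ξ := by fun_prop
  -- The components of the flux `|det G̃|^{1/2} G̃⁻¹ ∂F` in the regrouped variables `(z, τ, ρ)`,
  -- valid for `τ > 0`.
  set Ψ : AmbIdx n → E n × ℝ × ℝ → ℝ := Sum.elim
    (fun i p => p.2.1 ^ (n + 1) * s (p.1, p.2.2) *
      ∑ j, (p.2.1 ^ 2)⁻¹ * k i j (p.1, p.2.2) * dx j Q (p.1, p.2.2))
    ![fun p => p.2.1 ^ (n + 1) * s (p.1, p.2.2) * (p.2.1⁻¹ * dr Q (p.1, p.2.2)),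
      fun p => p.2.1 ^ (n + 1) * s (p.1, p.2.2) *
        (-2 * p.2.2 * (p.2.1 ^ 2)⁻¹ * dr Q (p.1, p.2.2))] with hΨ
  have hτne : ∀ p ∈ Ξ, p.2.1 ≠ 0 := fun p hp => hp.2.ne'
  have hpre : ContDiffOn ℝ ∞ (fun p : E n × ℝ × ℝ => p.2.1 ^ (n + 1) * s (p.1, p.2.2)) Ξ :=
    (hτs.pow _).mul (hss.comp hπ hπm)
  have hΨs : ∀ i, ContDiffOn ℝ ∞ (Ψ i) Ξ := by
    rintro (i | i)
    · refine hpre.mul (ContDiffOn.sum fun j _ => ?_)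
      exact (((hτs.pow 2).inv fun p hp => pow_ne_zero 2 (hτne p hp)).mul
        ((hks i j).comp hπ hπm)).mul ((contDiffOn_dx hOo hQs j).comp hπ hπm)
    · fin_cases i
      · exact hpre.mul ((hτs.inv hτne).mul ((contDiffOn_dr hOo hQs).comp hπ hπm))
      · refine hpre.mul (ContDiffOn.mul ?_ ((contDiffOn_dr hOo hQs).comp hπ hπm))
        exact ContDiffOn.mul (by fun_prop) ((hτs.pow 2).inv fun p hp => pow_ne_zero 2 (hτne p hp))
  set F : (AmbIdx n → ℝ) → ℝ := fun ξ =>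
    (wFun g (φ.symm (baseCoord ξ)) (ξ (Sum.inr 1)))⁻¹ * u (φ.symm (baseCoord ξ)) with hF
  have hFH : F = (fun p : E n × ℝ × ℝ => Q (p.1, p.2.2)) ∘ ambEquiv n := rfl
  have hdQ : ∀ p ∈ Ξ, DifferentiableAt ℝ (fun p : E n × ℝ × ℝ => Q (p.1, p.2.2)) p := fun p hp =>
    ((hQs.comp hπ hπm).contDiffAt (hΞo.mem_nhds hp)).differentiableAt (by simp)
  have hflux : ∀ ξ, ambEquiv n ξ ∈ Ξ → ∀ i, √|(ambGram g φ ξ).det| *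
      ∑ j, (ambGram g φ ξ)⁻¹ i j * pd j F ξ = (Ψ i ∘ ambEquiv n) ξ := by
    intro ξ hξ i
    have hd := hdQ _ hξ
    have e1 : ∀ j, pd (Sum.inl j) F ξ = dx j Q (baseCoord ξ, ξ (Sum.inr 1)) := fun j => by
      rw [hFH, pd_inl hd]; rfl
    have e2 : pd (Sum.inr 0) F ξ = 0 := by
      rw [hFH, pd_inr_zero hd]; simp
    have e3 : pd (Sum.inr 1) F ξ = dr Q (baseCoord ξ, ξ (Sum.inr 1)) := by
      rw [hFH, pd_inr_one hd]; rfl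
    rw [sqrt_det_ambGram g φ hξ.2, inv_ambGram g φ hξ.2 (det_metric_ne_zero g hξ.1),
      Fintype.sum_sum_type, Fin.sum_univ_two, e2, e3]
    simp only [e1]
    rcases i with i | i
    · simp [hΨ, ambEquiv_apply, hs, hk]
    · fin_cases i <;> simp [hΨ, ambEquiv_apply, hs]
  set ξ0 : AmbIdx n → ℝ := Sum.elim (fun i => φ x i) ![1, ρ] with hξ0
  have hb : ambEquiv n ξ0 = (φ x, 1, ρ) := rfl
  have hxO : (φ x, ρ) ∈ O := ⟨mem_chart_target _ x, hρ⟩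
  have hξΞ : ambEquiv n ξ0 ∈ Ξ := ⟨hxO, one_pos⟩
  have hpd : ∀ i, pd i (fun ξ => √|(ambGram g φ ξ).det| *
      ∑ j, (ambGram g φ ξ)⁻¹ i j * pd j F ξ) ξ0 = pd i (Ψ i ∘ ambEquiv n) ξ0 := by
    intro i
    have : (fun ξ => √|(ambGram g φ ξ).det| * ∑ j, (ambGram g φ ξ)⁻¹ i j * pd j F ξ) =ᶠ[nhds ξ0]
        Ψ i ∘ ambEquiv n := by
      filter_upwards [(hΞo.preimage (ambEquiv n).continuous).mem_nhds hξΞ] with ξ hξ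
      exact hflux ξ hξ i
    rw [pd, pd, this.fderiv_eq]
  have hdΨ : ∀ i, DifferentiableAt ℝ (Ψ i) (ambEquiv n ξ0) := fun i =>
    ((hΨs i).contDiffAt (hΞo.mem_nhds hξΞ)).differentiableAt (by simp)
  have hsx : φ.symm (φ x) = x := φ.left_inv (mem_chart_source _ x)
  have hdr : ∀ r, dr Q (φ x, r) = u x * deriv (fun r => (wFun g x r)⁻¹) r := by
    intro r
    simp only [dr, hQ, hq, hsx]
    rw [deriv_mul_const_field, mul_comm]
  have hs0 : ∀ r ∈ Ioo (-ε) ε, s (φ x, r) = wFun g x r ^ 2 * s (φ x, 0) := fun r hr =>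
    sqrt_det_metric g hε (mem_chart_source _ x) hr
  have hs0ne : s (φ x, 0) ≠ 0 := by
    have h0 : (0 : ℝ) ∈ Ioo (-ε) ε := ⟨by linarith, hε⟩
    exact (Real.sqrt_pos.2 (abs_pos.2 (det_metric_ne_zero g (p := (φ x, 0)) ⟨hxO.1, h0⟩))).ne'
  have hw := (wFun_pos g hε x hρ).ne'
  have t1 : ∀ i, pd (Sum.inl i) (Ψ (Sum.inl i) ∘ ambEquiv n) ξ0 =
      pe i (fun z => s (z, ρ) * ∑ j, k i j (z, ρ) * dx j Q (z, ρ)) (φ x) := by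
    intro i
    rw [pd_inl (hdΨ _)]
    congr 1
    ext z
    simp [hΨ, hξ0]
  -- The volume factor `τ^{n+1}` meets the entry `τ⁻¹` of the inverse metric; differentiating `τ^n`
  -- at `1` gives the `n` in `zeroth`.
  have t2 : pd (Sum.inr 0) (Ψ (Sum.inr 0) ∘ ambEquiv n) ξ0 = n * s (φ x, ρ) * dr Q (φ x, ρ) := by
    rw [pd_inr_zero (hdΨ _)]
    have h1 : HasDerivAt (fun t : ℝ => t ^ n * (s (φ x, ρ) * dr Q (φ x, ρ)))
        ((n * 1 ^ (n - 1)) * (s (φ x, ρ) * dr Q (φ x, ρ))) 1 :=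
      (hasDerivAt_pow n 1).mul_const _
    have h2 : (fun t => Ψ (Sum.inr 0) (baseCoord ξ0, t, ξ0 (Sum.inr 1))) =ᶠ[nhds 1]
        fun t : ℝ => t ^ n * (s (φ x, ρ) * dr Q (φ x, ρ)) := by
      filter_upwards [isOpen_ne.mem_nhds (one_ne_zero (α := ℝ))] with t ht
      change t ^ (n + 1) * s (φ x, ρ) * (t⁻¹ * dr Q (φ x, ρ)) = _
      field_simp
      ring
    rw [show ξ0 (Sum.inr 0) = 1 from rfl, h2.deriv_eq, h1.deriv]
    simp only [one_pow]
    ring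
  -- Writing the density as `w²` times its value at `ρ = 0` leaves only `w` under the derivative.
  have t3 : pd (Sum.inr 1) (Ψ (Sum.inr 1) ∘ ambEquiv n) ξ0 =
      -2 * s (φ x, 0) * u x *
        deriv (fun r => wFun g x r ^ 2 * (r * deriv (fun r => (wFun g x r)⁻¹) r)) ρ := by
    rw [pd_inr_one (hdΨ _), ← deriv_const_mul_field]
    refine Filter.EventuallyEq.deriv_eq ?_
    filter_upwards [isOpen_Ioo.mem_nhds hρ] with r hr
    change 1 ^ (n + 1) * s (φ x, r) * (-2 * r * (1 ^ 2)⁻¹ * dr Q (φ x, r)) = _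
    rw [hs0 r hr, hdr]
    ring
  have hlap : ambLaplacian g (fun _ y r => (wFun g y r)⁻¹ * u y) 1 x ρ =
      lap (g.metric ρ) (fun y => (wFun g y ρ)⁻¹ * u y) x +
      (s (φ x, ρ))⁻¹ * (n * s (φ x, ρ) * dr Q (φ x, ρ) + -2 * s (φ x, 0) * u x *
        deriv (fun r => wFun g x r ^ 2 * (r * deriv (fun r => (wFun g x r)⁻¹) r)) ρ) := by
    change (√|(ambGram g φ ξ0).det|)⁻¹ * ∑ i, pd i (fun ξ => √|(ambGram g φ ξ).det| *
      ∑ j, (ambGram g φ ξ)⁻¹ i j * pd j F ξ) ξ0 = _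
    simp only [hpd]
    rw [Fintype.sum_sum_type, Fin.sum_univ_two, t2, t3, sqrt_det_ambGram g φ hξΞ.2, mul_add]
    congr 1
    · simp only [t1]
      rw [show ξ0 (Sum.inr 0) = 1 from rfl, one_pow, one_mul]
      rfl
    · rw [show ξ0 (Sum.inr 0) = 1 from rfl, one_pow, one_mul]
      rfl
  have hsne : s (φ x, ρ) ≠ 0 := by rw [hs0 ρ hρ]; exact mul_ne_zero (pow_ne_zero 2 hw) hs0ne
  rw [Mtilde, ambLaplacianW, hlap, zeroth, hdr, hs0 ρ hρ]
  field_simp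
  ring

end

/-! ### Iterated partial derivatives -/

section

variable {n : ℕ}

theorem dx_congr_on {O : Set (E n × ℝ)} (hO : IsOpen O) {Q R : E n × ℝ → ℝ} (h : EqOn Q R O)
    {p : E n × ℝ} (hp : p ∈ O) (i : Fin n) : dx i Q p = dx i R p := by
  refine pe_congr ?_
  have hc : Continuous fun z : E n => (z, p.2) := by fun_prop
  filter_upwards [(hO.preimage hc).mem_nhds hp] with z hz
  exact h hz

theorem dr_congr_on {O : Set (E n × ℝ)} (hO : IsOpen O) {Q R : E n × ℝ → ℝ} (h : EqOn Q R O)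
    {p : E n × ℝ} (hp : p ∈ O) : dr Q p = dr R p := by
  refine Filter.EventuallyEq.deriv_eq ?_
  have hc : Continuous fun r : ℝ => (p.1, r) := by fun_prop
  filter_upwards [(hO.preimage hc).mem_nhds hp] with r hr
  exact h hr

/-- Symmetry of the second derivative. -/
theorem dx_dr {O : Set (E n × ℝ)} (hO : IsOpen O) {Q : E n × ℝ → ℝ} (h : ContDiffOn ℝ ∞ Q O)
    {p : E n × ℝ} (hp : p ∈ O) (i : Fin n) : dx i (dr Q) p = dr (dx i Q) p := by
  have hd : ∀ p ∈ O, DifferentiableAt ℝ Q p := fun p hp =>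
    (h.contDiffAt (hO.mem_nhds hp)).differentiableAt (by simp)
  have h2 : DifferentiableAt ℝ (fderiv ℝ Q) p :=
    ((h.fderiv_of_isOpen hO (m := ∞) (by simp)).contDiffAt (hO.mem_nhds hp)).differentiableAt
      (by simp)
  have e1 : EqOn (dr Q) (fun p => fderiv ℝ Q p (0, 1)) O := fun p hp => dr_eq_fderiv (hd p hp)
  have e2 : EqOn (dx i Q) (fun p => fderiv ℝ Q p (EuclideanSpace.single i 1, 0)) O :=
    fun p hp => dx_eq_fderiv (hd p hp) i
  rw [dx_congr_on hO e1 hp, dr_congr_on hO e2 hp,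
    dx_eq_fderiv (h2.clm_apply (differentiableAt_const _)),
    dr_eq_fderiv (h2.clm_apply (differentiableAt_const _)),
    fderiv_clm_apply h2 (differentiableAt_const _), fderiv_clm_apply h2 (differentiableAt_const _)]
  simpa using ((h.contDiffAt (hO.mem_nhds hp)).isSymmSndFDerivAt (by
    rw [minSmoothness_of_isRCLikeNormedField]; exact WithTop.coe_le_coe.2 (le_top : (2 : ℕ∞) ≤ ⊤))).eq _ _

/-- The iterated derivative with respect to the parameter. -/
def itdr (m : ℕ) (Q : E n × ℝ → ℝ) (p : E n × ℝ) : ℝ := iteratedDeriv m (fun r => Q (p.1, r)) p.2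

theorem itdr_zero (Q : E n × ℝ → ℝ) : itdr 0 Q = Q := by ext p; simp [itdr]

theorem itdr_succ (m : ℕ) (Q : E n × ℝ → ℝ) : itdr (m + 1) Q = dr (itdr m Q) := by
  ext p
  simp [itdr, dr, iteratedDeriv_succ]

theorem contDiffOn_itdr {O : Set (E n × ℝ)} (hO : IsOpen O) {Q : E n × ℝ → ℝ}
    (h : ContDiffOn ℝ ∞ Q O) (m : ℕ) : ContDiffOn ℝ ∞ (itdr m Q) O := by
  induction m with
  | zero => rwa [itdr_zero]
  | succ m ih => rw [itdr_succ]; exact contDiffOn_dr hO ih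

theorem dx_itdr {O : Set (E n × ℝ)} (hO : IsOpen O) {Q : E n × ℝ → ℝ} (h : ContDiffOn ℝ ∞ Q O)
    (i : Fin n) (m : ℕ) : EqOn (dx i (itdr m Q)) (itdr m (dx i Q)) O := by
  induction m with
  | zero => rw [itdr_zero, itdr_zero]; exact fun _ _ => rfl
  | succ m ih =>
    intro p hp
    rw [itdr_succ, itdr_succ, dx_dr hO (contDiffOn_itdr hO h m) hp, dr_congr_on hO ih hp]

/-- Iterated partial derivatives on `E n`. -/
def iterpe (l : List (Fin n)) (u : E n → ℝ) : E n → ℝ := l.foldr pe u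

/-- Iterated partial derivatives on `E n × ℝ`. -/
def iterdx (l : List (Fin n)) (Q : E n × ℝ → ℝ) : E n × ℝ → ℝ := l.foldr dx Q

theorem iterdx_apply (l : List (Fin n)) (Q : E n × ℝ → ℝ) (r : ℝ) :
    (fun z => iterdx l Q (z, r)) = iterpe l fun z => Q (z, r) := by
  induction l with
  | nil => rfl
  | cons i l ih =>
    ext z
    simp only [iterdx, iterpe, List.foldr_cons, dx] at ih ⊢
    rw [ih]

theorem contDiffOn_iterdx {O : Set (E n × ℝ)} (hO : IsOpen O) {Q : E n × ℝ → ℝ}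
    (h : ContDiffOn ℝ ∞ Q O) (l : List (Fin n)) : ContDiffOn ℝ ∞ (iterdx l Q) O := by
  induction l with
  | nil => exact h
  | cons i l ih => exact contDiffOn_dx hO ih i

theorem contDiffOn_iterpe {O : Set (E n)} (hO : IsOpen O) {u : E n → ℝ}
    (h : ContDiffOn ℝ ∞ u O) (l : List (Fin n)) : ContDiffOn ℝ ∞ (iterpe l u) O := by
  induction l with
  | nil => exact h
  | cons i l ih => exact contDiffOn_pe hO ih i

theorem iterdx_itdr {O : Set (E n × ℝ)} (hO : IsOpen O) {Q : E n × ℝ → ℝ}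
    (h : ContDiffOn ℝ ∞ Q O) (l : List (Fin n)) (m : ℕ) :
    EqOn (iterdx l (itdr m Q)) (itdr m (iterdx l Q)) O := by
  induction l with
  | nil => exact fun _ _ => rfl
  | cons i l ih =>
    intro p hp
    refine (dx_congr_on hO ih hp i).trans ?_
    exact dx_itdr hO (contDiffOn_iterdx hO h l) i m hp

theorem iterpe_add {O : Set (E n)} (hO : IsOpen O) {u v : E n → ℝ} (hu : ContDiffOn ℝ ∞ u O)
    (hv : ContDiffOn ℝ ∞ v O) (l : List (Fin n)) :
    EqOn (iterpe l fun z => u z + v z) (fun z => iterpe l u z + iterpe l v z) O := by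
  induction l with
  | nil => exact fun _ _ => rfl
  | cons i l ih =>
    intro z hz
    refine (pe_congr_on hO ih hz).trans ?_
    rw [pe, fderiv_fun_add]
    · rfl
    · exact ((contDiffOn_iterpe hO hu l).contDiffAt (hO.mem_nhds hz)).differentiableAt (by simp)
    · exact ((contDiffOn_iterpe hO hv l).contDiffAt (hO.mem_nhds hz)).differentiableAt (by simp)

theorem iterpe_const_mul (c : ℝ) (u : E n → ℝ) (l : List (Fin n)) :
    (iterpe l fun z => c * u z) = fun z => c * iterpe l u z := by
  induction l with
  | nil => rfl
  | cons i l ih =>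
    ext z
    simp only [iterpe, List.foldr_cons] at ih ⊢
    rw [ih]
    change fderiv ℝ (c • l.foldr pe u) z _ = _
    rw [fderiv_const_smul_field]
    rfl

theorem iterpe_eq_zero {u : E n → ℝ} {z : E n} (h : u =ᶠ[nhds z] fun _ => 0)
    (l : List (Fin n)) : iterpe l u z = 0 := by
  have : iterpe l u =ᶠ[nhds z] fun _ => 0 := by
    induction l with
    | nil => exact h
    | cons i l ih =>
      filter_upwards [ih.eventuallyEq_nhds] with y hy
      refine (pe_congr hy).trans ?_
      simp [pe]
  exact this.self_of_nhds

/-! ### Families of differential operators -/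

/-- A family of linear differential operators with smooth coefficients. -/
def IsDiffOp (O : Set (E n)) (ε : ℝ) (T : (E n → ℝ) → E n × ℝ → ℝ) : Prop :=
  ∃ (ι : Type) (_ : Fintype ι) (c : ι → E n × ℝ → ℝ) (l : ι → List (Fin n)),
    (∀ α, ContDiffOn ℝ ∞ (c α) (O ×ˢ Ioo (-ε) ε)) ∧
    ∀ u, ContDiffOn ℝ ∞ u O → ∀ p ∈ O ×ˢ Ioo (-ε) ε,
      T u p = ∑ α, c α p * iterpe (l α) u p.1

namespace IsDiffOp

variable {O : Set (E n)} {ε : ℝ} {T T' : (E n → ℝ) → E n × ℝ → ℝ}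

theorem id : IsDiffOp O ε fun u p => u p.1 :=
  ⟨Unit, inferInstance, fun _ _ => 1, fun _ => [], fun _ => contDiffOn_const, fun u _ p _ => by
    simp [iterpe]⟩

theorem zero : IsDiffOp O ε fun _ _ => 0 :=
  ⟨Empty, inferInstance, fun _ _ => 1, fun _ => [], fun _ => contDiffOn_const, fun u _ p _ => by
    simp⟩

theorem add (hT : IsDiffOp O ε T) (hT' : IsDiffOp O ε T') :
    IsDiffOp O ε fun u p => T u p + T' u p := by
  obtain ⟨ι, _, c, l, hc, h⟩ := hT
  obtain ⟨ι', _, c', l', hc', h'⟩ := hT'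
  refine ⟨ι ⊕ ι', inferInstance, Sum.elim c c', Sum.elim l l', ?_, fun u hu p hp => ?_⟩
  · rintro (α | α)
    exacts [hc α, hc' α]
  · beta_reduce
    rw [h u hu p hp, h' u hu p hp]
    simp

theorem sum {κ : Type*} (s : Finset κ) {T : κ → (E n → ℝ) → E n × ℝ → ℝ}
    (hT : ∀ k, IsDiffOp O ε (T k)) : IsDiffOp O ε fun u p => ∑ k ∈ s, T k u p := by
  classical
  induction s using Finset.induction_on with
  | empty => simpa using zero
  | insert a s ha ih =>
    simp only [Finset.sum_insert ha]
    exact (hT a).add ih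

theorem mul (hT : IsDiffOp O ε T) {a : E n × ℝ → ℝ} (ha : ContDiffOn ℝ ∞ a (O ×ˢ Ioo (-ε) ε)) :
    IsDiffOp O ε fun u p => a p * T u p := by
  obtain ⟨ι, _, c, l, hc, h⟩ := hT
  refine ⟨ι, inferInstance, fun α p => a p * c α p, l, fun α => ha.mul (hc α),
    fun u hu p hp => ?_⟩
  beta_reduce
  rw [h u hu p hp, Finset.mul_sum]
  simp only [mul_assoc]

/-- By the product rule each term yields one with a differentiated coefficient and one with a longer
list of derivatives, hence the index type `ι ⊕ ι`. -/
theorem dx (hO : IsOpen O) (hT : IsDiffOp O ε T) (i : Fin n) :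
    IsDiffOp O ε fun u p => JuhlLinear.dx i (T u) p := by
  obtain ⟨ι, _, c, l, hc, h⟩ := hT
  have hΩ : IsOpen (O ×ˢ Ioo (-ε) ε) := hO.prod isOpen_Ioo
  refine ⟨ι ⊕ ι, inferInstance, Sum.elim (fun α => JuhlLinear.dx i (c α)) c,
    Sum.elim l fun α => i :: l α, ?_, fun u hu p hp => ?_⟩
  · rintro (α | α)
    exacts [contDiffOn_dx hΩ (hc α) i, hc α]
  · beta_reduce
    rw [dx_congr_on hΩ (h u hu) hp, JuhlLinear.dx, pe]
    have d1 : ∀ α, DifferentiableAt ℝ (fun z => c α (z, p.2)) p.1 := fun α => by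
      have : ContDiffAt ℝ ∞ (c α) (p.1, p.2) := (hc α).contDiffAt (hΩ.mem_nhds hp)
      exact (this.comp p.1 (contDiffAt_id.prodMk contDiffAt_const)).differentiableAt (by simp)
    have d2 : ∀ α, DifferentiableAt ℝ (iterpe (l α) u) p.1 := fun α =>
      ((contDiffOn_iterpe hO hu (l α)).contDiffAt (hO.mem_nhds hp.1)).differentiableAt (by simp)
    change fderiv ℝ (fun z => ∑ α, c α (z, p.2) * iterpe (l α) u z) p.1 _ = _
    rw [fderiv_fun_sum fun α _ => (d1 α).fun_mul (d2 α), sum_apply, Fintype.sum_sum_type,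
      ← Finset.sum_add_distrib]
    refine Finset.sum_congr rfl fun α _ => ?_
    rw [fderiv_fun_mul (d1 α) (d2 α)]
    simp only [add_apply, smul_apply, smul_eq_mul, Sum.elim_inl, Sum.elim_inr, JuhlLinear.dx, pe,
      iterpe, List.foldr_cons]
    ring

end IsDiffOp

end

/-! ### The operators `M̃(ρ)` in a chart -/

section

variable {n : ℕ} {M : Type*} [TopologicalSpace M] [ChartedSpace (E n) M] {ε : ℝ}

theorem ChartSmoothFam.slice {F : M → ℝ → ℝ} (hF : ChartSmoothFam n ε F) {r : ℝ}
    (hr : r ∈ Ioo (-ε) ε) : ChartSmooth n fun y => F y r := fun x =>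
  (hF x).comp (f := fun z : E n => (z, r)) (contDiffOn_id.prodMk contDiffOn_const)
    fun _ hz => ⟨hz, hr⟩

theorem ChartSmooth.const {u : M → ℝ} (hu : ChartSmooth n u) :
    ChartSmoothFam n ε fun y _ => u y := fun x => (hu x).comp contDiffOn_fst fun _ hp => hp.1

theorem ChartSmoothFam.mul {F G : M → ℝ → ℝ} (hF : ChartSmoothFam n ε F)
    (hG : ChartSmoothFam n ε G) : ChartSmoothFam n ε fun y r => F y r * G y r := fun x =>
  (hF x).mul (hG x)

theorem ChartSmoothFam.add {F G : M → ℝ → ℝ} (hF : ChartSmoothFam n ε F)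
    (hG : ChartSmoothFam n ε G) : ChartSmoothFam n ε fun y r => F y r + G y r := fun x =>
  (hF x).add (hG x)

theorem ChartSmoothFam.iteratedDeriv {F : M → ℝ → ℝ} (hF : ChartSmoothFam n ε F) (m : ℕ) :
    ChartSmoothFam n ε fun y r => iteratedDeriv m (F y) r := fun x =>
  contDiffOn_itdr (isOpen_chartDom x) (hF x) m

theorem ChartSmoothFam.contDiffAt {F : M → ℝ → ℝ} (hF : ChartSmoothFam n ε F) (x : M) {r : ℝ}
    (hr : r ∈ Ioo (-ε) ε) : ContDiffAt ℝ ∞ (F x) r := by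
  have := contDiffAt_slice (isOpen_chartDom (n := n) x) (hF x) (p := (chartAt (E n) x x, r))
    ⟨mem_chart_target (E n) x, hr⟩
  simpa only [(chartAt (E n) x).left_inv (mem_chart_source (E n) x)] using this

theorem eventuallyEq_comp_symm {u v : M → ℝ} {x y : M} (hy : y ∈ (chartAt (E n) x).source)
    (h : u =ᶠ[nhds y] v) :
    u ∘ (chartAt (E n) x).symm =ᶠ[nhds (chartAt (E n) x y)] v ∘ (chartAt (E n) x).symm := by
  have := (chartAt (E n) x).continuousAt_symm ((chartAt (E n) x).map_source hy)
  rw [ContinuousAt, (chartAt (E n) x).left_inv hy] at this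
  exact this.eventually h

variable [IsManifold (𝓡 n) ∞ M] (g : MetricFamily n M ε)

theorem chartSmoothFam_wFun_inv (hε : 0 < ε) :
    ChartSmoothFam n ε fun y r => (wFun g y r)⁻¹ := fun x =>
  (chartSmoothFam_wFun g hε x).inv fun _ hp => (wFun_pos g hε _ hp.2).ne'

theorem chartSmoothFam_zeroth (hε : 0 < ε) : ChartSmoothFam n ε (zeroth g) := by
  intro x
  have hO := isOpen_chartDom (n := n) (ε := ε) x
  have h1 := contDiffOn_dr hO (chartSmoothFam_wFun_inv g hε x)
  have h2 := contDiffOn_dr hO (((chartSmoothFam_wFun g hε x).pow 2).mul (contDiffOn_snd.mul h1))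
  have h3 := ((chartSmoothFam_wFun g hε x).pow 2).inv fun p hp =>
    pow_ne_zero 2 (wFun_pos g hε _ hp.2).ne'
  exact (chartSmoothFam_wFun g hε x).mul ((contDiffOn_const.mul h1).sub
    (contDiffOn_const.mul (h3.mul h2)))

variable [T2Space M] [SecondCountableTopology M]

/-- One set of coefficients serves the whole chart domain, although `Mtilde` at `y` is computed in
the chart at `y`; this is where `lap_eq_lapChart` enters. Smoothness, linearity, locality and the
Leibniz rule for `M̃(ρ)` are all read off from this form. -/
theorem exists_Mtilde_eq (hε : 0 < ε) (x : M) :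
    ∃ (ι : Type) (_ : Fintype ι) (c : ι → E n × ℝ → ℝ) (l : ι → List (Fin n)),
      (∀ α, ContDiffOn ℝ ∞ (c α) ((chartAt (E n) x).target ×ˢ Ioo (-ε) ε)) ∧
      ∀ u, ChartSmooth n u → ∀ y ∈ (chartAt (E n) x).source, ∀ ρ ∈ Ioo (-ε) ε,
        Mtilde g ρ u y = ∑ α, c α (chartAt (E n) x y, ρ) *
          iterpe (l α) (u ∘ (chartAt (E n) x).symm) (chartAt (E n) x y) := by
  -- A measurable structure is needed only because chart independence of the Laplacian was obtained
  -- by integration.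
  borelize M
  set φ := chartAt (E n) x with hφ
  have hO := φ.open_target
  set q : E n × ℝ → ℝ := fun p => (wFun g (φ.symm p.1) p.2)⁻¹ with hq
  have hqs := chartSmoothFam_wFun_inv g hε x
  set s : E n × ℝ → ℝ := fun p => √|(gram φ (g.metric p.2) p.1).det| with hs
  have hss : ContDiffOn ℝ ∞ s (φ.target ×ˢ Ioo (-ε) ε) :=
    contDiffOn_sqrt_det (g.smooth x) fun p hp => det_metric_ne_zero g hp
  have hsi := hss.inv fun p hp =>
    (Real.sqrt_pos.2 (abs_pos.2 (det_metric_ne_zero g hp))).ne'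
  set k : Fin n → Fin n → E n × ℝ → ℝ := fun i j p => (gram φ (g.metric p.2) p.1)⁻¹ i j with hk
  have hks : ∀ i j, ContDiffOn ℝ ∞ (k i j) (φ.target ×ˢ Ioo (-ε) ε) := fun i j =>
    contDiffOn_inv_apply (g.smooth x) (fun p hp => det_metric_ne_zero g hp) i j
  have h1 : IsDiffOp φ.target ε fun u p => wFun g (φ.symm p.1) p.2 * ((s p)⁻¹ *
      ∑ i, dx i (fun p => s p * ∑ j, k i j p * dx j (fun p => q p * u p.1) p) p) +
      zeroth g (φ.symm p.1) p.2 * u p.1 := by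
    refine IsDiffOp.add (IsDiffOp.mul (IsDiffOp.mul (IsDiffOp.sum _ fun i => ?_) hsi)
      (chartSmoothFam_wFun g hε x)) (IsDiffOp.mul IsDiffOp.id (chartSmoothFam_zeroth g hε x))
    refine IsDiffOp.dx (T := fun u p => s p * ∑ j, k i j p * dx j (fun p => q p * u p.1) p) hO
      (IsDiffOp.mul (IsDiffOp.sum _ fun j => IsDiffOp.mul ?_ (hks i j)) hss) i
    exact IsDiffOp.dx (T := fun u p => q p * u p.1) hO (IsDiffOp.mul IsDiffOp.id hqs) j
  obtain ⟨ι, hι, c, l, hc, h⟩ := h1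
  refine ⟨ι, hι, c, l, hc, fun u hu y hy ρ hρ => ?_⟩
  have hv : ChartSmooth n fun y => (wFun g y ρ)⁻¹ * u y :=
    ((chartSmoothFam_wFun_inv g hε).slice hρ).mul hu
  rw [Mtilde_eq g hε hu hρ, lap_eq_lapChart (g.isMetric hρ) hv hy,
    ← h _ (hu x) (φ y, ρ) ⟨φ.map_source hy, hρ⟩]
  simp only [Function.comp_apply, ← hφ, φ.left_inv hy]
  rfl

theorem chartSmoothFam_Mtilde (hε : 0 < ε) {F : M → ℝ → ℝ} (hF : ChartSmoothFam n ε F) :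
    ChartSmoothFam n ε fun y ρ => Mtilde g ρ (fun z => F z ρ) y := by
  intro x
  obtain ⟨ι, _, c, l, hc, h⟩ := exists_Mtilde_eq g hε x
  have h1 : ContDiffOn ℝ ∞ (fun p => ∑ α, c α p *
      iterdx (l α) (fun p : E n × ℝ => F ((chartAt (E n) x).symm p.1) p.2) p)
      ((chartAt (E n) x).target ×ˢ Ioo (-ε) ε) :=
    ContDiffOn.sum fun α _ => (hc α).mul (contDiffOn_iterdx (isOpen_chartDom x) (hF x) (l α))
  refine h1.congr fun p hp => ?_
  beta_reduce
  rw [h _ (hF.slice hp.2) _ ((chartAt (E n) x).map_target hp.1) _ hp.2,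
    (chartAt (E n) x).right_inv hp.1]
  refine Finset.sum_congr rfl fun α _ => ?_
  congr 1
  exact (congrFun (iterdx_apply (l α)
    (fun p : E n × ℝ => F ((chartAt (E n) x).symm p.1) p.2) p.2) p.1).symm

theorem Mtilde_add (hε : 0 < ε) {u v : M → ℝ} (hu : ChartSmooth n u) (hv : ChartSmooth n v)
    {ρ : ℝ} (hρ : ρ ∈ Ioo (-ε) ε) (x : M) :
    Mtilde g ρ (fun y => u y + v y) x = Mtilde g ρ u x + Mtilde g ρ v x := by
  obtain ⟨ι, _, c, l, hc, h⟩ := exists_Mtilde_eq g hε x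
  have hx := mem_chart_source (E n) x
  have huv : ChartSmooth n fun y => u y + v y := fun x => (hu x).add (hv x)
  rw [h _ huv x hx ρ hρ, h _ hu x hx ρ hρ, h _ hv x hx ρ hρ, ← Finset.sum_add_distrib]
  refine Finset.sum_congr rfl fun α _ => ?_
  rw [← mul_add]
  congr 1
  exact iterpe_add (chartAt (E n) x).open_target (hu x) (hv x) (l α) (mem_chart_target _ x)

theorem Mtilde_const_mul (hε : 0 < ε) {u : M → ℝ} (hu : ChartSmooth n u) (a : ℝ)
    {ρ : ℝ} (hρ : ρ ∈ Ioo (-ε) ε) (x : M) :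
    Mtilde g ρ (fun y => a * u y) x = a * Mtilde g ρ u x := by
  obtain ⟨ι, _, c, l, hc, h⟩ := exists_Mtilde_eq g hε x
  have hx := mem_chart_source (E n) x
  have hau : ChartSmooth n fun y => a * u y := fun x => contDiffOn_const.mul (hu x)
  rw [h _ hau x hx ρ hρ, h _ hu x hx ρ hρ, Finset.mul_sum]
  refine Finset.sum_congr rfl fun α _ => ?_
  rw [mul_left_comm]
  congr 1
  exact congrFun (iterpe_const_mul a (u ∘ (chartAt (E n) x).symm) (l α)) _

theorem Mtilde_eq_zero (hε : 0 < ε) {u : M → ℝ} (hu : ChartSmooth n u) {x : M}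
    (hx0 : u =ᶠ[nhds x] fun _ => 0) {ρ : ℝ} (hρ : ρ ∈ Ioo (-ε) ε) : Mtilde g ρ u x = 0 := by
  obtain ⟨ι, _, c, l, hc, h⟩ := exists_Mtilde_eq g hε x
  have hx := mem_chart_source (E n) x
  rw [h _ hu x hx ρ hρ]
  refine Finset.sum_eq_zero fun α _ => ?_
  rw [iterpe_eq_zero (eventuallyEq_comp_symm hx hx0), mul_zero]

/-- In a chart this is the scalar Leibniz rule for each term `c_α(x, ρ) ∂^{l_α} F(x, ρ)`, combined
with the commutation of `∂_ρ` with the spatial derivatives. -/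
theorem iteratedDeriv_Mtilde (hε : 0 < ε) {F : M → ℝ → ℝ} (hF : ChartSmoothFam n ε F) (N : ℕ)
    (x : M) :
    iteratedDeriv N (fun ρ => Mtilde g ρ (fun y => F y ρ) x) 0 =
      ∑ i ∈ Finset.range (N + 1), (N.choose i : ℝ) *
        iteratedDeriv i (fun ρ => Mtilde g ρ (fun y => iteratedDeriv (N - i) (F y) 0) x) 0 := by
  obtain ⟨ι, _, c, l, hc, h⟩ := exists_Mtilde_eq g hε x
  have h0 : (0 : ℝ) ∈ Ioo (-ε) ε := ⟨by linarith, hε⟩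
  have hx := mem_chart_source (E n) x
  set φ := chartAt (E n) x with hφ
  have hΩ := isOpen_chartDom (n := n) (ε := ε) x
  have hp : (φ x, (0 : ℝ)) ∈ φ.target ×ˢ Ioo (-ε) ε := ⟨mem_chart_target (E n) x, h0⟩
  set Q : E n × ℝ → ℝ := fun p => F (φ.symm p.1) p.2 with hQ
  have hI : Ioo (-ε) ε ∈ nhds (0 : ℝ) := isOpen_Ioo.mem_nhds h0
  have hca : ∀ α, ContDiffAt ℝ ∞ (fun r => c α (φ x, r)) 0 := fun α =>
    contDiffAt_slice hΩ (hc α) hp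
  have hQa : ∀ α, ContDiffAt ℝ ∞ (fun r => iterdx (l α) Q (φ x, r)) 0 := fun α =>
    contDiffAt_slice hΩ (contDiffOn_iterdx hΩ (hF x) (l α)) hp
  have e1 : (fun ρ => Mtilde g ρ (fun y => F y ρ) x) =ᶠ[nhds 0]
      fun ρ => ∑ α, c α (φ x, ρ) * iterdx (l α) Q (φ x, ρ) := by
    filter_upwards [hI] with ρ hρ
    rw [h _ (hF.slice hρ) x hx ρ hρ]
    refine Finset.sum_congr rfl fun α _ => ?_
    congr 1
    exact (congrFun (iterdx_apply (l α) Q ρ) (φ x)).symm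
  have e2 : ∀ m, (fun ρ => Mtilde g ρ (fun y => iteratedDeriv m (F y) 0) x) =ᶠ[nhds 0]
      fun ρ => ∑ α, c α (φ x, ρ) * iteratedDeriv m (fun r => iterdx (l α) Q (φ x, r)) 0 := by
    intro m
    filter_upwards [hI] with ρ hρ
    rw [h _ ((hF.iteratedDeriv m).slice h0) x hx ρ hρ]
    refine Finset.sum_congr rfl fun α _ => ?_
    congr 1
    have := iterdx_itdr hΩ (hF x) (l α) m hp
    exact (congrFun (iterdx_apply (l α) (itdr m Q) 0) (φ x)).symm.trans this
  rw [e1.iteratedDeriv_eq]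
  have e4 : ∀ i m,
      iteratedDeriv i (fun ρ => Mtilde g ρ (fun y => iteratedDeriv m (F y) 0) x) 0 =
      iteratedDeriv i (fun ρ => ∑ α, c α (φ x, ρ) *
        iteratedDeriv m (fun r => iterdx (l α) Q (φ x, r)) 0) 0 := fun i m =>
    (e2 m).iteratedDeriv_eq i
  simp only [e4]
  have hle : ∀ m : ℕ, ((m : ℕ∞) : ℕ∞ω) ≤ ∞ := fun m => by exact_mod_cast le_top
  rw [iteratedDeriv_fun_sum fun α _ => ((hca α).mul (hQa α)).of_le (hle N)]
  have e3 : ∀ i m, iteratedDeriv i (fun ρ => ∑ α, c α (φ x, ρ) *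
      iteratedDeriv m (fun r => iterdx (l α) Q (φ x, r)) 0) 0 =
      ∑ α, iteratedDeriv i (fun ρ => c α (φ x, ρ)) 0 *
        iteratedDeriv m (fun r => iterdx (l α) Q (φ x, r)) 0 := by
    intro i m
    rw [iteratedDeriv_fun_sum fun α _ => ((hca α).mul contDiffAt_const).of_le (hle i)]
    refine Finset.sum_congr rfl fun α _ => ?_
    simp only [mul_comm _ (iteratedDeriv m (fun r => iterdx (l α) Q (φ x, r)) 0)]
    exact iteratedDeriv_const_mul_field _ _
  simp only [e3, Finset.mul_sum]
  rw [Finset.sum_comm]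
  refine Finset.sum_congr rfl fun α _ => ?_
  rw [iteratedDeriv_fun_mul ((hca α).of_le (hle N)) ((hQa α).of_le (hle N))]
  simp only [mul_assoc]

end

/-! ### Taylor coefficients with respect to the parameter -/

section

theorem exists_linear_seqComp {X : Type*} [AddCommGroup X] [Module ℝ X] (P : ℕ → X →ₗ[ℝ] X)
    (A : List ℕ) : ∃ B : X →ₗ[ℝ] X, ∀ v, seqComp P A v = B v := by
  induction A with
  | nil => exact ⟨LinearMap.id, fun v => rfl⟩
  | cons a A ih =>
    obtain ⟨B, hB⟩ := ih
    exact ⟨B.comp (P a), fun v => hB _⟩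

theorem seqComp_smul {X : Type*} [AddCommGroup X] [Module ℝ X] (P : ℕ → X →ₗ[ℝ] X)
    (A : List ℕ) (c : ℝ) (v : X) : seqComp P A (c • v) = c • seqComp P A v := by
  obtain ⟨B, hB⟩ := exists_linear_seqComp P A
  rw [hB, hB, map_smul]

theorem natCast_le_infty (m : ℕ) : ((m : ℕ∞) : ℕ∞ω) ≤ ∞ := by exact_mod_cast le_top

theorem taylorCoeff_mul {φ ψ : ℝ → ℝ} (hφ : ContDiffAt ℝ ∞ φ 0) (hψ : ContDiffAt ℝ ∞ ψ 0)
    (k : ℕ) : iteratedDeriv k (fun r => φ r * ψ r) 0 / (k.factorial : ℝ) =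
      ∑ p ∈ antidiagonal k, iteratedDeriv p.1 φ 0 / (p.1.factorial : ℝ) *
        (iteratedDeriv p.2 ψ 0 / (p.2.factorial : ℝ)) := by
  rw [iteratedDeriv_fun_mul (hφ.of_le (natCast_le_infty k)) (hψ.of_le (natCast_le_infty k)),
    Finset.Nat.sum_antidiagonal_eq_sum_range_succ_mk, Finset.sum_div]
  refine Finset.sum_congr rfl fun i hi => ?_
  rw [Nat.cast_choose ℝ (Nat.lt_succ_iff.1 (Finset.mem_range.1 hi))]
  have := Nat.factorial_ne_zero k
  field_simp

theorem taylorCoeff_id_mul {ψ : ℝ → ℝ} (hψ : ContDiffAt ℝ ∞ ψ 0) (k : ℕ) :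
    iteratedDeriv (k + 1) (fun r => r * ψ r) 0 = (k + 1) * iteratedDeriv k ψ 0 := by
  have hid : ContDiffAt ℝ ∞ (fun r : ℝ => r) 0 := contDiffAt_id
  have h1 : ∀ i, iteratedDeriv i (fun r : ℝ => r) 0 = if i = 1 then 1 else 0 := by
    intro i
    rcases i with _ | _ | i
    · simp
    · simp
    · rw [iteratedDeriv_succ', iteratedDeriv_succ']
      simp
  rw [iteratedDeriv_fun_mul (hid.of_le (natCast_le_infty _)) (hψ.of_le (natCast_le_infty _)),
    Finset.sum_eq_single 1]
  · rw [h1]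
    simp
  · intro i _ hi
    rw [h1, if_neg hi, mul_zero, zero_mul]
  · intro h
    simp at h

end

/-! ### The operators `M̃(ρ)`, `R_j` and `D̃_{m,L}` on Taylor coefficients, and the expansion -/

section

variable {n : ℕ} {M : Type*} [TopologicalSpace M] [ChartedSpace (E n) M] {ε : ℝ}

variable (n M) in
/-- The space of smooth functions. -/
def smoothFns : Submodule ℝ (M → ℝ) where
  carrier := {u | ChartSmooth n u}
  add_mem' hu hv := fun x => (hu x).add (hv x)
  zero_mem' := fun _ => contDiffOn_const
  smul_mem' _ _ hu := fun x => contDiffOn_const.mul (hu x)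

/-- The Taylor coefficients at `ρ = 0` of a smooth family of functions. -/
def taylor (hε : 0 < ε) {F : M → ℝ → ℝ} (hF : ChartSmoothFam n ε F) (k : ℕ) : smoothFns n M :=
  ⟨fun x => iteratedDeriv k (F x) 0 / (k.factorial : ℝ), fun x =>
    ((hF.iteratedDeriv k).slice ⟨by linarith, hε⟩ x).div_const _⟩

/-- Multiplication by a smooth function. -/
def mulMap (a : smoothFns n M) : smoothFns n M →ₗ[ℝ] smoothFns n M where
  toFun u := ⟨fun x => a.1 x * u.1 x, ChartSmooth.mul a.2 u.2⟩
  map_add' _ _ := Subtype.ext (funext fun _ => mul_add _ _ _)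
  map_smul' _ _ := Subtype.ext (funext fun _ => mul_left_comm _ _ _)

theorem ChartSmoothFam.const_mul {F : M → ℝ → ℝ} (hF : ChartSmoothFam n ε F) (c : ℝ) :
    ChartSmoothFam n ε fun y r => c * F y r := fun x => contDiffOn_const.mul (hF x)

theorem ChartSmoothFam.deriv {F : M → ℝ → ℝ} (hF : ChartSmoothFam n ε F) :
    ChartSmoothFam n ε fun y r => deriv (F y) r := by
  simpa only [iteratedDeriv_one] using hF.iteratedDeriv 1

theorem chartSmoothFam_param : ChartSmoothFam n ε fun (_ : M) r => r := fun _ => contDiffOn_snd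

theorem taylor_mul (hε : 0 < ε) {f F : M → ℝ → ℝ} (hf : ChartSmoothFam n ε f) (hF : ChartSmoothFam n ε F) :
    taylor hε (hf.mul hF) =
      fun k => ∑ q ∈ antidiagonal k, mulMap (taylor hε hf q.1) (taylor hε hF q.2) := by
  have h0 : (0 : ℝ) ∈ Ioo (-ε) ε := ⟨by linarith, hε⟩
  ext k x
  rw [Submodule.coe_sum, Finset.sum_apply]
  exact taylorCoeff_mul (hf.contDiffAt x h0) (hF.contDiffAt x h0) k

theorem taylor_const (hε : 0 < ε) (u : smoothFns n M) :
    taylor hε (ChartSmooth.const u.2) = fun k => if k = 0 then u else 0 := by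
  ext k x
  change iteratedDeriv k (fun _ => u.1 x) 0 / (k.factorial : ℝ) = _
  rcases k with _ | k
  · simp
  · rw [iteratedDeriv_succ']
    simp

variable [IsManifold (𝓡 n) ∞ M] [T2Space M] [SecondCountableTopology M]

/-- The Taylor coefficients at `ρ = 0` of the family `M̃(ρ)`. -/
def Pmap (hε : 0 < ε) (g : MetricFamily n M ε) (a : ℕ) : smoothFns n M →ₗ[ℝ] smoothFns n M where
  toFun u := taylor hε (chartSmoothFam_Mtilde g hε (ChartSmooth.const u.2)) a
  map_add' u v := by
    have h0 : (0 : ℝ) ∈ Ioo (-ε) ε := ⟨by linarith, hε⟩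
    refine Subtype.ext (funext fun x => ?_)
    change iteratedDeriv a (fun ρ => Mtilde g ρ (fun y => u.1 y + v.1 y) x) 0 / _ =
      iteratedDeriv a (fun ρ => Mtilde g ρ u.1 x) 0 / _ +
        iteratedDeriv a (fun ρ => Mtilde g ρ v.1 x) 0 / _
    have e : (fun ρ => Mtilde g ρ (fun y => u.1 y + v.1 y) x) =ᶠ[nhds 0]
        fun ρ => Mtilde g ρ u.1 x + Mtilde g ρ v.1 x := by
      filter_upwards [isOpen_Ioo.mem_nhds h0] with ρ hρ
      exact Mtilde_add g hε u.2 v.2 hρ x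
    rw [e.iteratedDeriv_eq, iteratedDeriv_fun_add, add_div]
    · exact ((chartSmoothFam_Mtilde g hε (ChartSmooth.const u.2)).contDiffAt x h0).of_le
        (natCast_le_infty a)
    · exact ((chartSmoothFam_Mtilde g hε (ChartSmooth.const v.2)).contDiffAt x h0).of_le
        (natCast_le_infty a)
  map_smul' c u := by
    have h0 : (0 : ℝ) ∈ Ioo (-ε) ε := ⟨by linarith, hε⟩
    refine Subtype.ext (funext fun x => ?_)
    change iteratedDeriv a (fun ρ => Mtilde g ρ (fun y => c * u.1 y) x) 0 / _ =
      c * (iteratedDeriv a (fun ρ => Mtilde g ρ u.1 x) 0 / _)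
    have e : (fun ρ => Mtilde g ρ (fun y => c * u.1 y) x) =ᶠ[nhds 0]
        fun ρ => c * Mtilde g ρ u.1 x := by
      filter_upwards [isOpen_Ioo.mem_nhds h0] with ρ hρ
      exact Mtilde_const_mul g hε u.2 c hρ x
    rw [e.iteratedDeriv_eq, iteratedDeriv_const_mul_field, mul_div_assoc]

theorem Pmap_apply (hε : 0 < ε) (g : MetricFamily n M ε) (a : ℕ) (u : smoothFns n M) (x : M) :
    (Pmap hε g a u).1 x = iteratedDeriv a (fun ρ => Mtilde g ρ u.1 x) 0 / (a.factorial : ℝ) := rfl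

theorem chartSmoothFam_Rop (hε : 0 < ε) (g : MetricFamily n M ε)
    {F : M → ℝ → ℝ} (hF : ChartSmoothFam n ε F) (j : ℝ) :
    ChartSmoothFam n ε (Rop g j F) :=
  (((chartSmoothFam_param.const_mul (-2)).mul (hF.iteratedDeriv 2)).add
    (hF.deriv.const_mul (2 * j))).add (chartSmoothFam_Mtilde g hε hF)

/-- The coefficient of `ρ^k` in `-2ρF'' + 2jF'` is `(-2k(k+1) + 2j(k+1)) F_{k+1}`, and `M̃(ρ)F`
contributes a Cauchy product. This is the bridge from analysis to the algebra of `seqR`. -/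
theorem taylor_Rop (hε : 0 < ε) (g : MetricFamily n M ε)
    {F : M → ℝ → ℝ} (hF : ChartSmoothFam n ε F) (j : ℝ) :
    taylor hε (chartSmoothFam_Rop hε g hF j) = seqR (Pmap hε g) j (taylor hε hF) := by
  have h0 : (0 : ℝ) ∈ Ioo (-ε) ε := ⟨by linarith, hε⟩
  ext k x
  have c2 := (hF.iteratedDeriv 2).contDiffAt x h0
  have c2' : ContDiffAt ℝ ∞ (fun r => r * iteratedDeriv 2 (F x) r) 0 := contDiffAt_id.mul c2
  have c1 := hF.deriv.contDiffAt x h0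
  have cM := (chartSmoothFam_Mtilde g hε hF).contDiffAt x h0
  have e0 : Rop g j F x = fun r => (-2 * (r * iteratedDeriv 2 (F x) r) + 2 * j * deriv (F x) r) +
      Mtilde g r (fun y => F y r) x := by
    ext r
    rw [Rop]
    ring
  have e1 : iteratedDeriv k (Rop g j F x) 0 =
      (-2 * iteratedDeriv k (fun r => r * iteratedDeriv 2 (F x) r) 0 +
        2 * j * iteratedDeriv (k + 1) (F x) 0) +
      iteratedDeriv k (fun r => Mtilde g r (fun y => F y r) x) 0 := by
    have hle := natCast_le_infty k
    have a1 : ContDiffAt ℝ k (fun r => -2 * (r * iteratedDeriv 2 (F x) r)) 0 :=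
      (contDiffAt_const.mul c2').of_le hle
    have a2 : ContDiffAt ℝ k (fun r => 2 * j * deriv (F x) r) 0 :=
      (contDiffAt_const.mul c1).of_le hle
    rw [e0, iteratedDeriv_fun_add (a1.add a2) (cM.of_le hle), iteratedDeriv_fun_add a1 a2,
      iteratedDeriv_const_mul_field, iteratedDeriv_const_mul_field, ← iteratedDeriv_succ']
  have e2 : iteratedDeriv k (fun r => r * iteratedDeriv 2 (F x) r) 0 =
      k * iteratedDeriv (k + 1) (F x) 0 := by
    rcases k with _ | k
    · simp
    · rw [taylorCoeff_id_mul c2]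
      have : iteratedDeriv k (fun r => iteratedDeriv 2 (F x) r) =
          iteratedDeriv (k + 1 + 1) (F x) := by
        rw [iteratedDeriv_succ' (n := k + 1), iteratedDeriv_succ' (n := k),
          ← iteratedDeriv_one, ← iteratedDeriv_succ']
      rw [this]
      push_cast
      ring
  have e3 : iteratedDeriv k (fun r => Mtilde g r (fun y => F y r) x) 0 / (k.factorial : ℝ) =
      ∑ p ∈ antidiagonal k, (Pmap hε g p.1 (taylor hε hF p.2)).1 x := by
    rw [iteratedDeriv_Mtilde g hε hF, Finset.Nat.sum_antidiagonal_eq_sum_range_succ_mk,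
      Finset.sum_div]
    refine Finset.sum_congr rfl fun i hi => ?_
    have hi' := Nat.lt_succ_iff.1 (Finset.mem_range.1 hi)
    have e4 : (fun ρ => Mtilde g ρ (fun y => iteratedDeriv (k - i) (F y) 0) x) =ᶠ[nhds 0]
        fun ρ => ((k - i).factorial : ℝ) * Mtilde g ρ (taylor hε hF (k - i)).1 x := by
      filter_upwards [isOpen_Ioo.mem_nhds h0] with ρ hρ
      rw [← Mtilde_const_mul g hε (taylor hε hF (k - i)).2 _ hρ x]
      congr 1
      ext y
      simp only [taylor]
      rw [mul_div_cancel₀]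
      exact_mod_cast (k - i).factorial_ne_zero
    rw [e4.iteratedDeriv_eq, iteratedDeriv_const_mul_field, Pmap_apply, Nat.cast_choose ℝ hi']
    have := Nat.factorial_ne_zero k
    have := Nat.factorial_ne_zero (k - i)
    field_simp
  have hk : ((k + 1).factorial : ℝ) = (k + 1) * k.factorial := by
    rw [Nat.factorial_succ]; push_cast; ring
  have hk0 : (k.factorial : ℝ) ≠ 0 := by exact_mod_cast k.factorial_ne_zero
  have hk1 : ((k : ℝ) + 1) ≠ 0 := by positivity
  change iteratedDeriv k (Rop g j F x) 0 / (k.factorial : ℝ) = _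
  rw [e1, e2, add_div, e3, seqR, Submodule.coe_add, Submodule.coe_smul, Submodule.coe_sum,
    Pi.add_apply, Pi.smul_apply, Finset.sum_apply, smul_eq_mul]
  congr 1
  simp only [taylor]
  rw [hk]
  field_simp
  ring

theorem chartSmoothFam_Dtilde (hε : 0 < ε) (g : MetricFamily n M ε)
    {F : M → ℝ → ℝ} (hF : ChartSmoothFam n ε F) (m : ℕ) (L : ℝ) :
    ChartSmoothFam n ε (Dtilde g m L F) := by
  induction m with
  | zero => exact hF
  | succ m ih => exact chartSmoothFam_Rop hε g ih _

theorem taylor_Dtilde (hε : 0 < ε) (g : MetricFamily n M ε)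
    {F : M → ℝ → ℝ} (hF : ChartSmoothFam n ε F) (m : ℕ) (L : ℝ) :
    taylor hε (chartSmoothFam_Dtilde hε g hF m L) = seqD (Pmap hε g) m L (taylor hε hF) := by
  induction m with
  | zero => rfl
  | succ m ih =>
    rw [seqD, ← ih]
    exact taylor_Rop hε g (chartSmoothFam_Dtilde hε g hF m L) _

/-! ### The operators `D` -/

/-- The operator `D_{U,U,L,0;f}` on smooth functions. -/
def Dmap (hε : 0 < ε) (g : MetricFamily n M ε)
    {f : M → ℝ → ℝ} (hf : ChartSmoothFam n ε f) (U : ℕ) (L : ℝ) (u : smoothFns n M) :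
    smoothFns n M :=
  ∑ p ∈ antidiagonal U, (gammaQuot ((p.1 : ℝ) + 0 + 1) ((U : ℤ) - p.1) /
      Real.Gamma ((p.2 : ℝ) + 1) * (gammaQuot L p.2 * gammaQuot L ((U : ℤ) - p.2))) •
    seqD (Pmap hε g) p.2 (-(L + U) + 2 * p.2) (fun k => ∑ q ∈ antidiagonal k,
      mulMap (taylor hε hf q.1)
        (seqD (Pmap hε g) p.1 (L + U) (fun k => if k = 0 then u else 0) q.2)) 0

theorem DUVLK_eq_Dmap (hε : 0 < ε) (g : MetricFamily n M ε)
    {f : M → ℝ → ℝ} (hf : ChartSmoothFam n ε f) (U : ℕ) (L : ℝ)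
    (u : smoothFns n M) (x : M) : DUVLK g U U L 0 f u.1 x = (Dmap hε g hf U L u).1 x := by
  rw [DUVLK, Dmap, Submodule.coe_sum, Finset.sum_apply]
  refine Finset.sum_congr rfl fun p _ => ?_
  rw [Submodule.coe_smul, Pi.smul_apply, smul_eq_mul]
  congr 1
  rw [← taylor_const hε u, ← taylor_Dtilde, ← taylor_mul, ← taylor_Dtilde, Dpair]
  simp only [taylor, iteratedDeriv_zero, Nat.factorial_zero, Nat.cast_one, div_one]
  rw [show -L - (U : ℝ) = -(L + U) by ring, sub_zero]

/-- Up to `(-2)^m m!`, `stepNorm (L + U) m` is the product of the top `m` factors of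
`L(L+1)⋯(L+U-1)`, and `gammaQuot L m'` supplies the remaining `m'` bottom ones; likewise with `m`
and `m'` exchanged. -/
theorem gammaQuot_prefactor (U m m' : ℕ) (h : m + m' = U) (L : ℝ)
    (hl : ∀ k < U, stepFactor (L + U) (k + 1 : ℕ) ≠ 0) :
    gammaQuot ((m : ℝ) + 0 + 1) ((U : ℤ) - m) / Real.Gamma ((m' : ℝ) + 1) *
        (gammaQuot L m' * gammaQuot L ((U : ℤ) - m')) =
      (-2) ^ U * U.factorial * (∏ k ∈ Finset.range U, (L + k) ^ 2) *
        ((stepNorm (L + U) m)⁻¹ * (stepNorm (L + U) m')⁻¹) := by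
  have hne : ∀ k ≤ U, stepNorm (L + U) k ≠ 0 := fun k hk =>
    Finset.prod_ne_zero_iff.2 fun i hi => by
      exact_mod_cast hl i (by have := Finset.mem_range.1 hi; omega)
  have e1 : ∀ k, stepNorm (L + U) k =
      (-2) ^ k * k.factorial * ∏ i ∈ Finset.range k, (L + U - 1 - i) := by
    intro k
    induction k with
    | zero => simp [stepNorm]
    | succ k ih =>
      rw [stepNorm_succ, ih, Finset.prod_range_succ, Nat.factorial_succ, stepFactor]
      push_cast
      ring
  have e2 : ∀ k l, k + l = U → gammaQuot L k * ∏ i ∈ Finset.range l, (L + U - 1 - i) =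
      ∏ i ∈ Finset.range U, (L + i) := by
    intro k l hkl
    rw [← hkl, Finset.prod_range_add]
    congr 1
    rw [← Finset.prod_range_reflect]
    refine Finset.prod_congr rfl fun i hi => ?_
    have hi' := Finset.mem_range.1 hi
    rw [show l - 1 - i = l - (i + 1) by omega, Nat.cast_sub (by omega)]
    push_cast
    ring
  -- The summand `0` is the value of `K`.
  have e3 : gammaQuot ((m : ℝ) + 0 + 1) ((U : ℤ) - m) = U.factorial / m.factorial := by
    rw [show (U : ℤ) - m = (m' : ℕ) by omega]
    have : ∀ k : ℕ, (∏ i ∈ Finset.range k, ((m : ℝ) + 0 + 1 + i)) * m.factorial =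
        (m + k).factorial := by
      intro k
      induction k with
      | zero => simp
      | succ k ih =>
        rw [Finset.prod_range_succ, mul_right_comm, ih, ← add_assoc, Nat.factorial_succ]
        push_cast
        ring
    have h2 := this m'
    rw [h] at h2
    rw [← h2, mul_div_cancel_right₀ _ (by exact_mod_cast m.factorial_ne_zero)]
    rfl
  rw [e3, Real.Gamma_nat_eq_factorial, show (U : ℤ) - m' = (m : ℕ) by omega, ← mul_inv,
    eq_mul_inv_iff_mul_eq₀ (mul_ne_zero (hne m (by omega)) (hne m' (by omega))), e1, e1,
    Finset.prod_pow, sq]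
  have a1 := e2 m' m (by omega)
  have a2 := e2 m m' h
  have hm : (m.factorial : ℝ) ≠ 0 := by exact_mod_cast m.factorial_ne_zero
  have hm' : (m'.factorial : ℝ) ≠ 0 := by exact_mod_cast m'.factorial_ne_zero
  conv_rhs => rw [show (∏ k ∈ Finset.range U, (L + (k : ℝ))) * ∏ k ∈ Finset.range U, (L + (k : ℝ))
    = (gammaQuot L m' * ∏ i ∈ Finset.range m, (L + U - 1 - i)) *
      (gammaQuot L m * ∏ i ∈ Finset.range m', (L + U - 1 - i)) by rw [a1, a2]]
  rw [show (-2 : ℝ) ^ U = (-2) ^ m * (-2) ^ m' by rw [← pow_add, h]]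
  field_simp

/-- The factor `s_{k+1}` contains `L + (U - k - 1)`, and `U - k - 1` runs through the same range as
`k`. -/
theorem stepFactor_ne_zero {U : ℕ} {L : ℝ} (hL : ∀ k : ℕ, k < U → L + k ≠ 0) :
    ∀ k < U, stepFactor (L + U) (k + 1 : ℕ) ≠ 0 := by
  intro k hk h0
  rw [stepFactor] at h0
  have h1 : (((k + 1 : ℕ) : ℝ)) ≠ 0 := by positivity
  have h2 := hL (U - (k + 1)) (by omega)
  rw [Nat.cast_sub (by omega)] at h2
  rcases mul_eq_zero.1 h0 with h | h
  · rcases mul_eq_zero.1 h with h | h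
    · norm_num at h
    · exact h1 h
  · exact h2 (by linarith)

/-- The coefficients of the expansion in terms of the Taylor coefficients. -/
def taylorExpCoeff (U : ℕ) (L : ℝ) (A' A : List ℕ) : ℝ :=
  (-2) ^ U * U.factorial * (∏ k ∈ Finset.range U, (L + k) ^ 2) *
    (stepProd (fun i => (stepFactor (L + U) i)⁻¹) A'.reverse *
      stepProd (fun i => (stepFactor (L + U) i)⁻¹) A)

theorem Dmap_eq_sum (hε : 0 < ε) (g : MetricFamily n M ε)
    {f : M → ℝ → ℝ} (hf : ChartSmoothFam n ε f) {U : ℕ} {L : ℝ}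
    (hL : ∀ k : ℕ, k < U → L + k ≠ 0) (u : smoothFns n M) :
    Dmap hε g hf U L u = ∑ t ∈ indexSet U, taylorExpCoeff U L t.2.1 t.2.2 •
      seqComp (Pmap hε g) t.2.1 (mulMap (taylor hε hf t.1) (seqComp (Pmap hε g) t.2.2 u)) := by
  have hl := stepFactor_ne_zero hL
  have h1 := sum_seqD_pair (Pmap hε g) U (L + U) (by exact_mod_cast hl)
    (fun k => mulMap (taylor hε hf k)) u
  rw [sum_indexSet U fun R A' A => taylorExpCoeff U L A' A •
    seqComp (Pmap hε g) A' (mulMap (taylor hε hf R) (seqComp (Pmap hε g) A u))]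
  have h2 : Dmap hε g hf U L u =
      ((-2) ^ U * U.factorial * (∏ k ∈ Finset.range U, (L + k) ^ 2)) •
        ∑ p ∈ antidiagonal U, ∑ q ∈ antidiagonal p.2, outerCoeff (Pmap hε g) (L + U) p.1
          (mulMap (taylor hε hf q.1) (innerCoeff (Pmap hε g) (L + U) q.2 u)) := by
    rw [← h1, Dmap, Finset.smul_sum]
    refine Finset.sum_congr rfl fun p hp => ?_
    rw [gammaQuot_prefactor U p.1 p.2 (Finset.HasAntidiagonal.mem_antidiagonal.1 hp) L hl,
      smul_smul, smul_smul]
    congr 1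
    ring
  rw [h2, Finset.smul_sum]
  refine Finset.sum_congr rfl fun p _ => ?_
  rw [Finset.smul_sum]
  refine Finset.sum_congr rfl fun q _ => ?_
  rw [outerCoeff, Finset.smul_sum]
  refine Finset.sum_congr rfl fun A' _ => ?_
  obtain ⟨B, hB⟩ := exists_linear_seqComp (Pmap hε g) A'
  rw [innerCoeff, map_sum, hB, map_sum, Finset.smul_sum, Finset.smul_sum]
  refine Finset.sum_congr rfl fun A _ => ?_
  rw [map_smul, map_smul, hB, smul_smul, smul_smul, taylorExpCoeff]
  congr 1
  ring

/-! ### The explicit expansion -/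

/-- The normalization between `M_{2(A_r+1)} ⋯ M_{2(A_1+1)}` and the Taylor coefficients. -/
def normFactor (A : List ℕ) : ℝ := (A.map fun a => (a.factorial : ℝ) ^ 2 * (-2) ^ a).prod

theorem Mcomp_eq (hε : 0 < ε) (g : MetricFamily n M ε)
    (A : List ℕ) (u : smoothFns n M) :
    Mcomp g A u.1 = (normFactor A • seqComp (Pmap hε g) A u).1 := by
  induction A generalizing u with
  | nil => simp [normFactor, seqComp, Mcomp]
  | cons a A ih =>
    have h1 : Mop g a u.1 = (((a.factorial : ℝ) ^ 2 * (-2) ^ a) • Pmap hε g a u).1 := rfl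
    rw [Mcomp, List.foldl_cons, h1]
    refine (ih _).trans ?_
    rw [seqComp_smul, smul_smul, mul_comm]
    simp only [normFactor, List.map_cons, List.prod_cons]
    rfl

theorem stepProd_mul_pow (l : ℝ) (A : List ℕ) :
    stepProd (fun i => (stepFactor l i)⁻¹) A * (-2) ^ A.length =
      (∏ i ∈ Finset.Icc 1 A.length, 1 / (partialSum A i : ℝ)) *
        ∏ i ∈ Finset.Icc 1 A.length, 1 / (l - (partialSum A i : ℝ)) := by
  have h1 : ((-2 : ℝ)) ^ A.length = ∏ i ∈ Finset.Icc 1 A.length, (-2 : ℝ) := by simp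
  rw [stepProd, h1, ← Finset.prod_mul_distrib, ← Finset.prod_mul_distrib]
  refine Finset.prod_congr rfl fun i _ => ?_
  rw [stepFactor, mul_inv, mul_inv]
  ring

theorem prod_factorial_mul_normFactor (A : List ℕ) :
    (A.map fun a => 1 / (a.factorial : ℝ) ^ 2).prod * normFactor A = (-2) ^ A.sum := by
  induction A with
  | nil => simp [normFactor]
  | cons a A ih =>
    simp only [normFactor, List.map_cons, List.prod_cons, List.sum_cons] at ih ⊢
    rw [pow_add, ← ih]
    have : (a.factorial : ℝ) ≠ 0 := by exact_mod_cast a.factorial_ne_zero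
    field_simp

/-- Powers of `-2`: an entry `a` absorbs one through its `s` and `a` through the normalization of
`M_{2(a+1)}`. So `(-2)^U` leaves `(-2)^R`, the sign and power in the coefficient. The factor `R!`
passes from Taylor coefficients of `f` to derivatives. -/
theorem coeff_mul_normFactor {U R : ℕ} {A' A : List ℕ} (h : R + weight A + weight A' = U)
    (L : ℝ) :
    coeff U L R A' A * (normFactor A' * (R.factorial * normFactor A)) =
      taylorExpCoeff U L A' A := by
  have h1 := stepProd_mul_pow (L + U) A
  have h2 := stepProd_mul_pow (L + U) A'.reverse
  rw [List.length_reverse] at h2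
  have h3 := prod_factorial_mul_normFactor A
  have h4 := prod_factorial_mul_normFactor A'
  have hR : (R.factorial : ℝ) ≠ 0 := by exact_mod_cast R.factorial_ne_zero
  have hU : (-2 : ℝ) ^ U = (-1) ^ R * 2 ^ R * ((-2) ^ A.sum * (-2) ^ A'.sum *
      ((-2) ^ A.length * (-2) ^ A'.length)) := by
    rw [← mul_pow, ← pow_add, ← pow_add, ← pow_add, show (-1 : ℝ) * 2 = -2 by norm_num, ← pow_add]
    congr 1
    simp only [weight] at h
    omega
  rw [taylorExpCoeff, hU, ← h3, ← h4]
  set S := stepProd (fun i => (stepFactor (L + U) i)⁻¹) A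
  set S' := stepProd (fun i => (stepFactor (L + U) i)⁻¹) A'.reverse
  set Φ := ∏ k ∈ Finset.range U, (L + (k : ℝ)) ^ 2
  set p := (A.map fun a => 1 / (a.factorial : ℝ) ^ 2).prod
  set p' := (A'.map fun a => 1 / (a.factorial : ℝ) ^ 2).prod
  have e : coeff U L R A' A = (-1) ^ R * 2 ^ R * ((U.factorial : ℝ) / (R.factorial : ℝ)) * Φ * p *
      p' * (S * (-2) ^ A.length) * (S' * (-2) ^ A'.length) := by
    rw [h1, h2, coeff]
    ring
  rw [e]
  field_simp

theorem DUVLK_eq_sum (hε : 0 < ε) (g : MetricFamily n M ε)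
    {f : M → ℝ → ℝ} (hf : ChartSmoothFam n ε f) {U : ℕ} {L : ℝ}
    (hL : ∀ k : ℕ, k < U → L + k ≠ 0) (u : smoothFns n M) (x : M) :
    DUVLK g U U L 0 f u.1 x = ∑ t ∈ indexSet U, coeff U L t.1 t.2.1 t.2.2 *
      Mcomp g t.2.1 (fun y => iteratedDeriv t.1 (f y) 0 * Mcomp g t.2.2 u.1 y) x := by
  rw [DUVLK_eq_Dmap hε g hf, Dmap_eq_sum hε g hf hL, Submodule.coe_sum, Finset.sum_apply]
  refine Finset.sum_congr rfl fun t ht => ?_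
  have ht' : t.1 + weight t.2.2 + weight t.2.1 = U := by simpa [indexSet] using ht
  set v := seqComp (Pmap hε g) t.2.2 u with hv
  have h1 : (fun y => iteratedDeriv t.1 (f y) 0 * Mcomp g t.2.2 u.1 y) =
      (((t.1.factorial : ℝ) * normFactor t.2.2) • mulMap (taylor hε hf t.1) v).1 := by
    ext y
    rw [Mcomp_eq hε]
    simp only [Submodule.coe_smul, Pi.smul_apply, smul_eq_mul, mulMap, taylor, LinearMap.coe_mk,
      AddHom.coe_mk, ← hv]
    have hR : (t.1.factorial : ℝ) ≠ 0 := by exact_mod_cast t.1.factorial_ne_zero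
    field_simp
  rw [h1, Mcomp_eq hε, seqComp_smul, ← coeff_mul_normFactor ht']
  simp only [Submodule.coe_smul, Pi.smul_apply, smul_eq_mul]
  ring

theorem coeff_reverse (U : ℕ) (L : ℝ) (R : ℕ) (A' A : List ℕ) :
    coeff U L R A' A = coeff U L R A.reverse A'.reverse := by
  simp only [coeff, List.length_reverse, List.reverse_reverse, List.map_reverse,
    List.prod_reverse]
  ring

end

/-! ### Dependence on the parameter `L` -/

section

variable {X : Type*} [AddCommGroup X] [Module ℝ X]

/-- Continuity of a vector-valued function after composition with all linear functionals. -/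
def WeaklyContinuous (v : ℝ → X) : Prop := ∀ ℓ : X →ₗ[ℝ] ℝ, Continuous fun L => ℓ (v L)

theorem WeaklyContinuous.const (v : X) : WeaklyContinuous fun _ => v := fun _ => continuous_const

theorem WeaklyContinuous.add {v w : ℝ → X} (hv : WeaklyContinuous v) (hw : WeaklyContinuous w) :
    WeaklyContinuous fun L => v L + w L := fun ℓ => by
  simp only [map_add]
  exact (hv ℓ).add (hw ℓ)

theorem WeaklyContinuous.smul {c : ℝ → ℝ} {v : ℝ → X} (hc : Continuous c)
    (hv : WeaklyContinuous v) : WeaklyContinuous fun L => c L • v L := fun ℓ => by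
  simp only [map_smul, smul_eq_mul]
  exact hc.mul (hv ℓ)

theorem WeaklyContinuous.sum {ι : Type*} (s : Finset ι) {v : ι → ℝ → X}
    (hv : ∀ i, WeaklyContinuous (v i)) : WeaklyContinuous fun L => ∑ i ∈ s, v i L := fun ℓ => by
  simpa only [map_sum] using continuous_finsetSum s fun i _ => hv i ℓ

theorem WeaklyContinuous.map {v : ℝ → X} (hv : WeaklyContinuous v) (B : X →ₗ[ℝ] X) :
    WeaklyContinuous fun L => B (v L) := fun ℓ => hv (ℓ.comp B)

theorem weaklyContinuous_seqR (P : ℕ → X →ₗ[ℝ] X) {j : ℝ → ℝ} (hj : Continuous j)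
    {F : ℝ → ℕ → X} (hF : ∀ k, WeaklyContinuous fun L => F L k) (k : ℕ) :
    WeaklyContinuous fun L => seqR P (j L) (F L) k :=
  (WeaklyContinuous.smul (by fun_prop) (hF (k + 1))).add
    (WeaklyContinuous.sum _ fun p => (hF p.2).map (P p.1))

theorem weaklyContinuous_seqD (P : ℕ → X →ₗ[ℝ] X) (m : ℕ) {l : ℝ → ℝ} (hl : Continuous l)
    {F : ℝ → ℕ → X} (hF : ∀ k, WeaklyContinuous fun L => F L k) (k : ℕ) :
    WeaklyContinuous fun L => seqD P m (l L) (F L) k := by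
  induction m generalizing k with
  | zero => exact hF k
  | succ m ih => exact weaklyContinuous_seqR P (by fun_prop) ih k

theorem continuous_gammaQuot (m : ℕ) : Continuous fun L => gammaQuot L m := by
  change Continuous fun L : ℝ => ∏ i ∈ Finset.range m, (L + i)
  fun_prop

end

/-! ### Continuity in `L`, compact supports, symmetry and self-adjointness -/

section

variable {n : ℕ} {M : Type*} [TopologicalSpace M] [ChartedSpace (E n) M] {ε : ℝ}

theorem ChartSmoothFam.continuousOn {F : M → ℝ → ℝ} (hF : ChartSmoothFam n ε F) :
    ContinuousOn (fun p : M × ℝ => F p.1 p.2) (univ ×ˢ Ioo (-ε) ε) := by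
  rintro ⟨x, r⟩ ⟨_, hr⟩
  refine ContinuousAt.continuousWithinAt ?_
  set φ := chartAt (E n) x with hφ
  have ho : IsOpen (φ.source ×ˢ Ioo (-ε) ε) := φ.open_source.prod isOpen_Ioo
  have h1 : ContinuousOn (fun p : M × ℝ => (φ p.1, p.2)) (φ.source ×ˢ Ioo (-ε) ε) :=
    (φ.continuousOn.comp continuousOn_fst fun p hp => hp.1).prodMk continuousOn_snd
  have h2 := (hF x).continuousOn.comp h1 fun p hp => ⟨φ.map_source hp.1, hp.2⟩
  refine (h2.congr fun p hp => ?_).continuousAt (ho.mem_nhds ⟨mem_chart_source (E n) x, hr⟩)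
  simp [← hφ, φ.left_inv hp.1]

variable [IsManifold (𝓡 n) ∞ M] [T2Space M] [SecondCountableTopology M]

/-- The space of smooth functions is given no topology; testing with linear functionals suffices
because only pairings are compared. -/
theorem weaklyContinuous_Dmap (hε : 0 < ε) (g : MetricFamily n M ε) {f : M → ℝ → ℝ}
    (hf : ChartSmoothFam n ε f) (U : ℕ) (u : smoothFns n M) :
    WeaklyContinuous fun L => Dmap hε g hf U L u := by
  intro ℓ
  simp only [Dmap, map_sum]
  refine continuous_finsetSum _ fun p hp => ?_
  -- The shift is nonnegative, so both Gamma quotients are polynomials in `L` and there are no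
  -- poles.
  have hp' : (U : ℤ) - p.2 = (p.1 : ℕ) := by
    have := Finset.HasAntidiagonal.mem_antidiagonal.1 hp
    omega
  simp only [hp']
  have hc : Continuous fun L : ℝ => gammaQuot ((p.1 : ℝ) + 0 + 1) ((U : ℤ) - p.1) /
      Real.Gamma ((p.2 : ℝ) + 1) * (gammaQuot L p.2 * gammaQuot L p.1) :=
    continuous_const.mul ((continuous_gammaQuot _).mul (continuous_gammaQuot _))
  refine WeaklyContinuous.smul hc ?_ ℓ
  have hl : Continuous fun L : ℝ => -(L + U) + 2 * p.2 := by fun_prop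
  refine weaklyContinuous_seqD _ _ hl (fun k => ?_) 0
  refine WeaklyContinuous.sum (X := smoothFns n M) (antidiagonal k)
    (v := fun q L => mulMap (taylor hε hf q.1)
      (seqD (Pmap hε g) p.1 (L + U) (fun k => if k = 0 then u else 0) q.2)) fun q => ?_
  refine WeaklyContinuous.map ?_ (mulMap (taylor hε hf q.1))
  exact weaklyContinuous_seqD (Pmap hε g) p.1 (continuous_id.add continuous_const)
    (F := fun _ k => if k = 0 then u else 0) (fun k => WeaklyContinuous.const _) q.2

theorem hasCompactSupport_Pmap (hε : 0 < ε) (g : MetricFamily n M ε) (a : ℕ) {u : smoothFns n M}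
    (hc : HasCompactSupport u.1) : HasCompactSupport (Pmap hε g a u).1 := by
  refine HasCompactSupport.intro hc.isCompact fun x hx => ?_
  have : (fun ρ => Mtilde g ρ u.1 x) =ᶠ[nhds 0] fun _ => 0 := by
    filter_upwards [isOpen_Ioo.mem_nhds (show (0 : ℝ) ∈ Ioo (-ε) ε from ⟨by linarith, hε⟩)]
      with ρ hρ
    exact Mtilde_eq_zero g hε u.2 (notMem_tsupport_iff_eventuallyEq.1 hx) hρ
  rw [Pmap_apply, this.iteratedDeriv_eq]
  simp

theorem hasCompactSupport_seqComp (hε : 0 < ε) (g : MetricFamily n M ε) (A : List ℕ)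
    {u : smoothFns n M} (hc : HasCompactSupport u.1) :
    HasCompactSupport (seqComp (Pmap hε g) A u).1 := by
  induction A generalizing u with
  | nil => exact hc
  | cons a A ih => exact ih (hasCompactSupport_Pmap hε g a hc)

/-! ### Symmetry of `M̃(ρ)` -/

variable [MeasurableSpace M] [BorelSpace M]

theorem integral_metric (hε : 0 < ε) (g : MetricFamily n M ε) {ρ : ℝ} (hρ : ρ ∈ Ioo (-ε) ε)
    {k : M → ℝ} (hk : Continuous k) (hc : HasCompactSupport k) :
    ∫ p, k p ∂(riemannianVolume (g.metric ρ)) =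
      ∫ p, wFun g p ρ ^ 2 * k p ∂(riemannianVolume (g.metric 0)) := by
  have h0 : (0 : ℝ) ∈ Ioo (-ε) ε := ⟨by linarith, hε⟩
  obtain ⟨t, χ, hχ, hχs, hχ1⟩ := exists_chart_partition (n := n) hc.isCompact
  have hw : Continuous fun p => wFun g p ρ := ((chartSmoothFam_wFun g hε).slice hρ).continuous
  have hwk : ∀ {k : M → ℝ}, Continuous k → Continuous fun p => wFun g p ρ ^ 2 * k p := fun hk =>
    (hw.pow 2).mul hk
  have hd : ∀ i, Continuous fun p => χ i p * k p := fun i => (hχ i).continuous.mul hk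
  have hdc : ∀ i, HasCompactSupport fun p => χ i p * k p := fun i => hc.mul_left
  have hds : ∀ i, Function.support (fun p => χ i p * k p) ⊆ (chartAt (E n) (i : M)).source :=
    fun i => (subset_tsupport _).trans ((tsupport_mul_subset_left).trans (hχs i))
  have hsum := sum_partition_mul hχ1 (subset_tsupport k)
  have e1 : ∀ p, wFun g p ρ ^ 2 * k p = ∑ i, wFun g p ρ ^ 2 * (χ i p * k p) := fun p => by
    rw [← Finset.mul_sum, hsum]
  have e2 : ∀ p, k p = ∑ i, χ i p * k p := fun p => (hsum p).symm
  rw [integral_congr_ae (Filter.Eventually.of_forall e1),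
    integral_congr_ae (Filter.Eventually.of_forall e2), integral_finsetSum, integral_finsetSum]
  · refine Finset.sum_congr rfl fun i _ => ?_
    rw [integral_riemannianVolume (g.isMetric hρ) (i : M) (hd i) (hds i),
      integral_riemannianVolume (g.isMetric h0) (i : M) (hwk (hd i))
        ((Function.support_mul_subset_right _ _).trans (hds i))]
    refine setIntegral_congr_fun (chartAt (E n) (i : M)).open_target.measurableSet fun z hz => ?_
    have h1 := sqrt_det_metric g hε ((chartAt (E n) (i : M)).map_target hz) hρ
    rw [(chartAt (E n) (i : M)).right_inv hz] at h1
    rw [h1]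
    ring
  · exact fun i _ => (g.isMetric h0).integrable (hwk (hd i)) (hdc i).mul_left
  · exact fun i _ => (g.isMetric hρ).integrable (hd i) (hdc i)

/-- With `dvol_{g_ρ} = w² dvol_g`, the integral of `u · wΔ(w⁻¹v)` for `g` becomes that of `(w⁻¹u)
Δ(w⁻¹v)` for `g_ρ`, to which Green's identity applies. The resulting form is symmetric in `u` and
`v`. -/
theorem integral_mul_Mtilde (hε : 0 < ε) (g : MetricFamily n M ε) {u v : M → ℝ}
    (hu : ChartSmooth n u) (hv : ChartSmooth n v) (hc : HasCompactSupport u) {ρ : ℝ}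
    (hρ : ρ ∈ Ioo (-ε) ε) :
    ∫ p, u p * Mtilde g ρ v p ∂(riemannianVolume (g.metric 0)) =
      -∫ p, grad (g.metric ρ) (fun y => (wFun g y ρ)⁻¹ * u y) (fun y => (wFun g y ρ)⁻¹ * v y) p
          ∂(riemannianVolume (g.metric ρ)) +
        ∫ p, zeroth g p ρ * (u p * v p) ∂(riemannianVolume (g.metric 0)) := by
  have h0 : (0 : ℝ) ∈ Ioo (-ε) ε := ⟨by linarith, hε⟩
  have hw : Continuous fun p => wFun g p ρ := ((chartSmoothFam_wFun g hε).slice hρ).continuous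
  have hz : Continuous fun p => zeroth g p ρ := ((chartSmoothFam_zeroth g hε).slice hρ).continuous
  have hq := (chartSmoothFam_wFun_inv g hε).slice hρ
  have hk : Continuous fun p => (wFun g p ρ)⁻¹ * u p *
      lap (g.metric ρ) (fun y => (wFun g y ρ)⁻¹ * v y) p :=
    (hq.mul hu).continuous.mul ((g.isMetric hρ).chartSmooth_lap (hq.mul hv)).continuous
  rw [← integral_mul_lap (g.isMetric hρ) (hq.mul hu) (hq.mul hv) hc.mul_left,
    integral_metric hε g hρ hk (HasCompactSupport.mul_right
      hc.mul_left), ← integral_add]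
  · congr 1
    ext p
    have := (wFun_pos g hε p hρ).ne'
    rw [Mtilde_eq g hε hv hρ]
    field_simp
  · exact (g.isMetric h0).integrable ((hw.pow 2).mul hk)
      (HasCompactSupport.mul_left (HasCompactSupport.mul_right hc.mul_left))
  · exact (g.isMetric h0).integrable (hz.mul (hu.continuous.mul hv.continuous))
      (HasCompactSupport.mul_left hc.mul_right)

theorem integral_mul_Mtilde_comm (hε : 0 < ε) (g : MetricFamily n M ε) {u v : M → ℝ}
    (hu : ChartSmooth n u) (hv : ChartSmooth n v) (hcu : HasCompactSupport u)
    (hcv : HasCompactSupport v) {ρ : ℝ} (hρ : ρ ∈ Ioo (-ε) ε) :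
    ∫ p, u p * Mtilde g ρ v p ∂(riemannianVolume (g.metric 0)) =
      ∫ p, v p * Mtilde g ρ u p ∂(riemannianVolume (g.metric 0)) := by
  rw [integral_mul_Mtilde hε g hu hv hcu hρ, integral_mul_Mtilde hε g hv hu hcv hρ]
  simp only [grad_comm (g.isMetric hρ) (fun y => (wFun g y ρ)⁻¹ * u y), mul_comm (u _)]

/-! ### Differentiation under the integral -/

theorem hasDerivAt_integral_param {h : FormField n M} (hh : IsMetric h) {F : M → ℝ → ℝ}
    (hF : ChartSmoothFam n ε F) {K : Set M} (hK : IsCompact K)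
    (h0 : ∀ x ∉ K, ∀ r ∈ Ioo (-ε) ε, F x r = 0) {r : ℝ} (hr : r ∈ Ioo (-ε) ε) :
    HasDerivAt (fun s => ∫ x, F x s ∂(riemannianVolume h))
      (∫ x, deriv (F x) r ∂(riemannianVolume h)) r := by
  have := hh.isLocallyFiniteMeasure
  obtain ⟨δ, hδ, hball⟩ := Metric.nhds_basis_closedBall.mem_iff.1 (isOpen_Ioo.mem_nhds hr)
  -- Compactness of `K` times a closed ball in the parameter gives the dominating constant.
  obtain ⟨C, hC⟩ := (hK.prod (isCompact_closedBall r δ)).exists_bound_of_continuousOn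
    (hF.deriv.continuousOn.mono (prod_mono (subset_univ _) hball))
  have hd0 : ∀ x ∉ K, ∀ s ∈ Ioo (-ε) ε, deriv (F x) s = 0 := fun x hx s hs => by
    have : F x =ᶠ[nhds s] fun _ => 0 := by
      filter_upwards [isOpen_Ioo.mem_nhds hs] with t ht using h0 x hx t ht
    rw [this.deriv_eq, deriv_const]
  have hcs : ∀ s ∈ Ioo (-ε) ε, Integrable (fun x => F x s) (riemannianVolume h) := fun s hs =>
    hh.integrable (hF.slice hs).continuous (HasCompactSupport.intro hK fun x hx => h0 x hx s hs)
  refine (hasDerivAt_integral_of_dominated_loc_of_deriv_le (F := fun s x => F x s)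
    (F' := fun s x => deriv (F x) s) (bound := K.indicator fun _ => C)
    (Metric.closedBall_mem_nhds r hδ) ?_ (hcs r hr) ?_ ?_ ?_ ?_).2
  · filter_upwards [isOpen_Ioo.mem_nhds hr] with s hs using (hcs s hs).aestronglyMeasurable
  · exact (hF.deriv.slice hr).continuous.aestronglyMeasurable
  · refine Filter.Eventually.of_forall fun x s hs => ?_
    by_cases hx : x ∈ K
    · rw [indicator_of_mem hx]
      exact hC (x, s) ⟨hx, hs⟩
    · rw [indicator_of_notMem hx, hd0 x hx s (hball hs), norm_zero]
  · exact (integrable_indicator_iff hK.measurableSet).2 (integrableOn_const hK.measure_lt_top.ne)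
  · refine Filter.Eventually.of_forall fun x s hs => ?_
    exact ((hF.contDiffAt x (hball hs)).differentiableAt (by simp)).hasDerivAt

theorem integral_iteratedDeriv_eq_zero {h : FormField n M} (hh : IsMetric h) {F : M → ℝ → ℝ}
    (hF : ChartSmoothFam n ε F) {K : Set M} (hK : IsCompact K)
    (h0 : ∀ x ∉ K, ∀ r ∈ Ioo (-ε) ε, F x r = 0)
    (hI : ∀ r ∈ Ioo (-ε) ε, ∫ x, F x r ∂(riemannianVolume h) = 0) (m : ℕ) :
    ∀ r ∈ Ioo (-ε) ε, ∫ x, iteratedDeriv m (F x) r ∂(riemannianVolume h) = 0 := by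
  induction m with
  | zero => simpa using hI
  | succ m ih =>
    intro r hr
    have hz : ∀ x ∉ K, ∀ r ∈ Ioo (-ε) ε, iteratedDeriv m (F x) r = 0 := fun x hx r hr => by
      have : F x =ᶠ[nhds r] fun _ => 0 := by
        filter_upwards [isOpen_Ioo.mem_nhds hr] with t ht using h0 x hx t ht
      rw [this.iteratedDeriv_eq]
      simp
    have h1 := hasDerivAt_integral_param hh (hF.iteratedDeriv m) hK hz hr
    have h2 : (fun s => ∫ x, iteratedDeriv m (F x) s ∂(riemannianVolume h)) =ᶠ[nhds r]
        fun _ => 0 := by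
      filter_upwards [isOpen_Ioo.mem_nhds hr] with s hs using ih s hs
    simp only [iteratedDeriv_succ]
    rw [← h1.deriv, h2.deriv_eq, deriv_const]

/-! ### Symmetry of the Taylor coefficients -/

/-- The integral of `u M̃(ρ)v - v M̃(ρ)u` vanishes for every `ρ`, hence so does its `a`-th
derivative at `0`, taken under the integral. -/
theorem integral_mul_Pmap_comm (hε : 0 < ε) (g : MetricFamily n M ε) (a : ℕ)
    {u v : smoothFns n M} (hcu : HasCompactSupport u.1) (hcv : HasCompactSupport v.1) :
    ∫ p, u.1 p * (Pmap hε g a v).1 p ∂(riemannianVolume (g.metric 0)) =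
      ∫ p, v.1 p * (Pmap hε g a u).1 p ∂(riemannianVolume (g.metric 0)) := by
  have h0 : (0 : ℝ) ∈ Ioo (-ε) ε := ⟨by linarith, hε⟩
  have hh := g.isMetric h0
  have hMu := chartSmoothFam_Mtilde g hε (ChartSmooth.const (ε := ε) u.2)
  have hMv := chartSmoothFam_Mtilde g hε (ChartSmooth.const (ε := ε) v.2)
  have hFu : ChartSmoothFam n ε fun x ρ => u.1 x * Mtilde g ρ v.1 x :=
    (ChartSmooth.const u.2).mul hMv
  have hFv : ChartSmoothFam n ε fun x ρ => -1 * (v.1 x * Mtilde g ρ u.1 x) :=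
    ((ChartSmooth.const v.2).mul hMu).const_mul (-1)
  -- Locality of `M̃(ρ)` makes the support of `u` alone a common compact support for all `ρ`.
  have hz : ∀ x ∉ tsupport u.1, ∀ ρ ∈ Ioo (-ε) ε,
      u.1 x * Mtilde g ρ v.1 x + -1 * (v.1 x * Mtilde g ρ u.1 x) = 0 := fun x hx ρ hρ => by
    rw [image_eq_zero_of_notMem_tsupport hx,
      Mtilde_eq_zero g hε u.2 (notMem_tsupport_iff_eventuallyEq.1 hx) hρ]
    ring
  have hI : ∀ ρ ∈ Ioo (-ε) ε, ∫ x, u.1 x * Mtilde g ρ v.1 x + -1 * (v.1 x * Mtilde g ρ u.1 x)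
      ∂(riemannianVolume (g.metric 0)) = 0 := fun ρ hρ => by
    rw [integral_add (hh.integrable (hFu.slice hρ).continuous hcu.mul_right)
      (hh.integrable (hFv.slice hρ).continuous (HasCompactSupport.mul_left hcv.mul_right)),
      integral_const_mul, integral_mul_Mtilde_comm hε g u.2 v.2 hcu hcv hρ]
    ring
  have h1 := integral_iteratedDeriv_eq_zero hh (hFu.add hFv) hcu.isCompact hz hI a 0 h0
  have h2 : ∀ x, iteratedDeriv a
      (fun ρ => u.1 x * Mtilde g ρ v.1 x + -1 * (v.1 x * Mtilde g ρ u.1 x)) 0 =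
      (a.factorial : ℝ) * (u.1 x * (Pmap hε g a v).1 x - v.1 x * (Pmap hε g a u).1 x) := by
    intro x
    rw [iteratedDeriv_fun_add ((hFu.contDiffAt x h0).of_le (natCast_le_infty a))
      ((hFv.contDiffAt x h0).of_le (natCast_le_infty a)), iteratedDeriv_const_mul_field,
      iteratedDeriv_const_mul_field, iteratedDeriv_const_mul_field, Pmap_apply, Pmap_apply]
    have : (a.factorial : ℝ) ≠ 0 := by exact_mod_cast a.factorial_ne_zero
    field_simp
    ring
  simp only [h2] at h1
  rw [integral_const_mul, mul_eq_zero_iff_left (by exact_mod_cast a.factorial_ne_zero),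
    integral_sub, sub_eq_zero] at h1
  · exact h1
  · exact hh.integrable (u.2.mul (Pmap hε g a v).2).continuous hcu.mul_right
  · exact hh.integrable (v.2.mul (Pmap hε g a u).2).continuous hcv.mul_right

theorem integral_mul_seqComp (hε : 0 < ε) (g : MetricFamily n M ε) (A : List ℕ)
    {u v : smoothFns n M} (hcu : HasCompactSupport u.1) (hcv : HasCompactSupport v.1) :
    ∫ p, u.1 p * (seqComp (Pmap hε g) A v).1 p ∂(riemannianVolume (g.metric 0)) =
      ∫ p, v.1 p * (seqComp (Pmap hε g) A.reverse u).1 p ∂(riemannianVolume (g.metric 0)) := by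
  induction A generalizing v with
  | nil => simp only [seqComp, List.reverse_nil, List.foldl_nil, mul_comm]
  | cons a A ih =>
    rw [List.reverse_cons, seqComp_append]
    refine (ih (hasCompactSupport_Pmap hε g a hcv)).trans ?_
    simp only [mul_comm ((Pmap hε g a v).1 _)]
    exact integral_mul_Pmap_comm hε g a (hasCompactSupport_seqComp hε g _ hcu) hcv

theorem integral_mul_seqComp_mulMap (hε : 0 < ε) (g : MetricFamily n M ε) (A' A : List ℕ)
    (b : smoothFns n M) {u v : smoothFns n M} (hcu : HasCompactSupport u.1)
    (hcv : HasCompactSupport v.1) :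
    ∫ p, u.1 p * (seqComp (Pmap hε g) A' (mulMap b (seqComp (Pmap hε g) A v))).1 p
        ∂(riemannianVolume (g.metric 0)) =
      ∫ p, v.1 p * (seqComp (Pmap hε g) A.reverse
        (mulMap b (seqComp (Pmap hε g) A'.reverse u))).1 p ∂(riemannianVolume (g.metric 0)) := by
  have h1 : ∀ {w : smoothFns n M}, HasCompactSupport w.1 → HasCompactSupport (mulMap b w).1 :=
    fun hw => hw.mul_left
  have hA := hasCompactSupport_seqComp hε g A hcv
  have hA' := hasCompactSupport_seqComp hε g A'.reverse hcu
  rw [integral_mul_seqComp hε g A' hcu (h1 hA), ← integral_mul_seqComp hε g A (h1 hA') hcv]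
  congr 1
  ext p
  simp only [mulMap, LinearMap.coe_mk, AddHom.coe_mk]
  ring

/-! ### Formal self-adjointness -/

/-- The pairing with a compactly supported smooth function. -/
def pairing {h : FormField n M} (hh : IsMetric h) (u : smoothFns n M)
    (hc : HasCompactSupport u.1) : smoothFns n M →ₗ[ℝ] ℝ where
  toFun v := ∫ p, u.1 p * v.1 p ∂(riemannianVolume h)
  map_add' v w := by
    rw [← integral_add (hh.integrable (u.2.mul v.2).continuous hc.mul_right)
      (hh.integrable (u.2.mul w.2).continuous hc.mul_right)]
    simp only [Submodule.coe_add, Pi.add_apply, mul_add]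
  map_smul' c v := by
    simp only [Submodule.coe_smul, Pi.smul_apply, smul_eq_mul, mul_left_comm _ c,
      integral_const_mul, RingHom.id_apply]

theorem pairing_Dmap_comm (hε : 0 < ε) (g : MetricFamily n M ε) {f : M → ℝ → ℝ}
    (hf : ChartSmoothFam n ε f) (U : ℕ) (L : ℝ) {h : IsMetric (g.metric 0)} {u v : smoothFns n M}
    (hcu : HasCompactSupport u.1) (hcv : HasCompactSupport v.1) :
    pairing h u hcu (Dmap hε g hf U L v) = pairing h v hcv (Dmap hε g hf U L u) := by
  -- The values `-k` excluded from the expansion form a countable set, so its complement is dense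
  -- and equality there extends to every `L` by continuity.
  have hfin : ((fun k : ℕ => -(k : ℝ)) '' Iio U).Countable := (to_countable _).image _
  refine congrFun (Continuous.ext_on (hfin.dense_compl ℝ)
    (weaklyContinuous_Dmap hε g hf U v (pairing h u hcu))
    (weaklyContinuous_Dmap hε g hf U u (pairing h v hcv)) fun l hl => ?_) L
  have hl' : ∀ k : ℕ, k < U → l + k ≠ 0 := fun k hk h0 =>
    hl ⟨k, hk, by linarith⟩
  beta_reduce
  rw [Dmap_eq_sum hε g hf hl', Dmap_eq_sum hε g hf hl', map_sum, map_sum]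
  -- Transposition reverses and swaps the two sequences. This involution preserves the index set and
  -- the coefficients, so the two sums match term by term.
  refine Finset.sum_nbij' (fun t => (t.1, t.2.2.reverse, t.2.1.reverse))
    (fun t => (t.1, t.2.2.reverse, t.2.1.reverse)) ?_ ?_ ?_ ?_ fun t _ => ?_
  · intro t ht
    simp only [indexSet, Finite.mem_toFinset, mem_ofPred_eq, weight, List.length_reverse,
      List.sum_reverse] at ht ⊢
    omega
  · intro t ht
    simp only [indexSet, Finite.mem_toFinset, mem_ofPred_eq, weight, List.length_reverse,
      List.sum_reverse] at ht ⊢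
    omega
  · simp
  · simp
  · rw [map_smul, map_smul]
    congr 1
    · simp only [taylorExpCoeff, List.reverse_reverse]
      ring
    · exact integral_mul_seqComp_mulMap hε g _ _ _ hcu hcv

theorem isFormallySelfAdjoint_DUVLK (hε : 0 < ε) (g : MetricFamily n M ε) {f : M → ℝ → ℝ}
    (hf : ChartSmoothFam n ε f) (U : ℕ) (L : ℝ) :
    IsFormallySelfAdjoint (g.metric 0) (DUVLK g U U L 0 f) := by
  intro u v hu hv hcu hcv
  have hh := g.isMetric (show (0 : ℝ) ∈ Ioo (-ε) ε from ⟨by linarith, hε⟩)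
  set u' : smoothFns n M := ⟨u, ContMDiff.chartSmooth hu⟩
  set v' : smoothFns n M := ⟨v, ContMDiff.chartSmooth hv⟩
  have e1 : DUVLK g U U L 0 f u = (Dmap hε g hf U L u').1 :=
    funext fun x => DUVLK_eq_Dmap hε g hf U L u' x
  have e2 : DUVLK g U U L 0 f v = (Dmap hε g hf U L v').1 :=
    funext fun x => DUVLK_eq_Dmap hε g hf U L v' x
  rw [e1, e2]
  exact ⟨hh.integrable (u'.2.mul (Dmap hε g hf U L v').2).continuous hcu.mul_right,
    hh.integrable (v'.2.mul (Dmap hε g hf U L u').2).continuous hcv.mul_right,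
    pairing_Dmap_comm hε g hf U L (h := hh) (u := u') (v := v') hcu hcv⟩

end

end JuhlLinear

end

theorem mainTheorem7 (n : ℕ) (M : Type*) [TopologicalSpace M] [T2Space M]
    [SecondCountableTopology M] [ChartedSpace (JuhlLinear.E n) M] [IsManifold (𝓡 n) ∞ M]
    [MeasurableSpace M] [BorelSpace M]
    (ε : ℝ) (hε : 0 < ε) (g : JuhlLinear.MetricFamily n M ε)
    (f : M → ℝ → ℝ)
    (hf : ContMDiffOn ((𝓡 n).prod 𝓘(ℝ)) 𝓘(ℝ) ∞ (fun p : M × ℝ => f p.1 p.2)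
      (Set.univ ×ˢ Set.Ioo (-ε) ε))
    (U : ℕ) (L : ℝ) :
    ((∀ k : ℕ, k < U → L + k ≠ 0) →
      ∀ u : M → ℝ, ContMDiff (𝓡 n) 𝓘(ℝ) ∞ u → ∀ x : M,
        JuhlLinear.DUVLK g U U L 0 f u x =
          ∑ t ∈ JuhlLinear.indexSet U,
            JuhlLinear.coeff U L t.1 t.2.1 t.2.2 *
              JuhlLinear.Mcomp g t.2.1
                (fun y => iteratedDeriv t.1 (f y) 0 * JuhlLinear.Mcomp g t.2.2 u y) x) ∧
    (∀ (R : ℕ) (A' A : List ℕ),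
      JuhlLinear.coeff U L R A' A = JuhlLinear.coeff U L R A.reverse A'.reverse) ∧
    JuhlLinear.IsFormallySelfAdjoint (g.metric 0) (JuhlLinear.DUVLK g U U L 0 f) := by
  refine ⟨fun hL u hu x => ?_, fun R A' A => JuhlLinear.coeff_reverse U L R A' A, ?_⟩
  · exact JuhlLinear.DUVLK_eq_sum hε g (JuhlLinear.ContMDiffOn.chartSmoothFam hf) hL
      ⟨u, JuhlLinear.ContMDiff.chartSmooth hu⟩ x
  · exact JuhlLinear.isFormallySelfAdjoint_DUVLK hε g (JuhlLinear.ContMDiffOn.chartSmoothFam hf) U L
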